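/- Let $d\ge 2$ and let $g$ be the Coulomb kernel on $\mathbf R^d$: $g(x)=-\frac1{2\pi}\log|x|$ if $d=2$ and $g(x)=\frac{1}{(d-2)|S^{d-1}|}\,|x|^{2-d}$ if $d\ge 3$. For a signed measure $\mu$ of bounded variation on $\mathbf R^d$ let $$\mathcal E(\mu)=\iint_{x\ne y} g(x-y)\,d\mu(x)\,d\mu(y)\in[-\infty,\infty],$$ whenever this double integral is well defined, i.e. whenever the positive and the negative part of the integrand (with respect to the signed measure $\mu\otimes\mu$) do not both have infinite integral. For a compact set $K\subset\mathbf R^d$ and a signed measure $\mu$ of bounded variation on $K$ let $$\|\mu\|_{H^{-1}(K)}=\sup_f \frac{\int_K f\,d\mu}{\|f\|_{H^1}}\in[0,\infty],\qquad \|f\|_{H^1}^2=\|f\|_{L^2}^2+\|\nabla f\|_{L^2}^2,$$ where the supremum is over the functions $f$ that are continuous on $K$ and belong to $H^1$ of the interior of $K$, the norm $\|f\|_{H^1}$ is taken over the interior of $K$, and $0/0=0$, $a/0=+\infty$ for $a>0$. We say that $K$ has Lipschitz boundary if near each of its boundary points $K$ is, up to a rigid motion, the set of points on or above the graph of a Lipschitz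 function of $d-1$ variables. **Proposition.** Let $K\subset\mathbf R^d$ be compact. All measures $\mu$ below are signed measures of bounded variation on $K$ for which $\mathcal E(\mu)$ is well defined. a) Let $d=2$ and suppose that $K$ has Lipschitz boundary. There is a constant $C>0$, depending only on $K$, such that every $\mu$ without atoms and with $\int_K d\mu=0$ satisfies $\mathcal E(\mu)\ge 0$ and $\|\mu\|_{H^{-1}(K)}\le C\sqrt{\mathcal E(\mu)}$. b) Let $d\ge 3$. If $K$ has Lipschitz boundary, there is a constant $C>0$, depending only on $K$ (and $d$), such that every $\mu$ without atoms satisfies $\mathcal E(\mu)\ge 0$ and $\|\mu\|_{H^{-1}(K)}\le C\sqrt{\mathcal E(\mu)}$. Moreover, for every compact $K$, there is a constant $c>0$, depending only on $K$ (and $d$), such that every $\mu$ with $\int_K d\mu\ne 0$ satisfies $\sqrt{\mathcal E(\mu)}\le c^{-1}\|\mu\|_{H^{-1}(K)}$ (where $\sqrt{\mathcal E(\mu)}$ is read as $0$ should $\mathcal E(\mu)$ be negative, which can only happen if $\mu$ has atoms). -/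

import Mathlib

open MeasureTheory Set
open scoped ENNReal NNReal ContDiff

namespace Coulomb

noncomputable section

/-- The normalising constant of the Coulomb kernel: `1 / (2π)` if `d = 2` and
`1 / ((d - 2) |S^{d-1}|)` if `d ≥ 3`, where `|S^{d-1}| = d |B(0, 1)|`. -/
def kernelConst (d : ℕ) : ℝ :=
  if d = 2 then 1 / (2 * Real.pi)
  else 1 / (((d : ℝ) - 2) * (d * volume.real (Metric.ball (0 : EuclideanSpace ℝ (Fin d)) 1)))

/-- The Coulomb kernel (`d ≥ 2`): `-c log |x|` if `d = 2` and `c / |x|^(d-2)` if `d ≥ 3`.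
It is only used away from the origin. -/
def kernel (d : ℕ) (x : EuclideanSpace ℝ (Fin d)) : ℝ :=
  if d = 2 then -kernelConst d * Real.log ‖x‖ else kernelConst d / ‖x‖ ^ (d - 2)

variable {d : ℕ}

/-- The restriction to the complement of the diagonal of the positive part
`μ⁺ ⊗ μ⁺ + μ⁻ ⊗ μ⁻` of the signed product measure `μ ⊗ μ`. -/
def offDiagPos (μ : SignedMeasure (EuclideanSpace ℝ (Fin d))) :
    Measure (EuclideanSpace ℝ (Fin d) × EuclideanSpace ℝ (Fin d)) :=
  (μ.toJordanDecomposition.posPart.prod μ.toJordanDecomposition.posPart +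
    μ.toJordanDecomposition.negPart.prod μ.toJordanDecomposition.negPart).restrict
      (Set.diagonal (EuclideanSpace ℝ (Fin d)))ᶜ

/-- The restriction to the complement of the diagonal of the negative part
`μ⁺ ⊗ μ⁻ + μ⁻ ⊗ μ⁺` of the signed product measure `μ ⊗ μ`. -/
def offDiagNeg (μ : SignedMeasure (EuclideanSpace ℝ (Fin d))) :
    Measure (EuclideanSpace ℝ (Fin d) × EuclideanSpace ℝ (Fin d)) :=
  (μ.toJordanDecomposition.posPart.prod μ.toJordanDecomposition.negPart +
    μ.toJordanDecomposition.negPart.prod μ.toJordanDecomposition.posPart).restrict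
      (Set.diagonal (EuclideanSpace ℝ (Fin d)))ᶜ

/-- The integral of the positive part of the integrand `g(x - y) d(μ ⊗ μ)(x, y)` off the
diagonal. -/
def energyPos (μ : SignedMeasure (EuclideanSpace ℝ (Fin d))) : ℝ≥0∞ :=
  (∫⁻ z, ENNReal.ofReal (kernel d (z.1 - z.2)) ∂offDiagPos μ) +
    ∫⁻ z, ENNReal.ofReal (-kernel d (z.1 - z.2)) ∂offDiagNeg μ

/-- The integral of the negative part of the integrand `g(x - y) d(μ ⊗ μ)(x, y)` off the
diagonal. -/
def energyNeg (μ : SignedMeasure (EuclideanSpace ℝ (Fin d))) : ℝ≥0∞ :=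
  (∫⁻ z, ENNReal.ofReal (-kernel d (z.1 - z.2)) ∂offDiagPos μ) +
    ∫⁻ z, ENNReal.ofReal (kernel d (z.1 - z.2)) ∂offDiagNeg μ

/-- The double integral defining the energy makes sense in `[-∞, ∞]`, i.e. it is not of the
form `∞ - ∞`. -/
def EnergyDefined (μ : SignedMeasure (EuclideanSpace ℝ (Fin d))) : Prop :=
  energyPos μ ≠ ⊤ ∨ energyNeg μ ≠ ⊤

/-- The Coulomb energy `𝓔(μ) = ∬_{x ≠ y} g(x - y) dμ(x) dμ(y)`, with values in `[-∞, ∞]`. -/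
def energy (μ : SignedMeasure (EuclideanSpace ℝ (Fin d))) : EReal :=
  (energyPos μ : EReal) - (energyNeg μ : EReal)

/-- `√𝓔(μ)` with values in `[0, ∞]` (and value `0` if `𝓔(μ) < 0`). -/
def sqrtEnergy (μ : SignedMeasure (EuclideanSpace ℝ (Fin d))) : ℝ≥0∞ :=
  (energy μ).toENNReal ^ (1 / 2 : ℝ)

/-- `μ` is a measure on `K`: its total variation vanishes outside of `K`. -/
def IsOn (μ : SignedMeasure (EuclideanSpace ℝ (Fin d))) (K : Set (EuclideanSpace ℝ (Fin d))) :
    Prop :=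
  μ.totalVariation Kᶜ = 0

/-- `G` is the weak gradient of `f` in the open set `Ω`. -/
def HasWeakGradient (Ω : Set (EuclideanSpace ℝ (Fin d))) (f : EuclideanSpace ℝ (Fin d) → ℝ)
    (G : EuclideanSpace ℝ (Fin d) → EuclideanSpace ℝ (Fin d)) : Prop :=
  ∀ φ : EuclideanSpace ℝ (Fin d) → ℝ, ContDiff ℝ ∞ φ → HasCompactSupport φ → tsupport φ ⊆ Ω →
    ∀ v : EuclideanSpace ℝ (Fin d),
      ∫ x in Ω, f x * fderiv ℝ φ x v = -∫ x in Ω, inner ℝ (G x) v * φ x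

/-- `f ∈ H¹(Ω)` with weak gradient `G`. -/
structure IsH1 (Ω : Set (EuclideanSpace ℝ (Fin d))) (f : EuclideanSpace ℝ (Fin d) → ℝ)
    (G : EuclideanSpace ℝ (Fin d) → EuclideanSpace ℝ (Fin d)) : Prop where
  memLp : MemLp f 2 (volume.restrict Ω)
  memLp_grad : MemLp G 2 (volume.restrict Ω)
  weakGradient : HasWeakGradient Ω f G

/-- The norm `(‖f‖²_{L²(Ω)} + ‖G‖²_{L²(Ω)})^{1/2}`, for `G` the weak gradient of `f`. -/
def h1Norm (Ω : Set (EuclideanSpace ℝ (Fin d))) (f : EuclideanSpace ℝ (Fin d) → ℝ)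
    (G : EuclideanSpace ℝ (Fin d) → EuclideanSpace ℝ (Fin d)) : ℝ :=
  Real.sqrt ((∫ x in Ω, f x ^ 2) + ∫ x in Ω, ‖G x‖ ^ 2)

/-- The norm `‖μ‖_{H⁻¹(K)} = sup (∫ f dμ) / ‖f‖_{H¹}` of a measure on `K`, with values in
`[0, ∞]`. The supremum is over the functions of class `H¹` in the interior of `K` for which the
pairing with an arbitrary measure on `K` makes sense: those which are continuous on `K`. (Negative
quotients do not contribute, as `f` may be replaced by `-f`; `0 / 0 = 0` and `a / 0 = ∞` for
`a > 0`.) -/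
def hMinusOneNorm (K : Set (EuclideanSpace ℝ (Fin d)))
    (μ : SignedMeasure (EuclideanSpace ℝ (Fin d))) : ℝ≥0∞ :=
  ⨆ (f : EuclideanSpace ℝ (Fin d) → ℝ)
    (G : EuclideanSpace ℝ (Fin d) → EuclideanSpace ℝ (Fin d))
    (_ : ContinuousOn f K) (_ : IsH1 (interior K) f G),
    ENNReal.ofReal (∫ᵛ x, f x ∂<•μ) / ENNReal.ofReal (h1Norm (interior K) f G)

/-- `K` has Lipschitz boundary: near each boundary point `x`, and for a suitable unit vector `e`,
the set `K` is the region on or above the graph, in direction `e`, of a Lipschitz function on the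
hyperplane orthogonal to `e`. -/
def HasLipschitzBoundary (K : Set (EuclideanSpace ℝ (Fin d))) : Prop :=
  ∀ x ∈ frontier K, ∃ (e : EuclideanSpace ℝ (Fin d)) (L : ℝ≥0) (γ : (ℝ ∙ e)ᗮ → ℝ) (r : ℝ),
    ‖e‖ = 1 ∧ LipschitzWith L γ ∧ 0 < r ∧
      ∀ y ∈ Metric.ball x r,
        y ∈ K ↔ γ ((ℝ ∙ e)ᗮ.orthogonalProjectionOnto y) ≤ inner ℝ e y

end

end Coulomb

open MeasureTheory Set
open scoped ENNReal NNReal ContDiff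

namespace Coulomb

noncomputable section

/-! Write p_t for the heat kernel. Up to a positive factor A the Coulomb kernel is the integral of
p_t over t in (0, ∞) (`exists_kernel_eq`); for d = 2 this converges only after subtracting a
function of t alone, which neutrality of the measure makes harmless. By the semigroup property the
quadratic form of p_t at μ is the squared L² norm of p_{t/2} * μ. For atomless μ of finite energy,
Fubini turns A 𝓔(μ) into the time integral of these squares (`energy_of_heat_le`), hence 𝓔(μ) ≥ 0.
Singular potentials are avoided by integrating over t in (δ, T] only.

The energy bounds the dual norm: let F be Lipschitz with compact support in the whole space. Since
∂_t p_t = Δ p_t, an integration by parts identifies the pairing of μ with F * (p_δ - p_T) with the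
L² pairing of ∇F and the time integral of ∇p_t * μ. The L² norm of the latter is again controlled by
the time integral of the quadratic forms. As δ → 0 and T → ∞ this gives |∫ F dμ| ≤ ‖∇F‖ √(A 𝓔(μ))
(`abs_sint_le`). It remains to approximate f on K by such F. A partition of unity localises f, a
mollifier pointing into K smooths it without looking outside of K, and a reflection in the Lipschitz
graph extends it (`IsChart`). The Dirichlet integral stays bounded by the H¹ norm of f, and the
approximation converges at every point of K, as it must, because μ may charge Lebesgue null sets
such as the boundary.

The dual norm n bounds the energy if d ≥ 3: the test function is the truncated potential U of μ
itself, the time integral over (δ, T] of p_t * μ. Its pairing with μ is the time integral Q of the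
quadratic forms, while ‖U‖²_{H¹} ≤ B Q + O(δ). So Q ≤ n ‖U‖_{H¹}, and δ → 0 gives Q ≤ B n². The
dimension enters through the integrability of t^(-d/2) at infinity, which bounds the large time part
of U. Atoms do no harm: leaving out the diagonal only lowers the positive part of the energy, and
the two Jordan parts have no common atoms. -/

variable {d : ℕ}

/-! ### The heat kernel, its derivatives and Gaussian bounds -/

/-- The heat kernel. -/
def heat (t : ℝ) (x : EuclideanSpace ℝ (Fin d)) : ℝ :=
  (4 * Real.pi * t) ^ (-(d : ℝ) / 2) * Real.exp (-(1 / (4 * t)) * ‖x‖ ^ 2)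

/-- The gradient of the heat kernel. -/
def heatGrad (t : ℝ) (x : EuclideanSpace ℝ (Fin d)) : EuclideanSpace ℝ (Fin d) :=
  (-(1 / (2 * t)) * heat t x) • x

/-- The Laplacian of the heat kernel, which is also its time derivative. -/
def heatLap (t : ℝ) (x : EuclideanSpace ℝ (Fin d)) : ℝ :=
  heat t x * (‖x‖ ^ 2 / (4 * t ^ 2) - d / (2 * t))

lemma heat_pos {t : ℝ} (ht : 0 < t) (x : EuclideanSpace ℝ (Fin d)) : 0 < heat t x := by
  unfold heat; positivity

lemma heat_le {t : ℝ} (ht : 0 < t) (x : EuclideanSpace ℝ (Fin d)) :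
    heat t x ≤ (4 * Real.pi * t) ^ (-(d : ℝ) / 2) := by
  unfold heat
  refine mul_le_of_le_one_right (by positivity) (Real.exp_le_one_iff.2 ?_)
  have : 0 ≤ (1 / (4 * t)) * ‖x‖ ^ 2 := by positivity
  linarith

lemma heat_zero (t : ℝ) :
    heat t (0 : EuclideanSpace ℝ (Fin d)) = (4 * Real.pi * t) ^ (-(d : ℝ) / 2) := by
  simp [heat]

lemma hasDerivAt_heat {t : ℝ} (ht : 0 < t) (x : EuclideanSpace ℝ (Fin d)) :
    HasDerivAt (fun s ↦ heat s x) (heatLap t x) t := by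
  have h0 : (4 * Real.pi * t) ≠ 0 := by positivity
  have h1 : HasDerivAt (fun s : ℝ ↦ 4 * Real.pi * s) (4 * Real.pi) t := by
    simpa using (hasDerivAt_id t).const_mul (4 * Real.pi)
  have h2 := h1.rpow_const (p := -(d : ℝ) / 2) (Or.inl h0)
  have h3 : HasDerivAt (fun s : ℝ ↦ -(1 / (4 * s)) * ‖x‖ ^ 2) (‖x‖ ^ 2 / (4 * t ^ 2)) t := by
    have := (((hasDerivAt_id t).const_mul 4).inv (by simpa using ht.ne')).neg.mul_const (‖x‖ ^ 2)
    simp only [id] at this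
    have e : (fun s : ℝ ↦ -(1 / (4 * s)) * ‖x‖ ^ 2) = fun y ↦ (-(fun y : ℝ ↦ 4 * y)⁻¹) y * ‖x‖ ^ 2 := by
      ext s; simp
    rw [e]
    refine this.congr_deriv ?_
    field_simp
  refine (h2.mul h3.exp).congr_deriv ?_
  unfold heatLap heat
  rw [Real.rpow_sub_one h0]
  field_simp
  ring

lemma hasFDerivAt_heat (t : ℝ) (x : EuclideanSpace ℝ (Fin d)) :
    HasFDerivAt (heat t) (innerSL ℝ (heatGrad t x)) x := by
  have h := (((hasStrictFDerivAt_norm_sq x).hasFDerivAt.const_mul (-(1 / (4 * t)))).exp).const_mul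
    ((4 * Real.pi * t) ^ (-(d : ℝ) / 2))
  refine h.congr_fderiv ?_
  ext v
  simp only [heatGrad, heat, innerSL_apply_apply, inner_smul_left, smul_apply,
    smul_eq_mul, conj_trivial]
  rw [nsmul_eq_mul]
  push_cast
  ring

lemma contDiff_heat (t : ℝ) : ContDiff ℝ ∞ (heat t : EuclideanSpace ℝ (Fin d) → ℝ) := by
  unfold heat
  exact contDiff_const.mul (Real.contDiff_exp.comp (contDiff_const.mul (contDiff_norm_sq ℝ)))

lemma contDiff_heatGrad (t : ℝ) :
    ContDiff ℝ ∞ (heatGrad t : EuclideanSpace ℝ (Fin d) → EuclideanSpace ℝ (Fin d)) := by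
  unfold heatGrad
  exact (contDiff_const.mul (contDiff_heat t)).smul contDiff_id

lemma hasFDerivAt_heatGrad_apply (t : ℝ) (x : EuclideanSpace ℝ (Fin d)) (i : Fin d) :
    HasFDerivAt (fun y : EuclideanSpace ℝ (Fin d) ↦ heatGrad t y i)
      ((-(1 / (2 * t))) • (x i • innerSL ℝ (heatGrad t x) +
        heat t x • EuclideanSpace.proj (𝕜 := ℝ) i)) x := by
  have h := ((hasFDerivAt_heat t x).const_mul (-(1 / (2 * t)))).mul
    (EuclideanSpace.proj (𝕜 := ℝ) i : EuclideanSpace ℝ (Fin d) →L[ℝ] ℝ).hasFDerivAt (x := x)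
  refine h.congr_fderiv ?_
  ext v
  simp
  ring

/-- The sum over `i` of the derivatives of the components of the gradient of the heat kernel. -/
lemma sum_deriv_heatGrad {t : ℝ} (ht : 0 < t) (x : EuclideanSpace ℝ (Fin d)) :
    ∑ i, ((-(1 / (2 * t))) • (x i • innerSL ℝ (heatGrad t x) +
        heat t x • EuclideanSpace.proj (𝕜 := ℝ) i)) (EuclideanSpace.single i 1) = heatLap t x := by
  simp only [heatGrad, smul_apply, add_apply,
    innerSL_apply_apply, inner_smul_left, EuclideanSpace.inner_single_right,
    PiLp.proj_apply, EuclideanSpace.proj, smul_eq_mul]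
  simp only [conj_trivial, PiLp.single_apply, if_true, one_mul, mul_one, heatLap]
  rw [EuclideanSpace.norm_sq_eq, ← Finset.mul_sum, Finset.sum_add_distrib]
  simp only [Finset.sum_const, Finset.card_univ, Fintype.card_fin, nsmul_eq_mul, Real.norm_eq_abs,
    sq_abs]
  have : ∑ i, x i * (-(1 / (2 * t)) * heat t x * x i) =
    (-(1 / (2 * t)) * heat t x) * ∑ i, x i ^ 2 := by
    rw [Finset.mul_sum]
    exact Finset.sum_congr rfl fun i _ ↦ by ring
  rw [this]
  field_simp
  ring

lemma continuousOn_heat : ContinuousOn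
    (fun z : ℝ × EuclideanSpace ℝ (Fin d) ↦ heat z.1 z.2) (Ioi 0 ×ˢ univ) := by
  unfold heat
  have h : ∀ z ∈ (Ioi (0 : ℝ) ×ˢ (univ : Set (EuclideanSpace ℝ (Fin d)))), z.1 ≠ 0 :=
    fun z hz ↦ (mem_Ioi.1 hz.1).ne'
  refine ContinuousOn.mul (ContinuousOn.rpow_const (by fun_prop) fun z hz ↦ Or.inl ?_)
    (ContinuousOn.rexp (ContinuousOn.mul (ContinuousOn.neg (ContinuousOn.div (by fun_prop)
      (by fun_prop) fun z hz ↦ ?_)) (by fun_prop)))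
  · have := h z hz; positivity
  · have := h z hz; positivity

lemma continuousOn_heatGrad : ContinuousOn
    (fun z : ℝ × EuclideanSpace ℝ (Fin d) ↦ heatGrad z.1 z.2) (Ioi 0 ×ˢ univ) := by
  unfold heatGrad
  refine ContinuousOn.smul (ContinuousOn.mul (ContinuousOn.neg (ContinuousOn.div (by fun_prop)
    (by fun_prop) fun z hz ↦ ?_)) continuousOn_heat) (by fun_prop)
  have := (mem_Ioi.1 hz.1).ne'; positivity

lemma continuousOn_heatLap : ContinuousOn
    (fun z : ℝ × EuclideanSpace ℝ (Fin d) ↦ heatLap z.1 z.2) (Ioi 0 ×ˢ univ) := by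
  unfold heatLap
  refine continuousOn_heat.mul (ContinuousOn.sub (ContinuousOn.div (by fun_prop)
    (by fun_prop) fun z hz ↦ ?_) (ContinuousOn.div (by fun_prop)
    (by fun_prop) fun z hz ↦ ?_))
  all_goals have := (mem_Ioi.1 hz.1).ne'; positivity

lemma measurable_heat : Measurable (fun z : ℝ × EuclideanSpace ℝ (Fin d) ↦ heat z.1 z.2) := by
  unfold heat; fun_prop

lemma measurable_heatGrad :
    Measurable (fun z : ℝ × EuclideanSpace ℝ (Fin d) ↦ heatGrad z.1 z.2) := by
  unfold heatGrad
  exact ((by fun_prop : Measurable fun z : ℝ × EuclideanSpace ℝ (Fin d) ↦ -(1 / (2 * z.1))).mul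
    measurable_heat).smul measurable_snd

lemma measurable_heatLap :
    Measurable (fun z : ℝ × EuclideanSpace ℝ (Fin d) ↦ heatLap z.1 z.2) := by
  unfold heatLap
  exact measurable_heat.mul (by fun_prop)

/-- The Gaussian used to dominate the heat kernel and its derivatives at times at most `T`. -/
def envelope (T : ℝ) (x : EuclideanSpace ℝ (Fin d)) : ℝ := Real.exp (-(1 / (8 * T)) * ‖x‖ ^ 2)

lemma integrable_exp_neg_mul_sq_norm {b : ℝ} (hb : 0 < b) :
    Integrable (fun x : EuclideanSpace ℝ (Fin d) ↦ Real.exp (-b * ‖x‖ ^ 2)) := by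
  refine Integrable.of_integral_ne_zero ?_
  rw [GaussianFourier.integral_rexp_neg_mul_sq_norm hb]
  positivity

lemma integrable_envelope {T : ℝ} (hT : 0 < T) :
    Integrable (envelope T : EuclideanSpace ℝ (Fin d) → ℝ) :=
  integrable_exp_neg_mul_sq_norm (by positivity)

lemma envelope_nonneg (T : ℝ) (x : EuclideanSpace ℝ (Fin d)) : 0 ≤ envelope T x :=
  (Real.exp_pos _).le

lemma envelope_le_one {T : ℝ} (hT : 0 < T) (x : EuclideanSpace ℝ (Fin d)) : envelope T x ≤ 1 := by
  refine Real.exp_le_one_iff.2 ?_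
  have : 0 ≤ (1 / (8 * T)) * ‖x‖ ^ 2 := by positivity
  linarith

/-- For t ≤ T the Gaussian factor of the heat kernel is at most the square of `envelope T`. One of
the two factors absorbs the polynomials in ‖x‖ created by differentiation, the other remains as an
integrable majorant; t ≥ δ bounds the negative powers of t. -/
lemma exists_heat_bound {δ T : ℝ} (hδ : 0 < δ) : ∃ C : ℝ, 0 ≤ C ∧
    ∀ t ∈ Icc δ T, ∀ x : EuclideanSpace ℝ (Fin d), |heat t x| ≤ C * envelope T x ∧
      ‖heatGrad t x‖ ≤ C * envelope T x ∧ |heatLap t x| ≤ C * envelope T x := by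
  rcases le_or_gt T 0 with hT | hT
  · exact ⟨0, le_rfl, fun t ht ↦ absurd (ht.1.trans ht.2) (by linarith)⟩
  set P := (4 * Real.pi * δ) ^ (-(d : ℝ) / 2) with hP
  have hP0 : 0 ≤ P := by positivity
  -- `A` adds up the coefficients, at their largest for t = δ, of the powers of ‖x‖ that multiply
  -- the heat kernel in the three quantities.
  set A : ℝ := 1 + 1 / (2 * δ) + 1 / (4 * δ ^ 2) + d / (2 * δ) with hA
  have hA0 : 0 ≤ A := by positivity
  refine ⟨P * A * (2 * (1 + 8 * T)), by positivity, fun t ht x ↦ ?_⟩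
  have ht0 : 0 < t := hδ.trans_le ht.1
  set r := ‖x‖ with hr
  have hr0 : 0 ≤ r := norm_nonneg x
  have hheat : heat t x ≤ P * (envelope T x * envelope T x) := by
    unfold heat envelope
    rw [← Real.exp_add]
    refine mul_le_mul (Real.rpow_le_rpow_of_nonpos (by positivity) ?_ ?_)
      (Real.exp_le_exp.2 ?_) (Real.exp_pos _).le hP0
    · have := ht.1; gcongr
    · have : (0 : ℝ) ≤ d := Nat.cast_nonneg d
      linarith
    · have h1 : 1 / (4 * T) ≤ 1 / (4 * t) := by
        have := ht.2; gcongr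
      have h2 : 1 / (8 * T) + 1 / (8 * T) = 1 / (4 * T) := by field_simp; norm_num
      nlinarith [sq_nonneg ‖x‖]
  -- From exp u ≥ 1 + u at u = r² / (8T), and 2r ≤ 1 + r².
  have hpoly : (1 + r + r ^ 2) * envelope T x ≤ 2 * (1 + 8 * T) := by
    have h1 : 1 + (1 / (8 * T)) * r ^ 2 ≤ Real.exp ((1 / (8 * T)) * r ^ 2) := by
      have := Real.add_one_le_exp ((1 / (8 * T)) * r ^ 2); linarith
    have h2 : 1 + r + r ^ 2 ≤ 2 * (1 + 8 * T) * Real.exp ((1 / (8 * T)) * r ^ 2) := by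
      refine le_trans ?_ (mul_le_mul_of_nonneg_left h1 (by positivity))
      have h3 : 2 * (1 + 8 * T) * (1 + (1 / (8 * T)) * r ^ 2) =
        2 + 16 * T + 2 * r ^ 2 + 2 * (1 / (8 * T)) * r ^ 2 := by field_simp; ring
      rw [h3]
      have : 0 ≤ 2 * (1 / (8 * T)) * r ^ 2 := by positivity
      nlinarith [sq_nonneg (r - 1)]
    calc (1 + r + r ^ 2) * envelope T x
        ≤ (2 * (1 + 8 * T) * Real.exp ((1 / (8 * T)) * r ^ 2)) * envelope T x :=
          mul_le_mul_of_nonneg_right h2 (envelope_nonneg _ _)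
      _ = 2 * (1 + 8 * T) := by
          unfold envelope
          rw [mul_assoc, ← Real.exp_add, ← hr]
          simp
  have key : ∀ m : ℝ, 0 ≤ m → m ≤ A * (1 + r + r ^ 2) →
      heat t x * m ≤ P * A * (2 * (1 + 8 * T)) * envelope T x := by
    intro m hm0 hm
    calc heat t x * m ≤ (P * (envelope T x * envelope T x)) * (A * (1 + r + r ^ 2)) := by
          have := envelope_nonneg T x
          gcongr
      _ = P * A * envelope T x * ((1 + r + r ^ 2) * envelope T x) := by ring
      _ ≤ P * A * envelope T x * (2 * (1 + 8 * T)) := by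
          have := envelope_nonneg T x
          gcongr
      _ = _ := by ring
  have hdt : 1 / (2 * t) ≤ 1 / (2 * δ) := by have := ht.1; gcongr
  have hdt2 : 1 / (4 * t ^ 2) ≤ 1 / (4 * δ ^ 2) := by have := ht.1; gcongr
  have hdt3 : (d : ℝ) / (2 * t) ≤ d / (2 * δ) := by have := ht.1; gcongr
  have p1 : 0 ≤ 1 / (2 * δ) := by positivity
  have p2 : 0 ≤ 1 / (4 * δ ^ 2) := by positivity
  have p3 : 0 ≤ (d : ℝ) / (2 * δ) := by positivity
  have hp := heat_pos ht0 x
  refine ⟨?_, ?_, ?_⟩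
  · rw [abs_of_pos hp]
    have := key 1 zero_le_one (by nlinarith [mul_nonneg hA0 hr0, mul_nonneg hA0 (sq_nonneg r)])
    simpa using this
  · have h1 : ‖heatGrad t x‖ = heat t x * (1 / (2 * t) * r) := by
      rw [heatGrad, norm_smul, norm_mul, norm_neg, Real.norm_of_nonneg hp.le,
        Real.norm_of_nonneg (by positivity)]
      ring
    rw [h1]
    refine key _ (by positivity) ?_
    calc 1 / (2 * t) * r ≤ A * r := by gcongr; linarith
      _ ≤ A * (1 + r + r ^ 2) := by gcongr; nlinarith [sq_nonneg r]
  · rw [heatLap, abs_mul, abs_of_pos hp]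
    refine key _ (abs_nonneg _) ?_
    have q1 : 0 ≤ r ^ 2 / (4 * t ^ 2) := by positivity
    have q2 : 0 ≤ (d : ℝ) / (2 * t) := by positivity
    have q3 : r ^ 2 / (4 * t ^ 2) ≤ (1 / (4 * δ ^ 2)) * r ^ 2 := by
      rw [div_eq_mul_one_div, mul_comm]; gcongr
    calc |r ^ 2 / (4 * t ^ 2) - d / (2 * t)| ≤ r ^ 2 / (4 * t ^ 2) + d / (2 * t) := by
          rw [abs_le]; constructor <;> linarith
      _ ≤ (1 / (4 * δ ^ 2)) * r ^ 2 + d / (2 * δ) := by linarith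
      _ ≤ A * (1 + r + r ^ 2) := by
          nlinarith [mul_nonneg hA0 hr0, sq_nonneg r, mul_nonneg p1 (sq_nonneg r),
            mul_nonneg p3 (sq_nonneg r)]

lemma integrable_heat {t : ℝ} (ht : 0 < t) :
    Integrable (heat t : EuclideanSpace ℝ (Fin d) → ℝ) :=
  (integrable_exp_neg_mul_sq_norm (by positivity)).const_mul _

lemma integral_heat {t : ℝ} (ht : 0 < t) :
    ∫ x : EuclideanSpace ℝ (Fin d), heat t x = 1 := by
  unfold heat
  rw [integral_const_mul, GaussianFourier.integral_rexp_neg_mul_sq_norm (by positivity),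
    finrank_euclideanSpace_fin]
  have : Real.pi / (1 / (4 * t)) = 4 * Real.pi * t := by field_simp
  rw [this, ← Real.rpow_add (by positivity)]
  ring_nf
  simp

/-- The semigroup property of the heat kernel. -/
lemma integral_heat_mul_heat {s t : ℝ} (hs : 0 < s) (ht : 0 < t) (x y : EuclideanSpace ℝ (Fin d)) :
    ∫ z, heat s (z - x) * heat t (z - y) = heat (s + t) (x - y) := by
  have hst : 0 < s + t := by positivity
  -- Completing the square: b = 1/(4s) + 1/(4t), and the product of the two Gaussians is centred at
  -- the barycentre m.
  set b : ℝ := (s + t) / (4 * s * t) with hb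
  set m : EuclideanSpace ℝ (Fin d) := (s + t)⁻¹ • (t • x + s • y) with hm
  have key : ∀ z, -(1 / (4 * s)) * ‖z - x‖ ^ 2 + -(1 / (4 * t)) * ‖z - y‖ ^ 2 =
      -(1 / (4 * (s + t))) * ‖x - y‖ ^ 2 + -b * ‖z - m‖ ^ 2 := by
    intro z
    simp only [EuclideanSpace.norm_sq_eq, Finset.mul_sum, ← Finset.sum_add_distrib]
    refine Finset.sum_congr rfl fun i _ ↦ ?_
    simp only [hm, PiLp.sub_apply, PiLp.smul_apply, PiLp.add_apply, smul_eq_mul, Real.norm_eq_abs,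
      sq_abs, hb]
    field_simp
    ring
  have h1 : ∀ z, heat s (z - x) * heat t (z - y) =
      ((4 * Real.pi * s) ^ (-(d : ℝ) / 2) * (4 * Real.pi * t) ^ (-(d : ℝ) / 2) *
        Real.exp (-(1 / (4 * (s + t))) * ‖x - y‖ ^ 2)) * Real.exp (-b * ‖z - m‖ ^ 2) := by
    intro z
    unfold heat
    rw [mul_mul_mul_comm, ← Real.exp_add, key, Real.exp_add]
    ring
  simp_rw [h1]
  rw [integral_const_mul, integral_sub_right_eq_self
    (fun z : EuclideanSpace ℝ (Fin d) ↦ Real.exp (-b * ‖z‖ ^ 2)) m,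
    GaussianFourier.integral_rexp_neg_mul_sq_norm (by positivity), finrank_euclideanSpace_fin, heat]
  rw [show ((d : ℝ) / 2) = -(-(d : ℝ) / 2) by ring, Real.rpow_neg (by positivity),
    ← Real.inv_rpow (by positivity), mul_right_comm, ← Real.mul_rpow (by positivity)
    (by positivity), ← Real.mul_rpow (by positivity) (by positivity)]
  congr 2
  simp only [hb]
  field_simp

/-! ### Heat kernels integrated over a bounded time interval -/

/-- The time integral over `(δ, T]` of the heat kernel. -/
def heatInt (δ T : ℝ) (x : EuclideanSpace ℝ (Fin d)) : ℝ := ∫ t in Ioc δ T, heat t x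

/-- The time integral over `(δ, T]` of the gradient of the heat kernel. -/
def gradInt (δ T : ℝ) (x : EuclideanSpace ℝ (Fin d)) : EuclideanSpace ℝ (Fin d) :=
  ∫ t in Ioc δ T, heatGrad t x

/-- Integrability on a product with a time interval, from a bound independent of time. -/
lemma integrable_time_prod {X F : Type*} [MeasurableSpace X] {ν : Measure X} [SFinite ν]
    [NormedAddCommGroup F] {δ T C : ℝ} {f : ℝ × X → F} {g : X → ℝ}
    (hf : AEStronglyMeasurable f ((volume.restrict (Ioc δ T)).prod ν)) (hg : Integrable g ν)
    (h : ∀ t ∈ Ioc δ T, ∀ z, ‖f (t, z)‖ ≤ C * g z) :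
    Integrable f ((volume.restrict (Ioc δ T)).prod ν) := by
  have h1 : Integrable (fun p : ℝ × X ↦ C * g p.2) ((volume.restrict (Ioc δ T)).prod ν) :=
    (hg.comp_snd (volume.restrict (Ioc δ T))).const_mul C
  refine h1.mono' hf ?_
  have : ∀ᵐ p ∂((volume.restrict (Ioc δ T)).prod ν), p.1 ∈ Ioc δ T :=
    Measure.quasiMeasurePreserving_fst.ae (ae_restrict_mem measurableSet_Ioc)
  filter_upwards [this] with p hp using h p.1 hp p.2

lemma norm_setIntegral_Ioc_le {F : Type*} [NormedAddCommGroup F] [NormedSpace ℝ F]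
    {δ T C : ℝ} (hδT : δ ≤ T) {f : ℝ → F} (h : ∀ t ∈ Ioc δ T, ‖f t‖ ≤ C) :
    ‖∫ t in Ioc δ T, f t‖ ≤ C * (T - δ) := by
  have := norm_setIntegral_le_of_norm_le_const (μ := volume) (s := Ioc δ T)
    measure_Ioc_lt_top h
  simpa [measureReal_def, ENNReal.toReal_ofReal (sub_nonneg.2 hδT)] using this

lemma exists_heatInt_bound {δ T : ℝ} (hδ : 0 < δ) (hδT : δ ≤ T) : ∃ C : ℝ, 0 ≤ C ∧
    ∀ x : EuclideanSpace ℝ (Fin d), |heatInt δ T x| ≤ C * envelope T x ∧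
      ‖gradInt δ T x‖ ≤ C * envelope T x := by
  obtain ⟨C, hC, h⟩ := exists_heat_bound (d := d) (T := T) hδ
  refine ⟨C * (T - δ), mul_nonneg hC (sub_nonneg.2 hδT), fun x ↦ ⟨?_, ?_⟩⟩
  · have := norm_setIntegral_Ioc_le (f := fun t ↦ heat t x) hδT
      fun t ht ↦ (h t (Ioc_subset_Icc_self ht) x).1
    rw [heatInt, ← Real.norm_eq_abs]
    linarith
  · have := norm_setIntegral_Ioc_le hδT fun t ht ↦ (h t (Ioc_subset_Icc_self ht) x).2.1
    rw [gradInt]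
    linarith

lemma continuous_heatInt {δ T : ℝ} (hδ : 0 < δ) :
    Continuous (heatInt δ T : EuclideanSpace ℝ (Fin d) → ℝ) := by
  obtain ⟨C, hC, h⟩ := exists_heat_bound (d := d) (T := T) hδ
  refine continuous_of_dominated (bound := fun _ ↦ C) (fun x ↦ ?_) (fun x ↦ ?_)
    (integrableOn_const measure_Ioc_lt_top.ne) (Filter.Eventually.of_forall fun t ↦ ?_)
  · exact (measurable_heat.comp (measurable_id.prodMk measurable_const)).aestronglyMeasurable
  · filter_upwards [ae_restrict_mem measurableSet_Ioc] with t ht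
    have hT : 0 < T := hδ.trans (ht.1.trans_le ht.2)
    exact ((h t (Ioc_subset_Icc_self ht) x).1).trans
      (mul_le_of_le_one_right hC (envelope_le_one hT x))
  · exact (contDiff_heat t).continuous

lemma continuous_gradInt {δ T : ℝ} (hδ : 0 < δ) :
    Continuous (gradInt δ T : EuclideanSpace ℝ (Fin d) → EuclideanSpace ℝ (Fin d)) := by
  obtain ⟨C, hC, h⟩ := exists_heat_bound (d := d) (T := T) hδ
  refine continuous_of_dominated (bound := fun _ ↦ C) (fun x ↦ ?_) (fun x ↦ ?_)
    (integrableOn_const measure_Ioc_lt_top.ne) (Filter.Eventually.of_forall fun t ↦ ?_)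
  · exact (measurable_heatGrad.comp (measurable_id.prodMk measurable_const)).aestronglyMeasurable
  · filter_upwards [ae_restrict_mem measurableSet_Ioc] with t ht
    have hT : 0 < T := hδ.trans (ht.1.trans_le ht.2)
    exact ((h t (Ioc_subset_Icc_self ht) x).2.1).trans
      (mul_le_of_le_one_right hC (envelope_le_one hT x))
  · exact (contDiff_heatGrad t).continuous

lemma integrable_of_le_envelope {F : Type*} [NormedAddCommGroup F] {T C : ℝ} (hT : 0 < T)
    {f : EuclideanSpace ℝ (Fin d) → F} (hf : Continuous f)
    (h : ∀ x, ‖f x‖ ≤ C * envelope T x) : Integrable f :=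
  ((integrable_envelope hT).const_mul C).mono' hf.aestronglyMeasurable
    (Filter.Eventually.of_forall h)

lemma integrable_heatInt {δ T : ℝ} (hδ : 0 < δ) (hδT : δ ≤ T) :
    Integrable (heatInt δ T : EuclideanSpace ℝ (Fin d) → ℝ) := by
  obtain ⟨C, -, h⟩ := exists_heatInt_bound (d := d) hδ hδT
  exact integrable_of_le_envelope (hδ.trans_le hδT) (continuous_heatInt hδ) fun x ↦ (h x).1

lemma integrable_gradInt {δ T : ℝ} (hδ : 0 < δ) (hδT : δ ≤ T) :
    Integrable (gradInt δ T : EuclideanSpace ℝ (Fin d) → EuclideanSpace ℝ (Fin d)) := by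
  obtain ⟨C, -, h⟩ := exists_heatInt_bound (d := d) hδ hδT
  exact integrable_of_le_envelope (hδ.trans_le hδT) (continuous_gradInt hδ) fun x ↦ (h x).2

lemma integrable_heatGrad {t : ℝ} (ht : 0 < t) :
    Integrable (heatGrad t : EuclideanSpace ℝ (Fin d) → EuclideanSpace ℝ (Fin d)) := by
  obtain ⟨C, -, h⟩ := exists_heat_bound (d := d) (T := t) ht
  exact integrable_of_le_envelope ht (contDiff_heatGrad t).continuous
    fun x ↦ (h t (right_mem_Icc.2 le_rfl) x).2.1

lemma continuous_heatLap (t : ℝ) : Continuous (heatLap t : EuclideanSpace ℝ (Fin d) → ℝ) := by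
  unfold heatLap
  exact (contDiff_heat t).continuous.mul (by fun_prop)

lemma integrable_heatLap {t : ℝ} (ht : 0 < t) :
    Integrable (heatLap t : EuclideanSpace ℝ (Fin d) → ℝ) := by
  obtain ⟨C, -, h⟩ := exists_heat_bound (d := d) (T := t) ht
  exact integrable_of_le_envelope ht (continuous_heatLap t)
    fun x ↦ (h t (right_mem_Icc.2 le_rfl) x).2.2

lemma integral_heatLap_Ioc {δ T : ℝ} (hδ : 0 < δ) (hδT : δ ≤ T) (x : EuclideanSpace ℝ (Fin d)) :
    ∫ t in Ioc δ T, heatLap t x = heat T x - heat δ x := by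
  rw [← intervalIntegral.integral_of_le hδT]
  refine intervalIntegral.integral_eq_sub_of_hasDerivAt (fun t ht ↦ hasDerivAt_heat ?_ x) ?_
  · rw [uIcc_of_le hδT] at ht
    exact hδ.trans_le ht.1
  · refine ContinuousOn.intervalIntegrable ?_
    rw [uIcc_of_le hδT]
    exact continuousOn_heatLap.comp (f := fun t ↦ (t, x)) (by fun_prop)
      fun t ht ↦ ⟨hδ.trans_le ht.1, mem_univ _⟩

/-! ### Integration by parts against heat kernels -/

/-- `W` is the gradient of `F` as far as integration by parts against the gradients of the heat
kernels is concerned. -/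
def HeatIBP (F : EuclideanSpace ℝ (Fin d) → ℝ)
    (W : EuclideanSpace ℝ (Fin d) → EuclideanSpace ℝ (Fin d)) : Prop :=
  ∀ t > 0, ∀ x, ∫ z, inner ℝ (W z) (heatGrad t (z - x)) = -∫ z, F z * heatLap t (z - x)

lemma aestronglyMeasurable_time_shift {F : Type*} [NormedAddCommGroup F]
    {k : ℝ × EuclideanSpace ℝ (Fin d) → F} (hk : StronglyMeasurable k)
    (x : EuclideanSpace ℝ (Fin d)) (ν : Measure (ℝ × EuclideanSpace ℝ (Fin d))) :
    AEStronglyMeasurable (fun p : ℝ × EuclideanSpace ℝ (Fin d) ↦ k (p.1, p.2 - x)) ν :=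
  (hk.comp_measurable
    (measurable_fst.prodMk (measurable_snd.sub measurable_const))).aestronglyMeasurable

/-- Integration by parts turns the gradient of the heat kernel into its Laplacian, which is its time
derivative, so that the time integral telescopes to the two end times. -/
lemma HeatIBP.integral_inner_gradInt {F : EuclideanSpace ℝ (Fin d) → ℝ}
    {W : EuclideanSpace ℝ (Fin d) → EuclideanSpace ℝ (Fin d)} (h : HeatIBP F W)
    (hF : Integrable F) (hW : Integrable W) {δ T : ℝ} (hδ : 0 < δ) (hδT : δ ≤ T)
    (x : EuclideanSpace ℝ (Fin d)) :
    ∫ z, inner ℝ (W z) (gradInt δ T (z - x)) =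
      ∫ z, F z * (heat δ (z - x) - heat T (z - x)) := by
  obtain ⟨C, hC, hb⟩ := exists_heat_bound (d := d) (T := T) hδ
  have hT : 0 < T := hδ.trans_le hδT
  have h1 : ∀ z, inner ℝ (W z) (gradInt δ T (z - x)) =
      ∫ t in Ioc δ T, inner ℝ (W z) (heatGrad t (z - x)) := by
    intro z
    rw [gradInt]
    refine (((innerSL ℝ (W z)).integral_comp_comm ?_)).symm
    refine (ContinuousOn.integrableOn_Icc ?_).mono_set Ioc_subset_Icc_self
    exact continuousOn_heatGrad.comp (f := fun t ↦ (t, z - x)) (by fun_prop)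
      fun t ht ↦ ⟨hδ.trans_le ht.1, mem_univ _⟩
  simp_rw [h1]
  rw [integral_integral_swap]
  · have h2 : ∀ t ∈ Ioc δ T, ∫ z, inner ℝ (W z) (heatGrad t (z - x)) =
        -∫ z, F z * heatLap t (z - x) := fun t ht ↦ h t (hδ.trans ht.1) x
    rw [setIntegral_congr_fun measurableSet_Ioc h2, integral_neg, integral_integral_swap,
      ← integral_neg]
    · refine integral_congr_ae (Filter.Eventually.of_forall fun z ↦ ?_)
      simp only
      rw [integral_const_mul, integral_heatLap_Ioc hδ hδT]
      ring
    · refine integrable_time_prod (C := C) (g := fun z ↦ ‖F z‖) ?_ hF.norm ?_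
      · exact hF.aestronglyMeasurable.comp_snd.mul
          (aestronglyMeasurable_time_shift measurable_heatLap.stronglyMeasurable x _)
      · intro t ht z
        simp only [Function.uncurry, norm_mul]
        rw [mul_comm]
        gcongr
        exact ((hb t (Ioc_subset_Icc_self ht) _).2.2).trans
          (mul_le_of_le_one_right hC (envelope_le_one hT _))
  · refine Integrable.swap (f := fun p : ℝ × EuclideanSpace ℝ (Fin d) ↦
      inner ℝ (W p.2) (heatGrad p.1 (p.2 - x))) ?_
    refine integrable_time_prod (C := C) (g := fun z ↦ ‖W z‖) ?_ hW.norm ?_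
    · exact hW.aestronglyMeasurable.comp_snd.inner
        (aestronglyMeasurable_time_shift measurable_heatGrad.stronglyMeasurable x _)
    · intro t ht z
      refine (norm_inner_le_norm _ _).trans ?_
      rw [mul_comm]
      gcongr
      exact ((hb t (Ioc_subset_Icc_self ht) _).2.1).trans
        (mul_le_of_le_one_right hC (envelope_le_one hT _))

/-- Integration by parts of the heat kernel against a differentiable function. -/
lemma integral_heat_mul_fderiv {s : ℝ} (hs : 0 < s) (y v : EuclideanSpace ℝ (Fin d))
    {g : EuclideanSpace ℝ (Fin d) → ℝ} {g' : EuclideanSpace ℝ (Fin d) → ℝ} {M : ℝ}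
    (hg : ∀ x, HasLineDerivAt ℝ g (g' x) x v) (hgc : Continuous g) (hgc' : Continuous g')
    (hgM : ∀ x, |g x| ≤ M) (hgM' : ∀ x, |g' x| ≤ M) :
    ∫ z, heat s (z - y) * g' z = -∫ z, inner ℝ (heatGrad s (z - y)) v * g z := by
  have hh : Integrable fun z : EuclideanSpace ℝ (Fin d) ↦ heat s (z - y) :=
    (integrable_heat hs).comp_sub_right y
  have hG : Integrable fun z : EuclideanSpace ℝ (Fin d) ↦ inner ℝ (heatGrad s (z - y)) v :=
    ((integrable_heatGrad hs).comp_sub_right y).inner_const v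
  refine integral_bilinear_hasLineDerivAt_right_eq_neg_left_of_integrable
    (B := ContinuousLinearMap.mul ℝ ℝ) (v := v)
    (f' := fun z ↦ inner ℝ (heatGrad s (z - y)) v) ?_ ?_ ?_ ?_ fun x _ ↦ hg x
  · exact hG.mul_bdd (c := M) hgc.aestronglyMeasurable (Filter.Eventually.of_forall hgM)
  · exact hh.mul_bdd (c := M) hgc'.aestronglyMeasurable (Filter.Eventually.of_forall hgM')
  · exact hh.mul_bdd (c := M) hgc.aestronglyMeasurable (Filter.Eventually.of_forall hgM)
  · intro x _
    have := (hasFDerivAt_heat s (x - y)).comp x ((hasFDerivAt_id x).sub_const y)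
    simpa [Function.comp_def] using this.hasLineDerivAt v

/-- The derivative of the `i`-th component of the gradient of the heat kernel. -/
def heatHess (t : ℝ) (x : EuclideanSpace ℝ (Fin d)) (i : Fin d) :
    EuclideanSpace ℝ (Fin d) →L[ℝ] ℝ :=
  (-(1 / (2 * t))) • (x i • innerSL ℝ (heatGrad t x) +
    heat t x • EuclideanSpace.proj (𝕜 := ℝ) i)

lemma hasFDerivAt_heatGrad_sub (t : ℝ) (x z : EuclideanSpace ℝ (Fin d)) (i : Fin d) :
    HasFDerivAt (fun y : EuclideanSpace ℝ (Fin d) ↦ heatGrad t (y - x) i)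
      (heatHess t (z - x) i) z := by
  have := (hasFDerivAt_heatGrad_apply t (z - x) i).comp z ((hasFDerivAt_id z).sub_const x)
  simpa only [Function.comp_def, id, ContinuousLinearMap.comp_id, heatHess] using this

lemma continuous_heatGrad_sub_apply (t : ℝ) (x : EuclideanSpace ℝ (Fin d)) (i : Fin d) :
    Continuous fun y : EuclideanSpace ℝ (Fin d) ↦ heatGrad t (y - x) i :=
  continuous_iff_continuousAt.2 fun z ↦ (hasFDerivAt_heatGrad_sub t x z i).continuousAt

lemma continuous_heatHess_apply (t : ℝ) (i : Fin d) (v : EuclideanSpace ℝ (Fin d)) :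
    Continuous fun x : EuclideanSpace ℝ (Fin d) ↦ heatHess t x i v := by
  have h1 := (contDiff_heatGrad (d := d) t).continuous
  have h2 := (contDiff_heat (d := d) t).continuous
  simp only [heatHess, smul_apply, add_apply, innerSL_apply_apply, smul_eq_mul]
  fun_prop

lemma exists_heatHess_bound {t : ℝ} (ht : 0 < t) : ∃ M : ℝ, 0 ≤ M ∧
    ∀ (x : EuclideanSpace ℝ (Fin d)) (i : Fin d), |heatGrad t x i| ≤ M ∧
      ‖heatHess t x i‖ ≤ M := by
  obtain ⟨C, hC, h⟩ := exists_heat_bound (d := d) (T := t) ht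
  refine ⟨C + (1 / (2 * t)) * (2 * t * C + d * C + C), by positivity, fun x i ↦ ?_⟩
  obtain ⟨h1, h2, h3⟩ := h t (right_mem_Icc.2 le_rfl) x
  have he := mul_le_of_le_one_right hC (envelope_le_one ht x)
  have hp := heat_pos ht x
  rw [abs_of_pos hp] at h1
  have hnn : 0 ≤ (1 / (2 * t)) * (2 * t * C + d * C + C) := by positivity
  constructor
  · have := (PiLp.norm_apply_le (heatGrad t x) i)
    rw [Real.norm_eq_abs] at this
    linarith
  · have hx : ‖x‖ * ‖heatGrad t x‖ ≤ 2 * t * C + d * C := by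
      have e : ‖x‖ * ‖heatGrad t x‖ = 2 * t * heatLap t x + d * heat t x := by
        rw [heatGrad, norm_smul, norm_mul, norm_neg, Real.norm_of_nonneg hp.le,
          Real.norm_of_nonneg (by positivity), heatLap]
        field_simp
        ring
      rw [e]
      have : heatLap t x ≤ C := (le_abs_self _).trans (h3.trans he)
      gcongr
      linarith
    have hi : |x i| * ‖heatGrad t x‖ ≤ 2 * t * C + d * C := by
      refine le_trans ?_ hx
      gcongr
      simpa using PiLp.norm_apply_le x i
    have hproj : ‖(EuclideanSpace.proj (𝕜 := ℝ) i : EuclideanSpace ℝ (Fin d) →L[ℝ] ℝ)‖ ≤ 1 := by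
      refine ContinuousLinearMap.opNorm_le_bound _ zero_le_one fun v ↦ ?_
      simpa using PiLp.norm_apply_le v i
    rw [heatHess, norm_smul, norm_neg, Real.norm_of_nonneg (by positivity)]
    have : ‖x i • innerSL ℝ (heatGrad t x) +
        heat t x • (EuclideanSpace.proj (𝕜 := ℝ) i : EuclideanSpace ℝ (Fin d) →L[ℝ] ℝ)‖ ≤
        2 * t * C + d * C + C := by
      refine (norm_add_le _ _).trans (add_le_add ?_ ?_)
      · rwa [norm_smul, innerSL_apply_norm, Real.norm_eq_abs]
      · rw [norm_smul, Real.norm_of_nonneg hp.le]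
        exact (mul_le_of_le_one_right hp.le hproj).trans (h1.trans he)
    have := mul_le_mul_of_nonneg_left this (by positivity : 0 ≤ 1 / (2 * t))
    linarith

lemma abs_heatHess_single_le {t M : ℝ} {x : EuclideanSpace ℝ (Fin d)} {i : Fin d}
    (h : ‖heatHess t x i‖ ≤ M) : |heatHess t x i (EuclideanSpace.single i 1)| ≤ M := by
  have := (heatHess t x i).le_opNorm (EuclideanSpace.single i 1)
  rw [PiLp.norm_single, norm_one, mul_one] at this
  exact this.trans h

/-- The Laplacian is the trace of `heatHess`, so the integration by parts may be done one coordinate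
direction at a time. -/
lemma heatIBP_of_components {F : EuclideanSpace ℝ (Fin d) → ℝ}
    {W : EuclideanSpace ℝ (Fin d) → EuclideanSpace ℝ (Fin d)}
    (hF : Integrable F) (hW : Integrable W)
    (h : ∀ t > 0, ∀ x i, ∫ z, inner ℝ (W z) (EuclideanSpace.single i 1) * heatGrad t (z - x) i =
      -∫ z, F z * heatHess t (z - x) i (EuclideanSpace.single i 1)) : HeatIBP F W := by
  intro t ht x
  obtain ⟨M, hM, hb⟩ := exists_heatHess_bound (d := d) ht
  have h1 : ∀ z, inner ℝ (W z) (heatGrad t (z - x)) =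
      ∑ i, inner ℝ (W z) (EuclideanSpace.single i 1) * heatGrad t (z - x) i := by
    intro z
    rw [PiLp.inner_apply]
    refine Finset.sum_congr rfl fun i _ ↦ ?_
    simp [EuclideanSpace.inner_single_right, mul_comm]
  have h2 : ∀ z, F z * heatLap t (z - x) =
      ∑ i, F z * heatHess t (z - x) i (EuclideanSpace.single i 1) := by
    intro z
    rw [← sum_deriv_heatGrad ht, Finset.mul_sum]
    rfl
  simp_rw [h1, h2]
  rw [integral_finsetSum, integral_finsetSum, ← Finset.sum_neg_distrib]
  · exact Finset.sum_congr rfl fun i _ ↦ h t ht x i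
  · intro i _
    refine hF.mul_bdd (c := M) ?_ (Filter.Eventually.of_forall fun z ↦ abs_heatHess_single_le
      (hb (z - x) i).2)
    exact ((continuous_heatHess_apply t i _).comp (continuous_sub_right x)).aestronglyMeasurable
  · intro i _
    refine (hW.inner_const _).mul_bdd (c := M) ?_ (Filter.Eventually.of_forall fun z ↦
      (hb (z - x) i).1)
    exact (continuous_heatGrad_sub_apply t x i).aestronglyMeasurable

lemma heatIBP_heat {s : ℝ} (hs : 0 < s) (y : EuclideanSpace ℝ (Fin d)) :
    HeatIBP (fun z ↦ heat s (z - y)) (fun z ↦ heatGrad s (z - y)) := by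
  refine heatIBP_of_components ((integrable_heat hs).comp_sub_right y)
    ((integrable_heatGrad hs).comp_sub_right y) fun t ht x i ↦ ?_
  obtain ⟨M, hM, hb⟩ := exists_heatHess_bound (d := d) ht
  have := integral_heat_mul_fderiv (M := M) hs y (EuclideanSpace.single i 1)
    (g := fun z ↦ heatGrad t (z - x) i)
    (g' := fun z ↦ heatHess t (z - x) i (EuclideanSpace.single i 1))
    (fun z ↦ (hasFDerivAt_heatGrad_sub t x z i).hasLineDerivAt _)
    (continuous_heatGrad_sub_apply t x i)
    ((continuous_heatHess_apply t i _).comp (continuous_sub_right x))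
    (fun z ↦ (hb _ i).1) (fun z ↦ abs_heatHess_single_le (hb _ i).2)
  rw [this, neg_neg]

lemma memLp_gradient {F : EuclideanSpace ℝ (Fin d) → ℝ} {C : ℝ≥0} (hF : LipschitzWith C F)
    (hFc : HasCompactSupport F) (p : ℝ≥0∞) : MemLp (gradient F) p := by
  have hcs : HasCompactSupport (gradient F) := by
    unfold gradient
    exact (hFc.fderiv ℝ).comp_left (map_zero _)
  refine hcs.memLp_of_bound ?_ C (Filter.Eventually.of_forall fun x ↦ ?_)
  · unfold gradient
    exact ((LinearIsometryEquiv.continuous _).measurable.comp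
      (measurable_fderiv ℝ F)).aestronglyMeasurable
  · unfold gradient
    rw [LinearIsometryEquiv.norm_map]
    exact norm_fderiv_le_of_lipschitz ℝ hF

/-- Rademacher gradients of compactly supported Lipschitz functions. -/
lemma heatIBP_gradient {F : EuclideanSpace ℝ (Fin d) → ℝ} {C : ℝ≥0} (hF : LipschitzWith C F)
    (hFc : HasCompactSupport F) : HeatIBP F (gradient F) := by
  have hW : Integrable (gradient F) := memLp_one_iff_integrable.1 (memLp_gradient hF hFc 1)
  refine heatIBP_of_components (hF.continuous.integrable_of_hasCompactSupport hFc) hW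
    fun t ht x i ↦ ?_
  obtain ⟨M, hM, hb⟩ := exists_heatHess_bound (d := d) ht
  have hL : LipschitzWith M.toNNReal
      (fun z : EuclideanSpace ℝ (Fin d) ↦ heatGrad t (z - x) i) := by
    refine lipschitzWith_of_nnnorm_fderiv_le
      (fun z ↦ (hasFDerivAt_heatGrad_sub t x z i).differentiableAt) fun z ↦ ?_
    rw [(hasFDerivAt_heatGrad_sub t x z i).fderiv, ← NNReal.coe_le_coe, Real.coe_toNNReal _ hM]
    exact (hb _ i).2
  -- Integration by parts between two Lipschitz functions. Smoothness of `F` cannot be asked for,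
  -- since the extensions built below come from a reflection in a Lipschitz graph. The formula
  -- differentiates `F` in the opposite direction, whence the sign in `e2`.
  have key := hL.integral_lineDeriv_mul_eq (μ := volume) hF hFc (EuclideanSpace.single i 1)
  have e1 : ∀ z, lineDeriv ℝ (fun z : EuclideanSpace ℝ (Fin d) ↦ heatGrad t (z - x) i) z
      (EuclideanSpace.single i 1) = heatHess t (z - x) i (EuclideanSpace.single i 1) :=
    fun z ↦ ((hasFDerivAt_heatGrad_sub t x z i).hasLineDerivAt _).lineDeriv
  simp_rw [e1] at key
  have e2 : ∀ᵐ z : EuclideanSpace ℝ (Fin d),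
      inner ℝ (gradient F z) (EuclideanSpace.single i 1) * heatGrad t (z - x) i =
      -(lineDeriv ℝ F z (-EuclideanSpace.single i 1) * heatGrad t (z - x) i) := by
    filter_upwards [hF.ae_differentiableAt] with z hz
    rw [hz.lineDeriv_eq_fderiv, map_neg, gradient, InnerProductSpace.toDual_symm_apply]
    ring
  rw [integral_congr_ae e2, integral_neg, ← key]
  simp_rw [mul_comm]

lemma integral_heatInt_mul {δ T : ℝ} (hδ : 0 < δ) (y : EuclideanSpace ℝ (Fin d))
    {g : EuclideanSpace ℝ (Fin d) → ℝ} (hg : Integrable g) :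
    ∫ z, heatInt δ T (z - y) * g z = ∫ s in Ioc δ T, ∫ z, heat s (z - y) * g z := by
  obtain ⟨C, hC, hb⟩ := exists_heat_bound (d := d) (T := T) hδ
  rw [integral_integral_swap]
  · refine integral_congr_ae (Filter.Eventually.of_forall fun z ↦ ?_)
    simp only
    rw [integral_mul_const, heatInt]
  · refine integrable_time_prod (C := C) (g := fun z ↦ ‖g z‖) ?_ hg.norm ?_
    · exact (aestronglyMeasurable_time_shift measurable_heat.stronglyMeasurable y _).mul
        hg.aestronglyMeasurable.comp_snd
    · intro t ht z
      have hT : 0 < T := hδ.trans (ht.1.trans_le ht.2)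
      simp only [Function.uncurry, norm_mul]
      gcongr
      exact ((hb t (Ioc_subset_Icc_self ht) _).1).trans
        (mul_le_of_le_one_right hC (envelope_le_one hT _))

lemma integral_inner_gradInt {δ T : ℝ} (hδ : 0 < δ) (y : EuclideanSpace ℝ (Fin d))
    {g : EuclideanSpace ℝ (Fin d) → EuclideanSpace ℝ (Fin d)} (hg : Integrable g) :
    ∫ z, inner ℝ (gradInt δ T (z - y)) (g z) =
      ∫ s in Ioc δ T, ∫ z, inner ℝ (heatGrad s (z - y)) (g z) := by
  obtain ⟨C, hC, hb⟩ := exists_heat_bound (d := d) (T := T) hδ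
  rw [integral_integral_swap]
  · refine integral_congr_ae (Filter.Eventually.of_forall fun z ↦ ?_)
    simp only [gradInt]
    simp_rw [real_inner_comm (g z)]
    refine (((innerSL ℝ (g z)).integral_comp_comm ?_)).symm
    refine (ContinuousOn.integrableOn_Icc ?_).mono_set Ioc_subset_Icc_self
    exact continuousOn_heatGrad.comp (f := fun t ↦ (t, z - y)) (by fun_prop)
      fun t ht ↦ ⟨hδ.trans_le ht.1, mem_univ _⟩
  · refine integrable_time_prod (C := C) (g := fun z ↦ ‖g z‖) ?_ hg.norm ?_
    · exact (aestronglyMeasurable_time_shift measurable_heatGrad.stronglyMeasurable y _).inner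
        hg.aestronglyMeasurable.comp_snd
    · intro t ht z
      have hT : 0 < T := hδ.trans (ht.1.trans_le ht.2)
      refine (norm_inner_le_norm _ _).trans ?_
      gcongr
      exact ((hb t (Ioc_subset_Icc_self ht) _).2.1).trans
        (mul_le_of_le_one_right hC (envelope_le_one hT _))

/-- The property is linear in the pair of functions, and it is here superposed over the times in (δ,
T]. -/
lemma heatIBP_heatInt {δ T : ℝ} (hδ : 0 < δ) (y : EuclideanSpace ℝ (Fin d)) :
    HeatIBP (fun z ↦ heatInt δ T (z - y)) (fun z ↦ gradInt δ T (z - y)) := by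
  intro t ht x
  rw [integral_inner_gradInt hδ y ((integrable_heatGrad ht).comp_sub_right x),
    integral_heatInt_mul hδ y ((integrable_heatLap ht).comp_sub_right x), ← integral_neg]
  exact setIntegral_congr_fun measurableSet_Ioc
    fun s hs ↦ heatIBP_heat (hδ.trans hs.1) y t ht x

/-- The inner products of the translates of `gradInt`. -/
lemma integral_inner_gradInt_gradInt {δ T : ℝ} (hδ : 0 < δ) (hδT : δ ≤ T)
    (x y : EuclideanSpace ℝ (Fin d)) :
    ∫ z, inner ℝ (gradInt δ T (z - x)) (gradInt δ T (z - y)) =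
      ∫ s in Ioc δ T, (heat (s + δ) (x - y) - heat (s + T) (x - y)) := by
  have hT : 0 < T := hδ.trans_le hδT
  -- The telescoped identity, applied to a translate of `heatInt` itself, leaves only products of
  -- two heat kernels, to which the semigroup property applies.
  rw [(heatIBP_heatInt hδ x).integral_inner_gradInt ((integrable_heatInt hδ hδT).comp_sub_right x)
    ((integrable_gradInt hδ hδT).comp_sub_right x) hδ hδT, integral_heatInt_mul hδ]
  · refine setIntegral_congr_fun measurableSet_Ioc fun s hs ↦ ?_
    have hs0 : 0 < s := hδ.trans hs.1
    simp only [mul_sub]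
    rw [integral_sub, integral_heat_mul_heat hs0 hδ, integral_heat_mul_heat hs0 hT]
    · exact ((integrable_heat hs0).comp_sub_right x).mul_bdd
        (((contDiff_heat δ).continuous.comp (continuous_sub_right y)).aestronglyMeasurable)
        (Filter.Eventually.of_forall fun z ↦ by
          rw [Real.norm_of_nonneg (heat_pos hδ _).le]; exact heat_le hδ _)
    · exact ((integrable_heat hs0).comp_sub_right x).mul_bdd
        (((contDiff_heat T).continuous.comp (continuous_sub_right y)).aestronglyMeasurable)
        (Filter.Eventually.of_forall fun z ↦ by
          rw [Real.norm_of_nonneg (heat_pos hT _).le]; exact heat_le hT _)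
  · exact ((integrable_heat hδ).comp_sub_right y).sub ((integrable_heat hT).comp_sub_right y)

/-- `gradInt` is the weak gradient of `heatInt`. -/
lemma integral_heatInt_mul_fderiv {δ T : ℝ} (hδ : 0 < δ) (x v : EuclideanSpace ℝ (Fin d))
    {φ : EuclideanSpace ℝ (Fin d) → ℝ} (hφ : ContDiff ℝ ∞ φ) (hφc : HasCompactSupport φ) :
    ∫ z, heatInt δ T (z - x) * fderiv ℝ φ z v =
      -∫ z, inner ℝ (gradInt δ T (z - x)) v * φ z := by
  have hc : Continuous fun z ↦ fderiv ℝ φ z v := (hφ.continuous_fderiv (by simp)).clm_apply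
    continuous_const
  have hcs : HasCompactSupport fun z ↦ fderiv ℝ φ z v :=
    hφc.fderiv_apply ℝ v
  obtain ⟨M1, hM1⟩ := hφ.continuous.bounded_above_of_compact_support hφc
  obtain ⟨M2, hM2⟩ := hc.bounded_above_of_compact_support hcs
  rw [integral_heatInt_mul hδ x (hc.integrable_of_hasCompactSupport hcs)]
  have e : ∀ z, inner ℝ (gradInt δ T (z - x)) v * φ z =
      inner ℝ (gradInt δ T (z - x)) (φ z • v) := fun z ↦ by rw [inner_smul_right, mul_comm]
  simp_rw [e]
  rw [integral_inner_gradInt hδ x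
    ((hφ.continuous.integrable_of_hasCompactSupport hφc).smul_const v), ← integral_neg]
  refine setIntegral_congr_fun measurableSet_Ioc fun s hs ↦ ?_
  have := integral_heat_mul_fderiv (M := max M1 M2) (hδ.trans hs.1) x v (g := φ)
    (g' := fun z ↦ fderiv ℝ φ z v)
    (fun z ↦ ((hφ.differentiable (by simp) z).hasFDerivAt.hasLineDerivAt v)) hφ.continuous hc
    (fun z ↦ (hM1 z).trans (le_max_left _ _)) (fun z ↦ (hM2 z).trans (le_max_right _ _))
  rw [this]
  simp_rw [inner_smul_right, mul_comm]

/-! ### Quadratic forms of kernels at a difference of two finite measures -/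

/-- The integral against the signed measure `α - β`. -/
def sint {X F : Type*} [MeasurableSpace X] [NormedAddCommGroup F] [NormedSpace ℝ F]
    (α β : Measure X) (f : X → F) : F := ∫ x, f x ∂α - ∫ x, f x ∂β

/-- The double integral of `k (x - y)` against the square of the signed measure `α - β`. -/
def sform (α β : Measure (EuclideanSpace ℝ (Fin d))) (k : EuclideanSpace ℝ (Fin d) → ℝ) : ℝ :=
  ∫ p, k (p.1 - p.2) ∂(α.prod α + β.prod β) - ∫ p, k (p.1 - p.2) ∂(α.prod β + β.prod α)

section Bilinear

variable {F : Type*} [NormedAddCommGroup F]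

lemma integrable_shift {α : Measure (EuclideanSpace ℝ (Fin d))} [IsFiniteMeasure α]
    {a : EuclideanSpace ℝ (Fin d) → F} (ha : Continuous a) {M : ℝ} (hM : ∀ x, ‖a x‖ ≤ M)
    (z : EuclideanSpace ℝ (Fin d)) : Integrable (fun x ↦ a (z - x)) α :=
  Integrable.of_bound (ha.comp (continuous_sub_left z)).aestronglyMeasurable M
    (Filter.Eventually.of_forall fun _ ↦ hM _)

variable [InnerProductSpace ℝ F]

lemma continuous_integral_shift {α : Measure (EuclideanSpace ℝ (Fin d))} [IsFiniteMeasure α]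
    {a : EuclideanSpace ℝ (Fin d) → F} (ha : Continuous a) {M : ℝ} (hM : ∀ x, ‖a x‖ ≤ M) :
    Continuous fun z ↦ ∫ x, a (z - x) ∂α :=
  continuous_of_dominated (bound := fun _ ↦ M)
    (fun z ↦ (ha.comp (continuous_sub_left z)).aestronglyMeasurable)
    (fun _ ↦ Filter.Eventually.of_forall fun _ ↦ hM _) (integrable_const _)
    (Filter.Eventually.of_forall fun x ↦ ha.comp (continuous_sub_right x))

variable [CompleteSpace F]

/-- Fubini in the three variables z, x, y. Absolute convergence comes from bounding one factor by
`M` and integrating the other one in z, after which the measures only contribute their masses. -/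
lemma integral_inner_shift {α α' : Measure (EuclideanSpace ℝ (Fin d))} [IsFiniteMeasure α]
    [IsFiniteMeasure α'] {a : EuclideanSpace ℝ (Fin d) → F} (ha : Continuous a)
    (hai : Integrable a) {M : ℝ} (hM : ∀ x, ‖a x‖ ≤ M) {B : EuclideanSpace ℝ (Fin d) → ℝ}
    (hB : ∀ x y, ∫ z, inner ℝ (a (z - x)) (a (z - y)) = B (x - y)) :
    Integrable (fun z ↦ inner ℝ (∫ x, a (z - x) ∂α) (∫ y, a (z - y) ∂α')) ∧
      ∫ z, inner ℝ (∫ x, a (z - x) ∂α) (∫ y, a (z - y) ∂α') =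
        ∫ p, B (p.1 - p.2) ∂(α.prod α') := by
  have e : ∀ z, inner ℝ (∫ x, a (z - x) ∂α) (∫ y, a (z - y) ∂α') =
      ∫ p, inner ℝ (a (z - p.1)) (a (z - p.2)) ∂(α.prod α') := by
    intro z
    have hi : Integrable (fun p : EuclideanSpace ℝ (Fin d) × EuclideanSpace ℝ (Fin d) ↦
        (inner ℝ (a (z - p.1)) (a (z - p.2)) : ℝ)) (α.prod α') := by
      refine Integrable.of_bound (C := M * M) ?_ (Filter.Eventually.of_forall fun p ↦ ?_)
      · exact Continuous.aestronglyMeasurable (by fun_prop)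
      · refine (norm_inner_le_norm _ _).trans ?_
        exact mul_le_mul (hM _) (hM _) (norm_nonneg _) ((norm_nonneg _).trans (hM 0))
    rw [integral_prod _ hi]
    simp only
    have h1 : ∀ x, ∫ y, inner ℝ (a (z - x)) (a (z - y)) ∂α' =
        inner ℝ (a (z - x)) (∫ y, a (z - y) ∂α') :=
      fun x ↦ integral_inner (integrable_shift ha hM z) _
    simp_rw [h1, real_inner_comm (∫ y, a (z - y) ∂α')]
    exact (integral_inner (integrable_shift ha hM z) _).symm
  have hint : Integrable (fun q : EuclideanSpace ℝ (Fin d) ×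
      (EuclideanSpace ℝ (Fin d) × EuclideanSpace ℝ (Fin d)) ↦
        (inner ℝ (a (q.1 - q.2.1)) (a (q.1 - q.2.2)) : ℝ)) (volume.prod (α.prod α')) := by
    have hsm : AEStronglyMeasurable (fun q : EuclideanSpace ℝ (Fin d) ×
      (EuclideanSpace ℝ (Fin d) × EuclideanSpace ℝ (Fin d)) ↦
        (inner ℝ (a (q.1 - q.2.1)) (a (q.1 - q.2.2)) : ℝ)) (volume.prod (α.prod α')) :=
      Continuous.aestronglyMeasurable (by fun_prop)
    have hle : ∀ (p : EuclideanSpace ℝ (Fin d) × EuclideanSpace ℝ (Fin d)) z,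
        ‖(inner ℝ (a (z - p.1)) (a (z - p.2)) : ℝ)‖ ≤ ‖a (z - p.1)‖ * M := fun p z ↦
      (norm_inner_le_norm _ _).trans (mul_le_mul_of_nonneg_left (hM _) (norm_nonneg _))
    have hni : ∀ x, Integrable fun z ↦ ‖a (z - x)‖ * M :=
      fun x ↦ (hai.comp_sub_right x).norm.mul_const M
    refine (integrable_prod_iff' hsm).2 ⟨Filter.Eventually.of_forall fun p ↦ ?_, ?_⟩
    · exact (hni p.1).mono' (Continuous.aestronglyMeasurable (by fun_prop))
        (Filter.Eventually.of_forall (hle p))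
    · refine Integrable.of_bound (C := (∫ z, ‖a z‖) * M) hsm.norm.prod_swap.integral_prod_right'
        (Filter.Eventually.of_forall fun p ↦ ?_)
      rw [Real.norm_of_nonneg (integral_nonneg fun _ ↦ norm_nonneg _)]
      refine (integral_mono_of_nonneg (Filter.Eventually.of_forall fun _ ↦ norm_nonneg _)
        (hni p.1) (Filter.Eventually.of_forall (hle p))).trans ?_
      rw [integral_mul_const, integral_sub_right_eq_self (fun z ↦ ‖a z‖)]
  simp_rw [e]
  refine ⟨hint.integral_prod_left, ?_⟩
  rw [integral_integral_swap hint]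
  exact integral_congr_ae (Filter.Eventually.of_forall fun p ↦ hB p.1 p.2)

/-- A convolution square integrates to the quadratic form of its autocorrelation. -/
lemma integral_norm_sq_sint {α β : Measure (EuclideanSpace ℝ (Fin d))} [IsFiniteMeasure α]
    [IsFiniteMeasure β] {a : EuclideanSpace ℝ (Fin d) → F} (ha : Continuous a)
    (hai : Integrable a) {M : ℝ} (hM : ∀ x, ‖a x‖ ≤ M) {B : EuclideanSpace ℝ (Fin d) → ℝ}
    (hBc : Continuous B) {MB : ℝ} (hMB : ∀ x, |B x| ≤ MB)
    (hB : ∀ x y, ∫ z, inner ℝ (a (z - x)) (a (z - y)) = B (x - y)) :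
    Integrable (fun z ↦ ‖sint α β fun x ↦ a (z - x)‖ ^ 2) ∧
      ∫ z, ‖sint α β fun x ↦ a (z - x)‖ ^ 2 = sform α β B := by
  obtain ⟨i1, h1⟩ := integral_inner_shift (α := α) (α' := α) ha hai hM hB
  obtain ⟨i2, h2⟩ := integral_inner_shift (α := β) (α' := β) ha hai hM hB
  obtain ⟨i3, h3⟩ := integral_inner_shift (α := α) (α' := β) ha hai hM hB
  obtain ⟨i4, h4⟩ := integral_inner_shift (α := β) (α' := α) ha hai hM hB
  have e : ∀ z, ‖sint α β fun x ↦ a (z - x)‖ ^ 2 =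
      (inner ℝ (∫ x, a (z - x) ∂α) (∫ y, a (z - y) ∂α) +
        inner ℝ (∫ x, a (z - x) ∂β) (∫ y, a (z - y) ∂β)) -
      (inner ℝ (∫ x, a (z - x) ∂α) (∫ y, a (z - y) ∂β) +
        inner ℝ (∫ x, a (z - x) ∂β) (∫ y, a (z - y) ∂α)) := by
    intro z
    rw [← real_inner_self_eq_norm_sq, sint, inner_sub_left, inner_sub_right, inner_sub_right]
    ring
  simp_rw [e]
  have i12 : Integrable fun z ↦ (inner ℝ (∫ x, a (z - x) ∂α) (∫ y, a (z - y) ∂α) +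
        inner ℝ (∫ x, a (z - x) ∂β) (∫ y, a (z - y) ∂β) : ℝ) := i1.add i2
  have i34 : Integrable fun z ↦ (inner ℝ (∫ x, a (z - x) ∂α) (∫ y, a (z - y) ∂β) +
        inner ℝ (∫ x, a (z - x) ∂β) (∫ y, a (z - y) ∂α) : ℝ) := i3.add i4
  refine ⟨i12.sub i34, ?_⟩
  have hi : ∀ ν : Measure (EuclideanSpace ℝ (Fin d) × EuclideanSpace ℝ (Fin d)),
      IsFiniteMeasure ν → Integrable (fun p ↦ B (p.1 - p.2)) ν := fun ν _ ↦
    Integrable.of_bound (Continuous.aestronglyMeasurable (by fun_prop)) MB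
      (Filter.Eventually.of_forall fun _ ↦ hMB _)
  rw [integral_sub i12 i34, integral_add i1 i2, integral_add i3 i4, h1, h2, h3,
    h4, sform, integral_add_measure (hi _ inferInstance) (hi _ inferInstance),
    integral_add_measure (hi _ inferInstance) (hi _ inferInstance)]

end Bilinear

/-- Cauchy-Schwarz for the integral of an inner product. -/
lemma abs_integral_inner_le {X F : Type*} [MeasurableSpace X] {ν : Measure X}
    [NormedAddCommGroup F] [InnerProductSpace ℝ F] {f g : X → F} (hf : MemLp f 2 ν)
    (hg : MemLp g 2 ν) :
    |∫ x, inner ℝ (f x) (g x) ∂ν| ≤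
      Real.sqrt (∫ x, ‖f x‖ ^ 2 ∂ν) * Real.sqrt (∫ x, ‖g x‖ ^ 2 ∂ν) := by
  have h := integral_mul_le_Lp_mul_Lq_of_nonneg (μ := ν) (f := fun x ↦ ‖f x‖) (g := fun x ↦ ‖g x‖)
    (p := 2) (q := 2) Real.HolderConjugate.two_two
    (Filter.Eventually.of_forall fun _ ↦ norm_nonneg _)
    (Filter.Eventually.of_forall fun _ ↦ norm_nonneg _) (by simpa using hf.norm)
    (by simpa using hg.norm)
  rw [Real.sqrt_eq_rpow, Real.sqrt_eq_rpow]
  refine le_trans ?_ (h.trans (by simp))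
  have h2 : ∀ᵐ x ∂ν, |(inner ℝ (f x) (g x) : ℝ)| ≤ ‖f x‖ * ‖g x‖ :=
    Filter.Eventually.of_forall fun x ↦ abs_real_inner_le_norm _ _
  exact (abs_integral_le_integral_abs).trans (integral_mono_of_nonneg
    (Filter.Eventually.of_forall fun _ ↦ abs_nonneg _) (hf.norm.integrable_mul hg.norm) h2)

lemma memLp_two_of_integrable_sq_norm {X F : Type*} [MeasurableSpace X] {ν : Measure X}
    [NormedAddCommGroup F] {f : X → F} (hf : AEStronglyMeasurable f ν)
    (h : Integrable (fun x ↦ ‖f x‖ ^ 2) ν) : MemLp f 2 ν :=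
  (memLp_two_iff_integrable_sq_norm hf).2 h

section Heat

variable {α β : Measure (EuclideanSpace ℝ (Fin d))} [IsFiniteMeasure α] [IsFiniteMeasure β]

/-- The semigroup property at equal times. It presents the heat kernel as an autocorrelation, which
is why its quadratic form is a square. -/
lemma heat_inner_shift {t : ℝ} (ht : 0 < t) (x y : EuclideanSpace ℝ (Fin d)) :
    ∫ z, inner ℝ (heat (t / 2) (z - x)) (heat (t / 2) (z - y)) = heat t (x - y) := by
  have := integral_heat_mul_heat (half_pos ht) (half_pos ht) x y
  rw [add_halves] at this
  rw [← this]
  simp [mul_comm]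

lemma abs_heat_le {t : ℝ} (ht : 0 < t) (x : EuclideanSpace ℝ (Fin d)) :
    |heat t x| ≤ (4 * Real.pi * t) ^ (-(d : ℝ) / 2) := by
  rw [abs_of_pos (heat_pos ht x)]
  exact heat_le ht x

lemma integral_sint_heat_sq {t : ℝ} (ht : 0 < t) :
    Integrable (fun z ↦ (sint α β fun x ↦ heat (t / 2) (z - x)) ^ 2) ∧
      ∫ z, (sint α β fun x ↦ heat (t / 2) (z - x)) ^ 2 = sform α β (heat t) := by
  have := integral_norm_sq_sint (α := α) (β := β) (contDiff_heat (t / 2)).continuous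
    (integrable_heat (half_pos ht)) (abs_heat_le (half_pos ht)) (contDiff_heat t).continuous
    (abs_heat_le ht) (heat_inner_shift ht)
  simpa using this

/-- The form is the squared L² norm of the heat flow of the measure at time t/2. All positivity of
the energy comes from here. -/
lemma sform_heat_nonneg {t : ℝ} (ht : 0 < t) : 0 ≤ sform α β (heat t) := by
  rw [← (integral_sint_heat_sq ht).2]
  exact integral_nonneg fun _ ↦ sq_nonneg _

/-- The quadratic form of a time integral of kernels. -/
lemma sform_integral {k : ℝ × EuclideanSpace ℝ (Fin d) → ℝ} (hk : StronglyMeasurable k)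
    {δ T C : ℝ} (hC : ∀ t ∈ Ioc δ T, ∀ x, |k (t, x)| ≤ C) :
    IntegrableOn (fun t ↦ sform α β fun x ↦ k (t, x)) (Ioc δ T) ∧
      sform α β (fun x ↦ ∫ t in Ioc δ T, k (t, x)) =
        ∫ t in Ioc δ T, sform α β fun x ↦ k (t, x) := by
  have hi : ∀ ν : Measure (EuclideanSpace ℝ (Fin d) × EuclideanSpace ℝ (Fin d)),
      IsFiniteMeasure ν → Integrable (fun q : ℝ × (EuclideanSpace ℝ (Fin d) ×
        EuclideanSpace ℝ (Fin d)) ↦ k (q.1, q.2.1 - q.2.2))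
        ((volume.restrict (Ioc δ T)).prod ν) := by
    intro ν _
    refine integrable_time_prod (C := C) (g := fun _ ↦ 1) ?_ (integrable_const _) ?_
    · exact (hk.comp_measurable (by fun_prop)).aestronglyMeasurable
    · intro t ht z
      simpa using hC t ht _
  have h1 := hi (α.prod α + β.prod β) inferInstance
  have h2 := hi (α.prod β + β.prod α) inferInstance
  refine ⟨h1.integral_prod_left.sub h2.integral_prod_left, ?_⟩
  simp only [sform]
  rw [integral_sub h1.integral_prod_left h2.integral_prod_left,
    integral_integral_swap (f := fun t (p : EuclideanSpace ℝ (Fin d) ×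
      EuclideanSpace ℝ (Fin d)) ↦ k (t, p.1 - p.2)) h1,
    integral_integral_swap (f := fun t (p : EuclideanSpace ℝ (Fin d) ×
      EuclideanSpace ℝ (Fin d)) ↦ k (t, p.1 - p.2)) h2]

lemma exists_heat_time_bound {δ T : ℝ} (hδ : 0 < δ) : ∃ C : ℝ, ∀ t ∈ Icc δ T,
    ∀ x : EuclideanSpace ℝ (Fin d), |heat t x| ≤ C := by
  obtain ⟨C, hC, h⟩ := exists_heat_bound (d := d) (T := T) hδ
  refine ⟨C, fun t ht x ↦ ((h t ht x).1).trans (mul_le_of_le_one_right hC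
    (envelope_le_one (hδ.trans_le (ht.1.trans ht.2)) x))⟩

lemma integrableOn_sform_heat {δ T : ℝ} (hδ : 0 < δ) :
    IntegrableOn (fun t ↦ sform α β (heat t)) (Ioc δ T) := by
  obtain ⟨C, h⟩ := exists_heat_time_bound (d := d) (T := T) hδ
  exact (sform_integral measurable_heat.stronglyMeasurable
    fun t ht x ↦ h t (Ioc_subset_Icc_self ht) x).1

lemma sform_heatInt {δ T : ℝ} (hδ : 0 < δ) :
    sform α β (heatInt δ T) = ∫ t in Ioc δ T, sform α β (heat t) := by
  obtain ⟨C, h⟩ := exists_heat_time_bound (d := d) (T := T) hδ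
  exact (sform_integral measurable_heat.stronglyMeasurable
    fun t ht x ↦ h t (Ioc_subset_Icc_self ht) x).2

lemma setIntegral_Ioc_add (f : ℝ → ℝ) {δ T c : ℝ} (hδT : δ ≤ T) :
    ∫ t in Ioc δ T, f (t + c) = ∫ t in Ioc (δ + c) (T + c), f t := by
  rw [← intervalIntegral.integral_of_le hδT, ← intervalIntegral.integral_of_le (by linarith),
    intervalIntegral.integral_comp_add_right]

/-- The `L²` norm of the convolution of `gradInt` with a signed measure. -/
lemma integral_sint_gradInt_sq {δ T : ℝ} (hδ : 0 < δ) (hδT : δ ≤ T) :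
    Integrable (fun z ↦ ‖sint α β fun x ↦ gradInt δ T (z - x)‖ ^ 2) ∧
      ∫ z, ‖sint α β fun x ↦ gradInt δ T (z - x)‖ ^ 2 ≤
        ∫ t in Ioc (δ + δ) (T + δ), sform α β (heat t) := by
  have hT : 0 < T := hδ.trans_le hδT
  obtain ⟨M, hM0, hM⟩ := exists_heatInt_bound (d := d) hδ hδT
  obtain ⟨C, hC⟩ := exists_heat_time_bound (d := d) (T := T + T) hδ
  have hk1 : StronglyMeasurable fun q : ℝ × EuclideanSpace ℝ (Fin d) ↦ heat (q.1 + δ) q.2 :=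
    (measurable_heat.comp (by fun_prop :
      Measurable fun q : ℝ × EuclideanSpace ℝ (Fin d) ↦ (q.1 + δ, q.2))).stronglyMeasurable
  have hk2 : StronglyMeasurable fun q : ℝ × EuclideanSpace ℝ (Fin d) ↦ heat (q.1 + T) q.2 :=
    (measurable_heat.comp (by fun_prop :
      Measurable fun q : ℝ × EuclideanSpace ℝ (Fin d) ↦ (q.1 + T, q.2))).stronglyMeasurable
  have hb1 : ∀ t ∈ Ioc δ T, ∀ x : EuclideanSpace ℝ (Fin d), |heat (t + δ) x| ≤ C :=
    fun t ht x ↦ hC _ ⟨by linarith [ht.1], by linarith [ht.2]⟩ x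
  have hb2 : ∀ t ∈ Ioc δ T, ∀ x : EuclideanSpace ℝ (Fin d), |heat (t + T) x| ≤ C :=
    fun t ht x ↦ hC _ ⟨by linarith [ht.1], by linarith [ht.2]⟩ x
  have hi : ∀ {k : ℝ × EuclideanSpace ℝ (Fin d) → ℝ}, StronglyMeasurable k →
      (∀ t ∈ Ioc δ T, ∀ x, |k (t, x)| ≤ C) → ∀ x, IntegrableOn (fun t ↦ k (t, x)) (Ioc δ T) :=
    fun hk h x ↦ Measure.integrableOn_of_bounded (M := C) measure_Ioc_lt_top.ne
      (hk.comp_measurable measurable_prodMk_right).aestronglyMeasurable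
      (by filter_upwards [ae_restrict_mem measurableSet_Ioc] with t ht using h t ht x)
  have hcont : ∀ c, 0 ≤ c → c ≤ T → Continuous fun x : EuclideanSpace ℝ (Fin d) ↦
      ∫ t in Ioc δ T, heat (t + c) x := by
    intro c hc hcT
    refine continuous_of_dominated (bound := fun _ ↦ C) (fun x ↦ ?_) (fun x ↦ ?_)
      (integrableOn_const measure_Ioc_lt_top.ne)
      (Filter.Eventually.of_forall fun t ↦ (contDiff_heat _).continuous)
    · exact (measurable_heat.comp (by fun_prop :
        Measurable fun q : ℝ ↦ (q + c, x))).aestronglyMeasurable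
    · filter_upwards [ae_restrict_mem measurableSet_Ioc] with t ht
      exact hC _ ⟨by linarith [ht.1], by linarith [ht.2]⟩ x
  have hB : ∀ x y : EuclideanSpace ℝ (Fin d),
      ∫ z, inner ℝ (gradInt δ T (z - x)) (gradInt δ T (z - y)) =
      (fun w ↦ ∫ s in Ioc δ T, (heat (s + δ) w - heat (s + T) w)) (x - y) :=
    integral_inner_gradInt_gradInt hδ hδT
  obtain ⟨i1, h1⟩ := integral_norm_sq_sint (α := α) (β := β) (continuous_gradInt hδ)
    (integrable_gradInt hδ hδT)
    (fun x ↦ ((hM x).2).trans (mul_le_of_le_one_right hM0 (envelope_le_one hT x)))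
    (B := fun w ↦ ∫ s in Ioc δ T, (heat (s + δ) w - heat (s + T) w))
    (MB := (C + C) * (T - δ)) (by
      have : (fun w : EuclideanSpace ℝ (Fin d) ↦
          ∫ s in Ioc δ T, (heat (s + δ) w - heat (s + T) w)) =
          fun w ↦ ((∫ s in Ioc δ T, heat (s + δ) w) - ∫ s in Ioc δ T, heat (s + T) w) := by
        ext w
        exact integral_sub (hi hk1 hb1 w) (hi hk2 hb2 w)
      rw [this]
      exact (hcont δ hδ.le hδT).sub (hcont T hT.le le_rfl)) (fun w ↦ by
      refine norm_setIntegral_Ioc_le (f := fun s ↦ heat (s + δ) w - heat (s + T) w) hδT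
        fun t ht ↦ ?_
      exact (norm_sub_le _ _).trans (add_le_add (hb1 t ht w) (hb2 t ht w))) hB
  refine ⟨i1, ?_⟩
  rw [h1]
  obtain ⟨j1, e1⟩ := sform_integral (α := α) (β := β) (k := fun q ↦ heat (q.1 + δ) q.2 -
    heat (q.1 + T) q.2) (hk1.sub hk2) (C := C + C) (δ := δ) (T := T)
    fun t ht w ↦ (abs_sub _ _).trans (add_le_add (hb1 t ht w) (hb2 t ht w))
  rw [e1, ← setIntegral_Ioc_add (fun t ↦ sform α β (heat t)) hδT]
  refine setIntegral_mono_on j1 (sform_integral hk1 hb1).1 measurableSet_Ioc fun t ht ↦ ?_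
  have ht0 : 0 < t := hδ.trans ht.1
  have hq : sform α β (fun x ↦ heat (t + δ) x - heat (t + T) x) =
      sform α β (heat (t + δ)) - sform α β (heat (t + T)) := by
    have hi' : ∀ c, 0 < c → ∀ ν : Measure (EuclideanSpace ℝ (Fin d) × EuclideanSpace ℝ (Fin d)),
      IsFiniteMeasure ν → Integrable (fun p ↦ heat c (p.1 - p.2)) ν := fun c hc ν _ ↦
      Integrable.of_bound ((contDiff_heat c).continuous.comp
        continuous_sub).aestronglyMeasurable _
        (Filter.Eventually.of_forall fun _ ↦ abs_heat_le hc _)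
    simp only [sform]
    rw [integral_sub (hi' _ (by linarith) _ inferInstance) (hi' _ (by linarith) _ inferInstance),
      integral_sub (hi' _ (by linarith) _ inferInstance) (hi' _ (by linarith) _ inferInstance)]
    ring
  -- The form at the later time t + T is nonnegative, and dropping it leaves the upper bound.
  rw [hq]
  linarith [sform_heat_nonneg (α := α) (β := β) (by linarith : 0 < t + T)]

end Heat

/-! ### Pairing a function with a measure of finite energy -/

section Duality

variable {α β : Measure (EuclideanSpace ℝ (Fin d))} [IsFiniteMeasure α] [IsFiniteMeasure β]

lemma integral_integral_inner_shift {F : Type*} [NormedAddCommGroup F] [InnerProductSpace ℝ F]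
    [CompleteSpace F] {W a : EuclideanSpace ℝ (Fin d) → F}
    (hW : Integrable W) (ha : Continuous a) {M : ℝ} (hM : ∀ x, ‖a x‖ ≤ M) :
    Integrable (fun x ↦ ∫ z, (inner ℝ (W z) (a (z - x)) : ℝ)) α ∧
      Integrable (fun z ↦ (inner ℝ (W z) (∫ x, a (z - x) ∂α) : ℝ)) ∧
      ∫ x, (∫ z, inner ℝ (W z) (a (z - x))) ∂α = ∫ z, inner ℝ (W z) (∫ x, a (z - x) ∂α) := by
  have hi : Integrable (fun q : EuclideanSpace ℝ (Fin d) × EuclideanSpace ℝ (Fin d) ↦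
      (inner ℝ (W q.1) (a (q.1 - q.2)) : ℝ)) (volume.prod α) := by
    refine ((hW.norm.comp_fst α).mul_const M).mono' ?_ (Filter.Eventually.of_forall fun q ↦ ?_)
    · exact hW.aestronglyMeasurable.comp_fst.inner
        (Continuous.aestronglyMeasurable (by fun_prop))
    · exact (norm_inner_le_norm _ _).trans (mul_le_mul_of_nonneg_left (hM _) (norm_nonneg _))
  have e : ∀ z, ∫ x, inner ℝ (W z) (a (z - x)) ∂α = inner ℝ (W z) (∫ x, a (z - x) ∂α) :=
    fun z ↦ integral_inner (integrable_shift ha hM z) _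
  refine ⟨hi.swap.integral_prod_left, ?_, ?_⟩
  · simpa [e] using hi.integral_prod_left
  · rw [integral_integral_swap (f := fun x z ↦ (inner ℝ (W z) (a (z - x)) : ℝ)) hi.swap]
    simp_rw [e]

/-- The left side is the L² pairing of `W` with the convolution of `gradInt` and the measure.
Cauchy-Schwarz applies, and the squared norm of the convolution is at most the integral of the
quadratic forms over (2δ, T + δ], hence at most `E`. -/
lemma abs_sint_heat_sub_le {F : EuclideanSpace ℝ (Fin d) → ℝ}
    {W : EuclideanSpace ℝ (Fin d) → EuclideanSpace ℝ (Fin d)} (h : HeatIBP F W)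
    (hF : Integrable F) (hW : Integrable W) (hW2 : MemLp W 2) {E : ℝ}
    (hE : ∀ a b : ℝ, 0 < a → a ≤ b → ∫ t in Ioc a b, sform α β (heat t) ≤ E)
    {δ T : ℝ} (hδ : 0 < δ) (hδT : δ ≤ T) :
    |sint α β fun x ↦ ∫ z, F z * (heat δ (z - x) - heat T (z - x))| ≤
      Real.sqrt (∫ z, ‖W z‖ ^ 2) * Real.sqrt E := by
  have hT : 0 < T := hδ.trans_le hδT
  obtain ⟨M, hM0, hM⟩ := exists_heatInt_bound (d := d) hδ hδT
  have hb : ∀ x : EuclideanSpace ℝ (Fin d), ‖gradInt δ T x‖ ≤ M :=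
    fun x ↦ ((hM x).2).trans (mul_le_of_le_one_right hM0 (envelope_le_one hT x))
  have hc := continuous_gradInt (d := d) (T := T) hδ
  obtain ⟨-, i1, e1⟩ := integral_integral_inner_shift (α := α) hW hc hb
  obtain ⟨-, i2, e2⟩ := integral_integral_inner_shift (α := β) hW hc hb
  obtain ⟨j, hj⟩ := integral_sint_gradInt_sq (α := α) (β := β) hδ hδT
  have key : (sint α β fun x ↦ ∫ z, F z * (heat δ (z - x) - heat T (z - x))) =
      ∫ z, inner ℝ (W z) (sint α β fun x ↦ gradInt δ T (z - x)) := by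
    simp_rw [← h.integral_inner_gradInt hF hW hδ hδT]
    rw [sint, e1, e2, ← integral_sub i1 i2]
    simp only [sint, inner_sub_right]
  rw [key]
  have hV : MemLp (fun z ↦ sint α β fun x ↦ gradInt δ T (z - x)) 2 := by
    refine memLp_two_of_integrable_sq_norm ?_ j
    exact ((continuous_integral_shift hc hb).sub
      (continuous_integral_shift hc hb)).aestronglyMeasurable
  refine (abs_integral_inner_le hW2 hV).trans ?_
  gcongr
  exact hj.trans (hE _ _ (by linarith) (by linarith))

/-- The parabolic scaling, in the form of an L¹ normalised dilation by c, as required for an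
approximate identity. -/
lemma heat_inv_sq {c : ℝ} (hc : 0 < c) (x : EuclideanSpace ℝ (Fin d)) :
    heat (c ^ 2)⁻¹ x = c ^ d * heat 1 (c • x) := by
  unfold heat
  have : (4 * Real.pi * (c ^ 2)⁻¹) ^ (-(d : ℝ) / 2) =
      c ^ d * (4 * Real.pi * 1) ^ (-(d : ℝ) / 2) := by
    rw [Real.mul_rpow (by positivity) (by positivity), mul_one, mul_comm, ← Real.rpow_natCast c 2,
      ← Real.rpow_neg hc.le, ← Real.rpow_mul hc.le, ← Real.rpow_natCast c d]
    congr 2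
    push_cast
    ring
  rw [this, norm_smul, Real.norm_of_nonneg hc.le, mul_assoc]
  congr 3
  field_simp

lemma tendsto_integral_mul_heat {F : EuclideanSpace ℝ (Fin d) → ℝ} (hF : Continuous F)
    (hFi : Integrable F) (x : EuclideanSpace ℝ (Fin d)) :
    Filter.Tendsto (fun c : ℝ ↦ ∫ z, F z * heat (c ^ 2)⁻¹ (z - x)) Filter.atTop (nhds (F x)) := by
  have h := tendsto_integral_comp_smul_smul_of_integrable (μ := volume)
    (φ := (heat 1 : EuclideanSpace ℝ (Fin d) → ℝ)) (fun x ↦ (heat_pos one_pos x).le)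
    (integral_heat one_pos) ?_ (g := fun w ↦ F (w + x)) (hFi.comp_add_right x) (by fun_prop)
  · rw [zero_add] at h
    refine h.congr' ?_
    filter_upwards [Filter.eventually_gt_atTop 0] with c hc
    rw [← integral_sub_right_eq_self _ x]
    refine integral_congr_ae (Filter.Eventually.of_forall fun z ↦ ?_)
    simp only [finrank_euclideanSpace_fin, sub_add_cancel, smul_eq_mul]
    rw [heat_inv_sq hc, mul_comm]
  -- The decay condition of the approximate identity: ‖w‖^d p_1(w) tends to 0 at infinity.
  · rw [finrank_euclideanSpace_fin]
    have h1 := (tendsto_rpow_abs_mul_exp_neg_mul_sq_cocompact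
      (a := 1 / (4 * 1)) (by norm_num) d)
    have h2 : Filter.Tendsto (fun r : ℝ ↦ r ^ d * Real.exp (-(1 / (4 * 1)) * r ^ 2)) Filter.atTop
        (nhds 0) := by
      refine (h1.mono_left atTop_le_cocompact).congr' ?_
      filter_upwards [Filter.eventually_ge_atTop 0] with r hr
      rw [abs_of_nonneg hr, Real.rpow_natCast]
    have h3 := (h2.comp (tendsto_norm_cobounded_atTop
      (E := EuclideanSpace ℝ (Fin d)))).const_mul ((4 * Real.pi * 1) ^ (-(d : ℝ) / 2))
    rw [mul_zero] at h3
    refine h3.congr fun w ↦ ?_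
    simp only [Function.comp, heat]
    ring

/-- A function with square integrable gradient pairs with a signed measure of finite energy. -/
theorem abs_sint_le {F : EuclideanSpace ℝ (Fin d) → ℝ}
    {W : EuclideanSpace ℝ (Fin d) → EuclideanSpace ℝ (Fin d)} (hd : 0 < d) (h : HeatIBP F W)
    (hF : Continuous F) (hFc : HasCompactSupport F) (hW : Integrable W) (hW2 : MemLp W 2) {E : ℝ}
    (hE : ∀ a b : ℝ, 0 < a → a ≤ b → ∫ t in Ioc a b, sform α β (heat t) ≤ E) :
    |sint α β F| ≤ Real.sqrt (∫ z, ‖W z‖ ^ 2) * Real.sqrt E := by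
  have hFi : Integrable F := hF.integrable_of_hasCompactSupport hFc
  obtain ⟨M, hM⟩ := hF.bounded_above_of_compact_support hFc
  have hM0 : 0 ≤ M := (norm_nonneg _).trans (hM 0)
  -- A single parameter c sends δ = c⁻² to 0 and T = c² to infinity.
  set f : ℝ → EuclideanSpace ℝ (Fin d) → ℝ := fun c x ↦
    ∫ z, F z * (heat (c ^ 2)⁻¹ (z - x) - heat (c ^ 2) (z - x)) with hf
  have hbd : ∀ t : ℝ, 0 < t → ∀ x, |∫ z, F z * heat t (z - x)| ≤ M := by
    intro t ht x
    calc |∫ z, F z * heat t (z - x)| ≤ ∫ z, |F z * heat t (z - x)| := abs_integral_le_integral_abs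
      _ ≤ ∫ z, M * heat t (z - x) := by
        refine integral_mono_of_nonneg (Filter.Eventually.of_forall fun _ ↦ abs_nonneg _)
          (((integrable_heat ht).comp_sub_right x).const_mul M)
          (Filter.Eventually.of_forall fun z ↦ ?_)
        simp only [abs_mul, abs_of_pos (heat_pos ht _)]
        exact mul_le_mul_of_nonneg_right (hM z) (heat_pos ht _).le
      _ = M := by
        rw [integral_const_mul, integral_sub_right_eq_self (fun z ↦ heat t z), integral_heat ht,
          mul_one]
  have hint : ∀ t : ℝ, 0 < t → ∀ x, Integrable fun z ↦ F z * heat t (z - x) := fun t ht x ↦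
    hFi.mul_bdd (((contDiff_heat t).continuous.comp (continuous_sub_right x)).aestronglyMeasurable)
        (Filter.Eventually.of_forall fun z ↦ abs_heat_le ht _)
  have hsub : ∀ c : ℝ, 0 < c → ∀ x, f c x =
      (∫ z, F z * heat (c ^ 2)⁻¹ (z - x)) - ∫ z, F z * heat (c ^ 2) (z - x) := by
    intro c hc x
    rw [hf, ← integral_sub (hint _ (by positivity) x) (hint _ (by positivity) x)]
    simp only [mul_sub]
  have hlim : ∀ x, Filter.Tendsto (fun c ↦ f c x) Filter.atTop (nhds (F x)) := by
    intro x
    have h2 : Filter.Tendsto (fun c : ℝ ↦ ∫ z, F z * heat (c ^ 2) (z - x)) Filter.atTop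
        (nhds 0) := by
      -- At time c² the heat kernel is uniformly of order c^(-d), so the average of the integrable
      -- function `F` against it vanishes in the limit.
      have h3 : Filter.Tendsto (fun c : ℝ ↦ (∫ z, |F z|) *
          (4 * Real.pi * c ^ 2) ^ (-(d : ℝ) / 2)) Filter.atTop (nhds 0) := by
        rw [← mul_zero (∫ z, |F z|)]
        refine Filter.Tendsto.const_mul _ ?_
        have : -(d : ℝ) / 2 = -((d : ℝ) / 2) := by ring
        rw [this]
        refine (tendsto_rpow_neg_atTop (by positivity)).comp ?_
        exact (Filter.tendsto_pow_atTop two_ne_zero).const_mul_atTop (by positivity)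
      refine squeeze_zero_norm' ?_ h3
      filter_upwards [Filter.eventually_gt_atTop 0] with c hc
      rw [← integral_mul_const]
      refine (norm_integral_le_integral_norm _).trans (integral_mono_of_nonneg
        (Filter.Eventually.of_forall fun _ ↦ norm_nonneg _) (hFi.norm.mul_const _)
        (Filter.Eventually.of_forall fun z ↦ ?_))
      simp only [norm_mul]
      exact mul_le_mul_of_nonneg_left (abs_heat_le (by positivity) _) (norm_nonneg _)
    have h4 := (tendsto_integral_mul_heat hF hFi x).sub h2
    rw [sub_zero] at h4
    refine h4.congr' ?_
    filter_upwards [Filter.eventually_gt_atTop 0] with c hc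
    rw [hsub c hc]
  have hmeas : ∀ (c : ℝ) (ν : Measure (EuclideanSpace ℝ (Fin d))), AEStronglyMeasurable (f c) ν := by
    intro c ν
    have hk : StronglyMeasurable fun q : EuclideanSpace ℝ (Fin d) × EuclideanSpace ℝ (Fin d) ↦
        F q.2 * (heat (c ^ 2)⁻¹ (q.2 - q.1) - heat (c ^ 2) (q.2 - q.1)) := by
      have h1 := (contDiff_heat (d := d) (c ^ 2)⁻¹).continuous
      have h2 := (contDiff_heat (d := d) (c ^ 2)).continuous
      exact Continuous.stronglyMeasurable ((hF.comp continuous_snd).mul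
        ((h1.comp (by fun_prop)).sub (h2.comp (by fun_prop))))
    exact hk.integral_prod_right'.aestronglyMeasurable
  have hten : ∀ (ν : Measure (EuclideanSpace ℝ (Fin d))) [IsFiniteMeasure ν],
      Filter.Tendsto (fun c ↦ ∫ x, f c x ∂ν) Filter.atTop (nhds (∫ x, F x ∂ν)) := by
    intro ν _
    refine tendsto_integral_filter_of_dominated_convergence (fun _ ↦ M + M)
      (Filter.Eventually.of_forall fun c ↦ hmeas c ν) ?_ (integrable_const _)
      (Filter.Eventually.of_forall hlim)
    filter_upwards [Filter.eventually_gt_atTop 0] with c hc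
    refine Filter.Eventually.of_forall fun x ↦ ?_
    rw [hsub c hc]
    exact (norm_sub_le _ _).trans (add_le_add (hbd _ (by positivity) x) (hbd _ (by positivity) x))
  have hs : Filter.Tendsto (fun c ↦ sint α β (f c)) Filter.atTop (nhds (sint α β F)) :=
    (hten α).sub (hten β)
  refine le_of_tendsto hs.abs ?_
  filter_upwards [Filter.eventually_ge_atTop 1] with c hc
  refine abs_sint_heat_sub_le h hFi hW hW2 hE (by positivity) ?_
  have : (1 : ℝ) ≤ c ^ 2 := one_le_pow₀ hc
  exact (inv_le_one_of_one_le₀ this).trans this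

end Duality

/-! ### The Coulomb kernel as a time integral of heat kernels -/

/-- The substitution of 1/t for t gives Euler's integral for the Gamma function. -/
lemma integral_rpow_mul_exp_neg_div_Ioi {a ρ : ℝ} (ha : 0 < a) (hρ : 0 < ρ) :
    IntegrableOn (fun t : ℝ ↦ t ^ (-(a + 1)) * Real.exp (-(ρ / t))) (Ioi 0) ∧
      ∫ t in Ioi (0 : ℝ), t ^ (-(a + 1)) * Real.exp (-(ρ / t)) =
        (1 / ρ) ^ a * Real.Gamma a := by
  have e : ∀ t ∈ Ioi (0 : ℝ), (|(-1 : ℝ)| * t ^ ((-1 : ℝ) - 1)) •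
      ((t ^ (-1 : ℝ)) ^ (a - 1) * Real.exp (-(ρ * t ^ (-1 : ℝ)))) =
      t ^ (-(a + 1)) * Real.exp (-(ρ / t)) := by
    intro t ht
    have ht : 0 < t := ht
    rw [smul_eq_mul, abs_neg, abs_one, one_mul, ← mul_assoc, ← Real.rpow_mul ht.le,
      ← Real.rpow_add ht, Real.rpow_neg_one, div_eq_mul_inv]
    congr 2
    ring
  have h1 := integral_comp_rpow_Ioi (fun s : ℝ ↦ s ^ (a - 1) * Real.exp (-(ρ * s)))
    (p := -1) (by norm_num)
  rw [Real.integral_rpow_mul_exp_neg_mul_Ioi ha hρ, setIntegral_congr_fun measurableSet_Ioi e] at h1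
  refine ⟨?_, h1⟩
  refine Integrable.of_integral_ne_zero ?_
  rw [h1]
  have := Real.Gamma_pos_of_pos ha
  positivity

/-- The function of time that is subtracted from the heat kernel to make its time integral
converge. -/
def heatShift (d : ℕ) (t : ℝ) : ℝ :=
  if d = 2 then (4 * Real.pi * t)⁻¹ * Real.exp (-(1 / (4 * t))) else 0

lemma heatShift_nonneg {t : ℝ} (ht : 0 < t) : 0 ≤ heatShift d t := by
  unfold heatShift
  split_ifs <;> positivity

lemma measurable_heatShift : Measurable (heatShift d) := by
  unfold heatShift
  split_ifs <;> fun_prop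

lemma kernelConst_pos (hd : 2 ≤ d) : 0 < kernelConst d := by
  unfold kernelConst
  split_ifs with h
  · positivity
  · have h3 : 3 ≤ d := by omega
    have h3' : (3 : ℝ) ≤ d := by exact_mod_cast h3
    have hv : 0 < volume.real (Metric.ball (0 : EuclideanSpace ℝ (Fin d)) 1) :=
      ENNReal.toReal_pos (Metric.measure_ball_pos _ _ one_pos).ne' measure_ball_lt_top.ne
    have : 0 < (d : ℝ) - 2 := by linarith
    positivity

/-- Both signs are recorded, because the Coulomb kernel of the plane changes sign and its positive
and negative parts are treated separately in the energy. -/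
lemma lintegral_ofReal_and_neg {f : ℝ → ℝ} {c : ℝ} (hf : IntegrableOn f (Ioi 0))
    (hi : ∫ t in Ioi (0 : ℝ), f t = c) (h : ∀ t ∈ Ioi (0 : ℝ), 0 ≤ f t) :
    ∫⁻ t in Ioi (0 : ℝ), ENNReal.ofReal (f t) = ENNReal.ofReal c ∧
      ∫⁻ t in Ioi (0 : ℝ), ENNReal.ofReal (-f t) = ENNReal.ofReal (-c) := by
  have h0 : 0 ≤ᵐ[volume.restrict (Ioi (0 : ℝ))] f := by
    filter_upwards [ae_restrict_mem measurableSet_Ioi] with t ht using h t ht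
  refine ⟨by rw [← hi, ofReal_integral_eq_lintegral_ofReal hf h0], ?_⟩
  rw [ENNReal.ofReal_of_nonpos (by rw [← hi]; exact neg_nonpos.2 (integral_nonneg_of_ae h0)),
    setLIntegral_congr_fun (g := fun _ ↦ 0) measurableSet_Ioi, lintegral_zero]
  intro t ht
  exact ENNReal.ofReal_of_nonpos (neg_nonpos.2 (h t ht))

/-- A Frullani integral. -/
lemma integral_exp_sub_exp {u v : ℝ} (hu : 0 < u) (huv : u ≤ v) :
    IntegrableOn (fun t : ℝ ↦ (4 * Real.pi * t)⁻¹ *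
        (Real.exp (-(1 / (4 * t)) * u) - Real.exp (-(1 / (4 * t)) * v))) (Ioi 0) ∧
      ∫ t in Ioi (0 : ℝ), (4 * Real.pi * t)⁻¹ *
        (Real.exp (-(1 / (4 * t)) * u) - Real.exp (-(1 / (4 * t)) * v)) =
        (1 / (4 * Real.pi)) * (Real.log v - Real.log u) := by
  -- `k t w` is minus the derivative in w of exp(-w/(4t)) / (4πt). Exchanging the integrals over t
  -- and over w in (u, v] leaves the integral of 1/(4πw), a logarithm.
  set k : ℝ → ℝ → ℝ := fun t w ↦ (16 * Real.pi)⁻¹ * (t ^ (-((1 : ℝ) + 1)) *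
    Real.exp (-((w / 4) / t))) with hk
  have hkm : Measurable fun p : ℝ × ℝ ↦ k p.1 p.2 := by
    simp only [hk]; fun_prop
  have hk0 : ∀ t ∈ Ioi (0 : ℝ), ∀ w, 0 ≤ k t w := fun t ht w ↦ by
    have : 0 < t := ht
    simp only [hk]; positivity
  have hkw : ∀ w, 0 < w → IntegrableOn (fun t ↦ k t w) (Ioi 0) ∧
      ∫ t in Ioi (0 : ℝ), k t w = (4 * Real.pi)⁻¹ * w⁻¹ := by
    intro w hw
    obtain ⟨h1, h2⟩ := integral_rpow_mul_exp_neg_div_Ioi one_pos (by positivity : 0 < w / 4)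
    refine ⟨h1.const_mul _, ?_⟩
    simp only [hk]
    rw [integral_const_mul, h2, Real.rpow_one, Real.Gamma_one]
    field_simp
    norm_num
  have hkt : ∀ t ∈ Ioi (0 : ℝ), ∫ w in Ioc u v, k t w = (4 * Real.pi * t)⁻¹ *
        (Real.exp (-(1 / (4 * t)) * u) - Real.exp (-(1 / (4 * t)) * v)) := by
    intro t ht
    have ht : 0 < t := ht
    rw [← intervalIntegral.integral_of_le huv]
    have hd : ∀ w ∈ uIcc u v, HasDerivAt
        (fun w ↦ -((4 * Real.pi * t)⁻¹ * Real.exp (-(1 / (4 * t)) * w))) (k t w) w := by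
      intro w _
      have := ((((hasDerivAt_id w).const_mul (-(1 / (4 * t)))).exp).const_mul
        (4 * Real.pi * t)⁻¹).neg
      simp only [id, mul_one] at this
      refine this.congr_deriv ?_
      simp only [hk]
      have e1 : t ^ (-((1 : ℝ) + 1)) = (t ^ 2)⁻¹ := by
        rw [Real.rpow_neg ht.le, show (1 : ℝ) + 1 = (2 : ℕ) by norm_num, Real.rpow_natCast]
      have e2 : -(w / 4 / t) = -(1 / (4 * t)) * w := by field_simp
      rw [e1, e2]
      field_simp
      norm_num
    rw [intervalIntegral.integral_eq_sub_of_hasDerivAt hd]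
    · ring
    · refine Continuous.intervalIntegrable ?_ _ _
      simp only [hk]
      fun_prop
  have hint : Integrable (fun p : ℝ × ℝ ↦ k p.1 p.2)
      ((volume.restrict (Ioi 0)).prod (volume.restrict (Ioc u v))) := by
    refine (integrable_prod_iff' hkm.aestronglyMeasurable).2 ⟨?_, ?_⟩
    · filter_upwards [ae_restrict_mem measurableSet_Ioc] with w hw
      exact (hkw w (hu.trans hw.1)).1
    · have : IntegrableOn (fun w : ℝ ↦ (4 * Real.pi)⁻¹ * w⁻¹) (Ioc u v) := by
        refine (ContinuousOn.integrableOn_Icc ?_).mono_set Ioc_subset_Icc_self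
        exact continuousOn_const.mul (continuousOn_id.inv₀ fun w hw ↦ (hu.trans_le hw.1).ne')
      refine this.congr ?_
      filter_upwards [ae_restrict_mem measurableSet_Ioc] with w hw
      rw [← (hkw w (hu.trans hw.1)).2]
      refine setIntegral_congr_fun measurableSet_Ioi fun t ht ↦ ?_
      exact (Real.norm_of_nonneg (hk0 t ht w)).symm
  have hsw := integral_integral_swap (f := k) hint
  rw [setIntegral_congr_fun measurableSet_Ioi hkt,
    setIntegral_congr_fun measurableSet_Ioc fun w hw ↦ (hkw w (hu.trans hw.1)).2] at hsw
  refine ⟨hint.integral_prod_left.congr ?_, ?_⟩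
  · filter_upwards [ae_restrict_mem measurableSet_Ioi] with t ht using hkt t ht
  · rw [hsw, ← intervalIntegral.integral_of_le huv, intervalIntegral.integral_const_mul,
      integral_inv_of_pos hu (hu.trans_le huv), Real.log_div (hu.trans_le huv).ne' hu.ne']
    ring

/-- The Coulomb kernel is a time integral of heat kernels. -/
lemma exists_kernel_eq (hd : 2 ≤ d) : ∃ A : ℝ, 0 < A ∧
    ∀ x : EuclideanSpace ℝ (Fin d), x ≠ 0 →
      ∫⁻ t in Ioi (0 : ℝ), ENNReal.ofReal (heat t x - heatShift d t) =
        ENNReal.ofReal (A * kernel d x) ∧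
      ∫⁻ t in Ioi (0 : ℝ), ENNReal.ofReal (-(heat t x - heatShift d t)) =
        ENNReal.ofReal (-(A * kernel d x)) := by
  have hc := kernelConst_pos hd
  by_cases h2 : d = 2
  · subst h2
    -- The factor is 1 here and also for d ≥ 3, but only its positivity matters, so that the
    -- constants need not be matched.
    refine ⟨(1 / (2 * Real.pi)) / kernelConst 2, by positivity, fun x hx ↦ ?_⟩
    have hr : 0 < ‖x‖ := norm_pos_iff.2 hx
    have hk : 1 / (2 * Real.pi) / kernelConst 2 * kernel 2 x =
        (1 / (4 * Real.pi)) * (Real.log 1 - Real.log (‖x‖ ^ 2)) := by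
      simp only [kernel, if_true]
      rw [Real.log_one, Real.log_pow]
      field_simp
      push_cast
      ring
    have hh : ∀ t ∈ Ioi (0 : ℝ), heat t x - heatShift 2 t = (4 * Real.pi * t)⁻¹ *
        (Real.exp (-(1 / (4 * t)) * ‖x‖ ^ 2) - Real.exp (-(1 / (4 * t)) * 1)) := by
      intro t ht
      simp only [heat, heatShift, if_true]
      push_cast
      rw [show -(2 : ℝ) / 2 = -1 by norm_num, Real.rpow_neg_one]
      ring_nf
    -- The subtracted function is the heat kernel at distance 1, where the logarithm vanishes. Hence
    -- the integrand has a fixed sign in t on either side of ‖x‖ = 1.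
    rcases le_total (‖x‖ ^ 2) 1 with h | h
    · obtain ⟨i, e⟩ := integral_exp_sub_exp (by positivity) h
      rw [← setIntegral_congr_fun measurableSet_Ioi hh, ← hk] at e
      have i' := i.congr_fun (fun t ht ↦ (hh t ht).symm) measurableSet_Ioi
      refine lintegral_ofReal_and_neg i' e fun t ht ↦ ?_
      have ht' : 0 < t := ht
      rw [hh t ht]
      refine mul_nonneg (by positivity) (sub_nonneg.2 (Real.exp_le_exp.2 ?_))
      have : 0 ≤ 1 / (4 * t) := by positivity
      nlinarith
    · obtain ⟨i, e⟩ := integral_exp_sub_exp one_pos h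
      have hh' : ∀ t ∈ Ioi (0 : ℝ), -(heat t x - heatShift 2 t) = (4 * Real.pi * t)⁻¹ *
        (Real.exp (-(1 / (4 * t)) * 1) - Real.exp (-(1 / (4 * t)) * ‖x‖ ^ 2)) := by
        intro t ht
        rw [hh t ht]; ring
      have e' : ∫ t in Ioi (0 : ℝ), -(heat t x - heatShift 2 t) =
          -(1 / (2 * Real.pi) / kernelConst 2 * kernel 2 x) := by
        rw [setIntegral_congr_fun measurableSet_Ioi hh', e, hk]; ring
      have i' := i.congr_fun (fun t ht ↦ (hh' t ht).symm) measurableSet_Ioi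
      have := lintegral_ofReal_and_neg i' e' fun t ht ↦ ?_
      · simp only [neg_neg] at this
        exact this.symm
      have ht' : 0 < t := ht
      rw [hh' t ht]
      refine mul_nonneg (by positivity) (sub_nonneg.2 (Real.exp_le_exp.2 ?_))
      have : 0 ≤ 1 / (4 * t) := by positivity
      nlinarith
  · have h3 : (3 : ℝ) ≤ d := by exact_mod_cast (by omega : 3 ≤ d)
    have ha : 0 < (d : ℝ) / 2 - 1 := by linarith
    have hG := Real.Gamma_pos_of_pos ha
    refine ⟨(4 * Real.pi) ^ (-(d : ℝ) / 2) * (4 ^ ((d : ℝ) / 2 - 1) *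
      Real.Gamma ((d : ℝ) / 2 - 1)) / kernelConst d, by positivity, fun x hx ↦ ?_⟩
    have hr : 0 < ‖x‖ := norm_pos_iff.2 hx
    obtain ⟨i, e⟩ := integral_rpow_mul_exp_neg_div_Ioi ha (by positivity : 0 < ‖x‖ ^ 2 / 4)
    have hh : ∀ t ∈ Ioi (0 : ℝ), heat t x - heatShift d t = (4 * Real.pi) ^ (-(d : ℝ) / 2) *
        (t ^ (-((d : ℝ) / 2 - 1 + 1)) * Real.exp (-(‖x‖ ^ 2 / 4 / t))) := by
      intro t ht
      have ht' : 0 < t := ht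
      simp only [heat, heatShift, if_neg h2, sub_zero]
      rw [Real.mul_rpow (by positivity) ht'.le, mul_assoc]
      congr 3
      · ring
      · field_simp
    refine lintegral_ofReal_and_neg
      (IntegrableOn.congr_fun (i.const_mul _) (fun t ht ↦ (hh t ht).symm) measurableSet_Ioi) ?_ ?_
    · rw [setIntegral_congr_fun measurableSet_Ioi hh, integral_const_mul, e]
      simp only [kernel, if_neg h2]
      have : (1 / (‖x‖ ^ 2 / 4)) ^ ((d : ℝ) / 2 - 1) =
          4 ^ ((d : ℝ) / 2 - 1) / ‖x‖ ^ (d - 2) := by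
        rw [one_div_div, Real.div_rpow (by norm_num) (by positivity), ← Real.rpow_natCast ‖x‖ 2,
          ← Real.rpow_mul hr.le, ← Real.rpow_natCast ‖x‖ (d - 2), Nat.cast_sub hd]
        congr 2
        push_cast
        ring
      rw [this]
      field_simp
    · intro t ht
      have ht' : 0 < t := ht
      rw [hh t ht]
      positivity

/-- For d = 2 the singular factor 1/t is cancelled by exp(-1/(4t)) ≤ 4t. -/
lemma lintegral_heatShift_lt_top : ∫⁻ t in Ioc (0 : ℝ) 1, ENNReal.ofReal (heatShift d t) < ⊤ := by
  refine (setLIntegral_mono' (g := fun _ ↦ ENNReal.ofReal 1) measurableSet_Ioc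
    fun t ht ↦ ENNReal.ofReal_le_ofReal ?_).trans_lt (by simp)
  have ht : 0 < t := ht.1
  unfold heatShift
  split_ifs with h
  · have h1 : Real.exp (-(1 / (4 * t))) ≤ 4 * t := by
      have := Real.add_one_le_exp (1 / (4 * t))
      rw [Real.exp_neg]
      refine inv_le_of_inv_le₀ (by positivity) ?_
      rw [← one_div]; linarith
    calc (4 * Real.pi * t)⁻¹ * Real.exp (-(1 / (4 * t))) ≤ (4 * Real.pi * t)⁻¹ * (4 * t) := by
          gcongr
      _ = 1 / Real.pi := by field_simp
      _ ≤ 1 := by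
        rw [div_le_one Real.pi_pos]
        linarith [Real.pi_gt_three]
  · exact zero_le_one

/-- For d = 2 the two Gaussians differ by O(1/t), uniformly in ‖x‖ ≤ R, so the difference is O(t⁻²).
For d ≥ 3 the heat kernel is itself at most t^(-d/2). The exponent -3/2 serves both cases and is
integrable at infinity. -/
lemma abs_heat_sub_heatShift_le (hd : 2 ≤ d) {R : ℝ} {x : EuclideanSpace ℝ (Fin d)} (hx : ‖x‖ ≤ R)
    {t : ℝ} (ht : 1 < t) :
    |heat t x - heatShift d t| ≤ (R ^ 2 + 1) * t ^ (-(3 / 2) : ℝ) := by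
  have ht0 : 0 < t := by linarith
  have hR : 0 ≤ R ^ 2 := sq_nonneg R
  have hx2 : ‖x‖ ^ 2 ≤ R ^ 2 := by gcongr
  have h4 : 1 ≤ 4 * Real.pi := by linarith [Real.pi_gt_three]
  by_cases h2 : d = 2
  · subst h2
    have hh : heat t x - heatShift 2 t = (4 * Real.pi * t)⁻¹ *
        (Real.exp (-((1 / (4 * t)) * ‖x‖ ^ 2)) - Real.exp (-(1 / (4 * t)))) := by
      simp only [heat, heatShift, if_true]
      push_cast
      rw [show -(2 : ℝ) / 2 = -1 by norm_num, Real.rpow_neg_one]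
      ring_nf
    have hexp : ∀ y : ℝ, 0 ≤ y → 1 - y ≤ Real.exp (-y) ∧ Real.exp (-y) ≤ 1 := fun y hy ↦
      ⟨by linarith [Real.add_one_le_exp (-y)], Real.exp_le_one_iff.2 (by linarith)⟩
    obtain ⟨a1, a2⟩ := hexp ((1 / (4 * t)) * ‖x‖ ^ 2) (by positivity)
    obtain ⟨b1, b2⟩ := hexp (1 / (4 * t)) (by positivity)
    have hd1 : |Real.exp (-((1 / (4 * t)) * ‖x‖ ^ 2)) - Real.exp (-(1 / (4 * t)))| ≤
        (R ^ 2 + 1) * t⁻¹ := by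
      have c1 : (1 / (4 * t)) * ‖x‖ ^ 2 ≤ t⁻¹ * R ^ 2 := by
        gcongr
        rw [one_div]
        exact inv_anti₀ ht0 (by linarith)
      have c2 : 1 / (4 * t) ≤ t⁻¹ := by
        rw [one_div]
        exact inv_anti₀ ht0 (by linarith)
      have c3 : 0 ≤ t⁻¹ * R ^ 2 := by positivity
      have c4 : 0 ≤ t⁻¹ := by positivity
      rw [abs_le]
      constructor <;> nlinarith
    have hi : (4 * Real.pi * t)⁻¹ ≤ t⁻¹ := inv_anti₀ ht0 (by nlinarith)
    rw [hh, abs_mul, abs_of_pos (by positivity)]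
    calc (4 * Real.pi * t)⁻¹ * |Real.exp (-((1 / (4 * t)) * ‖x‖ ^ 2)) - Real.exp (-(1 / (4 * t)))|
        ≤ t⁻¹ * ((R ^ 2 + 1) * t⁻¹) := by
          gcongr
      _ = (R ^ 2 + 1) * t ^ (-2 : ℝ) := by
          rw [Real.rpow_neg ht0.le, Real.rpow_two]
          field_simp
      _ ≤ _ := by
          gcongr
          · exact ht.le
          · norm_num
  · have h3 : (3 : ℝ) ≤ d := by exact_mod_cast (by omega : 3 ≤ d)
    simp only [heatShift, if_neg h2, sub_zero]
    refine (abs_heat_le ht0 x).trans ?_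
    have h1 : (4 * Real.pi * t) ^ (-(d : ℝ) / 2) ≤ t ^ (-(3 / 2) : ℝ) :=
      (Real.rpow_le_rpow_of_nonpos ht0 (by nlinarith) (by linarith)).trans
        (Real.rpow_le_rpow_of_exponent_le ht.le (by linarith))
    have : 0 ≤ t ^ (-(3 / 2) : ℝ) := by positivity
    nlinarith

lemma lintegral_const_mul_rpow_lt_top (R : ℝ) :
    ∫⁻ t in Ioi (1 : ℝ), ENNReal.ofReal ((R ^ 2 + 1) * t ^ (-(3 / 2) : ℝ)) < ⊤ := by
  have := (integrableOn_Ioi_rpow_of_lt (a := -(3 / 2)) (by norm_num) one_pos).const_mul (R ^ 2 + 1)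
  exact this.lintegral_lt_top

/-- The heat kernel integrated over small times is comparable to the Coulomb kernel. -/
lemma exists_kernel_comparison (hd : 2 ≤ d) {A : ℝ}
    (hA : ∀ x : EuclideanSpace ℝ (Fin d), x ≠ 0 →
      ∫⁻ t in Ioi (0 : ℝ), ENNReal.ofReal (heat t x - heatShift d t) =
        ENNReal.ofReal (A * kernel d x) ∧
      ∫⁻ t in Ioi (0 : ℝ), ENNReal.ofReal (-(heat t x - heatShift d t)) =
        ENNReal.ofReal (-(A * kernel d x))) (R : ℝ) :
    ∃ M : ℝ≥0∞, M ≠ ⊤ ∧ ∀ x : EuclideanSpace ℝ (Fin d), x ≠ 0 → ‖x‖ ≤ R →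
      ENNReal.ofReal (A * kernel d x) ≤ (∫⁻ t in Ioc (0 : ℝ) 1, ENNReal.ofReal (heat t x)) + M ∧
      (∫⁻ t in Ioc (0 : ℝ) 1, ENNReal.ofReal (heat t x)) ≤ ENNReal.ofReal (A * kernel d x) + M ∧
      ENNReal.ofReal (-(A * kernel d x)) ≤ M := by
  -- The error of the comparison consists of the shift at times up to 1 and of everything at later
  -- times. It is finite and uniform in ‖x‖ ≤ R, hence negligible against finite measures.
  set M1 := ∫⁻ t in Ioc (0 : ℝ) 1, ENNReal.ofReal (heatShift d t) with hM1
  set M2 := ∫⁻ t in Ioi (1 : ℝ), ENNReal.ofReal ((R ^ 2 + 1) * t ^ (-(3 / 2) : ℝ)) with hM2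
  have hT1 : M1 < ⊤ := lintegral_heatShift_lt_top
  have hT2 : M2 < ⊤ := lintegral_const_mul_rpow_lt_top R
  have hmb : Measurable fun t ↦ ENNReal.ofReal (heatShift d t) :=
    measurable_heatShift.ennreal_ofReal
  refine ⟨M1 + M2, (ENNReal.add_lt_top.2 ⟨hT1, hT2⟩).ne, fun x hx hxR ↦ ?_⟩
  obtain ⟨h1, h2⟩ := hA x hx
  have hsplit : ∀ f : ℝ → ℝ≥0∞, ∫⁻ t in Ioi (0 : ℝ), f t =
      (∫⁻ t in Ioc (0 : ℝ) 1, f t) + ∫⁻ t in Ioi (1 : ℝ), f t := by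
    intro f
    rw [← Ioc_union_Ioi_eq_Ioi zero_le_one, lintegral_union measurableSet_Ioi]
    exact Ioc_disjoint_Ioi le_rfl
  refine ⟨?_, ?_, ?_⟩
  · rw [← h1, hsplit, add_comm M1, ← add_assoc]
    refine le_add_right (add_le_add ?_ ?_)
    · refine setLIntegral_mono' measurableSet_Ioc fun t ht ↦ ENNReal.ofReal_le_ofReal ?_
      linarith [heatShift_nonneg (d := d) ht.1]
    · refine setLIntegral_mono' measurableSet_Ioi fun t ht ↦ ENNReal.ofReal_le_ofReal ?_
      exact (le_abs_self _).trans (abs_heat_sub_heatShift_le hd hxR ht)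
  · calc (∫⁻ t in Ioc (0 : ℝ) 1, ENNReal.ofReal (heat t x))
        ≤ ∫⁻ t in Ioc (0 : ℝ) 1, (ENNReal.ofReal (heat t x - heatShift d t) +
          ENNReal.ofReal (heatShift d t)) := by
          refine lintegral_mono fun t ↦ ?_
          refine le_trans (le_of_eq ?_) ENNReal.ofReal_add_le
          rw [sub_add_cancel]
      _ = (∫⁻ t in Ioc (0 : ℝ) 1, ENNReal.ofReal (heat t x - heatShift d t)) + M1 :=
          lintegral_add_right _ hmb
      _ ≤ ENNReal.ofReal (A * kernel d x) + (M1 + M2) := by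
          rw [← h1]
          exact add_le_add (lintegral_mono_set Ioc_subset_Ioi_self) (le_add_right le_rfl)
  · rw [← h2, hsplit]
    refine add_le_add ?_ ?_
    · refine setLIntegral_mono' measurableSet_Ioc fun t ht ↦ ENNReal.ofReal_le_ofReal ?_
      linarith [heat_pos ht.1 x]
    · refine setLIntegral_mono' measurableSet_Ioi fun t ht ↦ ENNReal.ofReal_le_ofReal ?_
      exact (neg_le_abs _).trans (abs_heat_sub_heatShift_le hd hxR ht)

/-! ### The Coulomb energy as a time integral -/

lemma measurable_kernel : Measurable (kernel d) := by
  unfold kernel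
  split_ifs <;> fun_prop

lemma measurable_heat_sub : Measurable
    fun q : ℝ × (EuclideanSpace ℝ (Fin d) × EuclideanSpace ℝ (Fin d)) ↦
      heat q.1 (q.2.1 - q.2.2) :=
  measurable_heat.comp (by fun_prop :
    Measurable fun q : ℝ × (EuclideanSpace ℝ (Fin d) × EuclideanSpace ℝ (Fin d)) ↦
      (q.1, q.2.1 - q.2.2))

lemma measurable_kernel_sub : Measurable
    fun p : EuclideanSpace ℝ (Fin d) × EuclideanSpace ℝ (Fin d) ↦ kernel d (p.1 - p.2) :=
  measurable_kernel.comp (by fun_prop)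

lemma integrable_heat_sub {t : ℝ} (ht : 0 < t)
    (N : Measure (EuclideanSpace ℝ (Fin d) × EuclideanSpace ℝ (Fin d))) [IsFiniteMeasure N] :
    Integrable (fun p : EuclideanSpace ℝ (Fin d) × EuclideanSpace ℝ (Fin d) ↦
      heat t (p.1 - p.2)) N :=
  Integrable.of_bound ((contDiff_heat t).continuous.comp continuous_sub).aestronglyMeasurable _
    (Filter.Eventually.of_forall fun _ ↦ abs_heat_le ht _)

/-- If the heat kernels charge the finite measure `N₂` less than `N₁`, then finiteness of the
Coulomb energy passes from `N₁` to `N₂`, and the difference of the energies is a time integral. -/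
theorem energy_of_heat_le (hd : 2 ≤ d) {A : ℝ} (hA0 : 0 < A)
    (hA : ∀ x : EuclideanSpace ℝ (Fin d), x ≠ 0 →
      ∫⁻ t in Ioi (0 : ℝ), ENNReal.ofReal (heat t x - heatShift d t) =
        ENNReal.ofReal (A * kernel d x) ∧
      ∫⁻ t in Ioi (0 : ℝ), ENNReal.ofReal (-(heat t x - heatShift d t)) =
        ENNReal.ofReal (-(A * kernel d x))) {R : ℝ}
    (N₁ N₂ : Measure (EuclideanSpace ℝ (Fin d) × EuclideanSpace ℝ (Fin d))) [IsFiniteMeasure N₁]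
    [IsFiniteMeasure N₂]
    (h₁ : ∀ᵐ p ∂N₁, p.1 - p.2 ≠ 0 ∧ ‖p.1 - p.2‖ ≤ R)
    (h₂ : ∀ᵐ p ∂N₂, p.1 - p.2 ≠ 0 ∧ ‖p.1 - p.2‖ ≤ R)
    (hle : ∀ t : ℝ, 0 < t → ∫ p, heat t (p.1 - p.2) ∂N₂ ≤ ∫ p, heat t (p.1 - p.2) ∂N₁)
    (hmass : ∀ t, heatShift d t * N₁.real univ = heatShift d t * N₂.real univ)
    (hfin : ∫⁻ p, ENNReal.ofReal (kernel d (p.1 - p.2)) ∂N₁ ≠ ⊤) :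
    Integrable (fun p ↦ kernel d (p.1 - p.2)) N₁ ∧ Integrable (fun p ↦ kernel d (p.1 - p.2)) N₂ ∧
      IntegrableOn (fun t ↦ ∫ p, heat t (p.1 - p.2) ∂N₁ - ∫ p, heat t (p.1 - p.2) ∂N₂) (Ioi 0) ∧
      ∫ t in Ioi (0 : ℝ), (∫ p, heat t (p.1 - p.2) ∂N₁ - ∫ p, heat t (p.1 - p.2) ∂N₂) =
        A * (∫ p, kernel d (p.1 - p.2) ∂N₁ - ∫ p, kernel d (p.1 - p.2) ∂N₂) := by
  obtain ⟨M, hM, hcmp⟩ := exists_kernel_comparison hd hA R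
  set P : EuclideanSpace ℝ (Fin d) × EuclideanSpace ℝ (Fin d) → ℝ≥0∞ := fun p ↦
    ∫⁻ t in Ioc (0 : ℝ) 1, ENNReal.ofReal (heat t (p.1 - p.2)) with hP
  have hofReal : ∀ y : ℝ, ENNReal.ofReal (A * y) = ENNReal.ofReal A * ENNReal.ofReal y :=
    fun y ↦ ENNReal.ofReal_mul hA0.le
  have hmk : Measurable fun p : EuclideanSpace ℝ (Fin d) × EuclideanSpace ℝ (Fin d) ↦
      ENNReal.ofReal (kernel d (p.1 - p.2)) := measurable_kernel_sub.ennreal_ofReal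
  -- The small time part `P` of the kernel is nonnegative, unlike the planar Coulomb kernel, so
  -- Tonelli transfers `hle` to it. This carries finiteness from `N₁` to `N₂` before anything is
  -- subtracted.
  have hPP : ∫⁻ p, P p ∂N₂ ≤ ∫⁻ p, P p ∂N₁ := by
    have hsw : ∀ (N : Measure (EuclideanSpace ℝ (Fin d) × EuclideanSpace ℝ (Fin d)))
        [IsFiniteMeasure N], ∫⁻ p, P p ∂N =
        ∫⁻ t in Ioc (0 : ℝ) 1, ∫⁻ p, ENNReal.ofReal (heat t (p.1 - p.2)) ∂N := by
      intro N _
      exact (lintegral_lintegral_swap measurable_heat_sub.ennreal_ofReal.aemeasurable).symm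
    rw [hsw, hsw]
    refine setLIntegral_mono' measurableSet_Ioc fun t ht ↦ ?_
    rw [← ofReal_integral_eq_lintegral_ofReal (integrable_heat_sub ht.1 N₂)
      (Filter.Eventually.of_forall fun p ↦ (heat_pos ht.1 _).le),
      ← ofReal_integral_eq_lintegral_ofReal (integrable_heat_sub ht.1 N₁)
      (Filter.Eventually.of_forall fun p ↦ (heat_pos ht.1 _).le)]
    exact ENNReal.ofReal_le_ofReal (hle t ht.1)
  have hP1 : ∫⁻ p, P p ∂N₁ ≠ ⊤ := by
    have : ∫⁻ p, P p ∂N₁ ≤ ∫⁻ p, (ENNReal.ofReal A * ENNReal.ofReal (kernel d (p.1 - p.2)) + M) ∂N₁ := by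
      refine lintegral_mono_ae ?_
      filter_upwards [h₁] with p hp
      rw [← hofReal]
      exact (hcmp _ hp.1 hp.2).2.1
    refine ne_top_of_le_ne_top ?_ this
    rw [lintegral_add_right _ measurable_const, lintegral_const_mul _ hmk, lintegral_const]
    exact ENNReal.add_ne_top.2 ⟨ENNReal.mul_ne_top ENNReal.ofReal_ne_top hfin,
      ENNReal.mul_ne_top hM (measure_ne_top _ _)⟩
  have hP2 : ∫⁻ p, P p ∂N₂ ≠ ⊤ := ne_top_of_le_ne_top hP1 hPP
  have habs : ∀ (N : Measure (EuclideanSpace ℝ (Fin d) × EuclideanSpace ℝ (Fin d)))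
      [IsFiniteMeasure N], (∀ᵐ p ∂N, p.1 - p.2 ≠ 0 ∧ ‖p.1 - p.2‖ ≤ R) → ∫⁻ p, P p ∂N ≠ ⊤ →
      ∫⁻ p, (ENNReal.ofReal (A * kernel d (p.1 - p.2)) +
        ENNReal.ofReal (-(A * kernel d (p.1 - p.2)))) ∂N ≠ ⊤ := by
    intro N _ hN hPN
    have : ∫⁻ p, (ENNReal.ofReal (A * kernel d (p.1 - p.2)) +
        ENNReal.ofReal (-(A * kernel d (p.1 - p.2)))) ∂N ≤ ∫⁻ p, (P p + (M + M)) ∂N := by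
      refine lintegral_mono_ae ?_
      filter_upwards [hN] with p hp
      obtain ⟨c1, -, c3⟩ := hcmp _ hp.1 hp.2
      rw [← add_assoc]
      exact add_le_add c1 c3
    refine ne_top_of_le_ne_top ?_ this
    rw [lintegral_add_right _ measurable_const, lintegral_const]
    exact ENNReal.add_ne_top.2 ⟨hPN, ENNReal.mul_ne_top (ENNReal.add_ne_top.2 ⟨hM, hM⟩)
      (measure_ne_top _ _)⟩
  have henorm : ∀ y : ℝ, ‖y‖ₑ = ENNReal.ofReal y + ENNReal.ofReal (-y) := by
    intro y
    rw [Real.enorm_eq_ofReal_abs]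
    rcases le_total 0 y with h | h
    · rw [abs_of_nonneg h, ENNReal.ofReal_of_nonpos (neg_nonpos.2 h), add_zero]
    · rw [abs_of_nonpos h, ENNReal.ofReal_of_nonpos h, zero_add]
  have hmf : Measurable fun q : ℝ × (EuclideanSpace ℝ (Fin d) × EuclideanSpace ℝ (Fin d)) ↦
      heat q.1 (q.2.1 - q.2.2) - heatShift d q.1 :=
    measurable_heat_sub.sub (measurable_heatShift.comp measurable_fst)
  have main : ∀ (N : Measure (EuclideanSpace ℝ (Fin d) × EuclideanSpace ℝ (Fin d)))
      [IsFiniteMeasure N], (∀ᵐ p ∂N, p.1 - p.2 ≠ 0 ∧ ‖p.1 - p.2‖ ≤ R) → ∫⁻ p, P p ∂N ≠ ⊤ →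
      Integrable (fun p ↦ kernel d (p.1 - p.2)) N ∧
      IntegrableOn (fun t ↦ ∫ p, heat t (p.1 - p.2) ∂N - heatShift d t * N.real univ) (Ioi 0) ∧
      ∫ t in Ioi (0 : ℝ), (∫ p, heat t (p.1 - p.2) ∂N - heatShift d t * N.real univ) =
        A * ∫ p, kernel d (p.1 - p.2) ∂N := by
    intro N _ hN hPN
    have hfi := habs N hN hPN
    have hAk : Integrable (fun p ↦ A * kernel d (p.1 - p.2)) N := by
      refine ⟨(measurable_kernel_sub.const_mul A).aestronglyMeasurable, ?_⟩
      rw [hasFiniteIntegral_iff_enorm]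
      simp_rw [henorm]
      exact hfi.lt_top
    have hk : Integrable (fun p ↦ kernel d (p.1 - p.2)) N := by
      have := hAk.const_mul A⁻¹
      refine this.congr (Filter.Eventually.of_forall fun p ↦ ?_)
      field_simp
    -- By `hA`, the time integral of |p_t - shift| at a given point is exactly |A g|, whose integral
    -- against `N` is finite.
    have hint : Integrable (fun q : ℝ × (EuclideanSpace ℝ (Fin d) × EuclideanSpace ℝ (Fin d)) ↦
        heat q.1 (q.2.1 - q.2.2) - heatShift d q.1) ((volume.restrict (Ioi 0)).prod N) := by
      refine ⟨hmf.aestronglyMeasurable, ?_⟩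
      rw [hasFiniteIntegral_iff_enorm, lintegral_prod_symm' _ hmf.enorm]
      refine lt_of_le_of_lt (lintegral_mono_ae ?_) hfi.lt_top
      filter_upwards [hN] with p hp
      simp_rw [henorm]
      rw [lintegral_add_left (by
        exact (hmf.comp measurable_prodMk_right).ennreal_ofReal), (hA _ hp.1).1, (hA _ hp.1).2]
    have hpt : ∀ t ∈ Ioi (0 : ℝ), ∫ p, (heat t (p.1 - p.2) - heatShift d t) ∂N =
        ∫ p, heat t (p.1 - p.2) ∂N - heatShift d t * N.real univ := by
      intro t ht
      rw [integral_sub (integrable_heat_sub ht N) (integrable_const _), integral_const,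
        smul_eq_mul, mul_comm]
    refine ⟨hk, ?_, ?_⟩
    · exact IntegrableOn.congr_fun (f := fun t ↦ ∫ p, (heat t (p.1 - p.2) - heatShift d t) ∂N)
        hint.integral_prod_left hpt measurableSet_Ioi
    · rw [← setIntegral_congr_fun measurableSet_Ioi hpt, integral_integral_swap hint,
        ← integral_const_mul]
      refine integral_congr_ae ?_
      filter_upwards [hN, hint.prod_left_ae] with p hp hip
      rw [integral_eq_lintegral_pos_part_sub_lintegral_neg_part hip, (hA _ hp.1).1, (hA _ hp.1).2,
        ENNReal.toReal_ofReal', ENNReal.toReal_ofReal']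
      rcases le_total 0 (A * kernel d (p.1 - p.2)) with h | h
      · rw [max_eq_left h, max_eq_right (by linarith)]; ring
      · rw [max_eq_right h, max_eq_left (by linarith)]; ring
  obtain ⟨a1, b1, c1⟩ := main N₁ h₁ hP1
  obtain ⟨a2, b2, c2⟩ := main N₂ h₂ hP2
  -- The shifts cancel between the two measures, as `hmass` makes their masses agree whenever the
  -- shift is not zero.
  have e : ∀ t, ∫ p, heat t (p.1 - p.2) ∂N₁ - ∫ p, heat t (p.1 - p.2) ∂N₂ =
      (∫ p, heat t (p.1 - p.2) ∂N₁ - heatShift d t * N₁.real univ) -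
        (∫ p, heat t (p.1 - p.2) ∂N₂ - heatShift d t * N₂.real univ) := by
    intro t
    rw [hmass t]
    ring
  simp_rw [e]
  exact ⟨a1, a2, b1.sub b2, by rw [integral_sub b1 b2, c1, c2, mul_sub]⟩

/-! ### Positivity of the energy of an atomless measure -/

section Energy

variable {μ : SignedMeasure (EuclideanSpace ℝ (Fin d))}

lemma isOn_ae {K : Set (EuclideanSpace ℝ (Fin d))} (h : IsOn μ K) :
    (∀ᵐ x ∂μ.toJordanDecomposition.posPart, x ∈ K) ∧
      ∀ᵐ x ∂μ.toJordanDecomposition.negPart, x ∈ K := by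
  rw [IsOn, SignedMeasure.totalVariation, Measure.add_apply, add_eq_zero] at h
  exact h

lemma posPart_or_negPart_singleton (x : EuclideanSpace ℝ (Fin d)) :
    μ.toJordanDecomposition.posPart {x} = 0 ∨ μ.toJordanDecomposition.negPart {x} = 0 := by
  obtain ⟨S, -, -, -, h1, h2⟩ := μ.toJordanDecomposition.exists_compl_positive_negative
  by_cases hx : x ∈ S
  · exact Or.inl (measure_mono_null (singleton_subset_iff.2 hx) h1)
  · exact Or.inr (measure_mono_null (singleton_subset_iff.2 hx) h2)

/-- At each point one Jordan part vanishes anyway, so no cancellation between the parts can hide an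
atom. -/
lemma singleton_eq_zero (h : ∀ x, μ {x} = 0) (x : EuclideanSpace ℝ (Fin d)) :
    μ.toJordanDecomposition.posPart {x} = 0 ∧ μ.toJordanDecomposition.negPart {x} = 0 := by
  have h1 := h x
  rw [μ.apply_eq_posPart_real_sub_negPart_real (measurableSet_singleton x)] at h1
  simp only [measureReal_def] at h1
  rcases posPart_or_negPart_singleton (μ := μ) x with h2 | h2
  · rw [h2, ENNReal.toReal_zero, zero_sub, neg_eq_zero, ENNReal.toReal_eq_zero_iff] at h1
    exact ⟨h2, h1.resolve_right (measure_ne_top _ _)⟩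
  · rw [h2, ENNReal.toReal_zero, sub_zero, ENNReal.toReal_eq_zero_iff] at h1
    exact ⟨h1.resolve_right (measure_ne_top _ _), h2⟩

lemma ae_prod_ne {α β : Measure (EuclideanSpace ℝ (Fin d))} [IsFiniteMeasure α] [IsFiniteMeasure β]
    (h : ∀ᵐ x ∂α, β {x} = 0) : ∀ᵐ p ∂(α.prod β), p ∈ (diagonal (EuclideanSpace ℝ (Fin d)))ᶜ := by
  have hm : MeasurableSet (diagonal (EuclideanSpace ℝ (Fin d))) := isClosed_diagonal.measurableSet
  have : (α.prod β) (diagonal (EuclideanSpace ℝ (Fin d))) = 0 := by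
    rw [Measure.measure_prod_null hm]
    filter_upwards [h] with x hx
    have : Prod.mk x ⁻¹' diagonal (EuclideanSpace ℝ (Fin d)) = {x} := by
      ext y; simp [eq_comm]
    rw [this, hx]; rfl
  exact measure_eq_zero_iff_ae_notMem.1 this

lemma ae_prod_mem {α β : Measure (EuclideanSpace ℝ (Fin d))} [IsFiniteMeasure α] [IsFiniteMeasure β]
    {K : Set (EuclideanSpace ℝ (Fin d))} (h1 : ∀ᵐ x ∂α, x ∈ K) (h2 : ∀ᵐ x ∂β, x ∈ K) :
    ∀ᵐ p ∂(α.prod β), p.1 ∈ K ∧ p.2 ∈ K := by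
  filter_upwards [Measure.quasiMeasurePreserving_fst.ae h1,
    Measure.quasiMeasurePreserving_snd.ae h2] with p a b using ⟨a, b⟩

lemma offDiagPos_eq (h : ∀ x, μ {x} = 0) : offDiagPos μ =
    μ.toJordanDecomposition.posPart.prod μ.toJordanDecomposition.posPart +
      μ.toJordanDecomposition.negPart.prod μ.toJordanDecomposition.negPart := by
  refine Measure.restrict_eq_self_of_ae_mem (ae_add_measure_iff.2 ⟨?_, ?_⟩)
  · exact ae_prod_ne (Filter.Eventually.of_forall fun x ↦ (singleton_eq_zero h x).1)
  · exact ae_prod_ne (Filter.Eventually.of_forall fun x ↦ (singleton_eq_zero h x).2)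

/-- The two parts of a signed measure have no common atoms. -/
lemma offDiagNeg_eq : offDiagNeg μ =
    μ.toJordanDecomposition.posPart.prod μ.toJordanDecomposition.negPart +
      μ.toJordanDecomposition.negPart.prod μ.toJordanDecomposition.posPart := by
  obtain ⟨S, -, -, -, h1, h2⟩ := μ.toJordanDecomposition.exists_compl_positive_negative
  refine Measure.restrict_eq_self_of_ae_mem (ae_add_measure_iff.2 ⟨?_, ?_⟩)
  · refine ae_prod_ne ?_
    filter_upwards [measure_eq_zero_iff_ae_notMem.1 h1] with x hx
    exact measure_mono_null (singleton_subset_iff.2 hx) h2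
  · refine ae_prod_ne ?_
    have h2' : ∀ᵐ x ∂μ.toJordanDecomposition.negPart, x ∈ S := h2
    filter_upwards [h2'] with x hx
    exact measure_mono_null (singleton_subset_iff.2 hx) h1

/-- `energy` groups the four integrals by the sign of the integrand, the right side by the measure.
All four being finite, the regrouping is real arithmetic. -/
lemma energy_eq_of_integrable {N₁ N₂ : Measure (EuclideanSpace ℝ (Fin d) ×
    EuclideanSpace ℝ (Fin d))} (h1 : offDiagPos μ = N₁) (h2 : offDiagNeg μ = N₂)
    (i1 : Integrable (fun p ↦ kernel d (p.1 - p.2)) N₁)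
    (i2 : Integrable (fun p ↦ kernel d (p.1 - p.2)) N₂) :
    energy μ = ((∫ p, kernel d (p.1 - p.2) ∂N₁ - ∫ p, kernel d (p.1 - p.2) ∂N₂ : ℝ) : EReal) := by
  have a1 := i1.lintegral_lt_top.ne
  have a2 := i1.neg.lintegral_lt_top.ne
  have b1 := i2.lintegral_lt_top.ne
  have b2 := i2.neg.lintegral_lt_top.ne
  simp only [Pi.neg_apply] at a2 b2
  rw [integral_eq_lintegral_pos_part_sub_lintegral_neg_part i1,
    integral_eq_lintegral_pos_part_sub_lintegral_neg_part i2, energy, energyPos, energyNeg, h1, h2]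
  rw [← ENNReal.ofReal_toReal a1, ← ENNReal.ofReal_toReal a2, ← ENNReal.ofReal_toReal b1,
    ← ENNReal.ofReal_toReal b2]
  generalize ha1 : (∫⁻ p, ENNReal.ofReal (kernel d (p.1 - p.2)) ∂N₁).toReal = s1
  generalize ha2 : (∫⁻ p, ENNReal.ofReal (-kernel d (p.1 - p.2)) ∂N₁).toReal = s2
  generalize hb1 : (∫⁻ p, ENNReal.ofReal (kernel d (p.1 - p.2)) ∂N₂).toReal = r1
  generalize hb2 : (∫⁻ p, ENNReal.ofReal (-kernel d (p.1 - p.2)) ∂N₂).toReal = r2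
  have p1 : 0 ≤ s1 := by rw [← ha1]; exact ENNReal.toReal_nonneg
  have p2 : 0 ≤ s2 := by rw [← ha2]; exact ENNReal.toReal_nonneg
  have p3 : 0 ≤ r1 := by rw [← hb1]; exact ENNReal.toReal_nonneg
  have p4 : 0 ≤ r2 := by rw [← hb2]; exact ENNReal.toReal_nonneg
  rw [← ENNReal.ofReal_add p1 p4, ← ENNReal.ofReal_add p2 p3, EReal.coe_ennreal_ofReal,
    EReal.coe_ennreal_ofReal, max_eq_left (add_nonneg p1 p4), max_eq_left (add_nonneg p2 p3),
    ← EReal.coe_sub, ENNReal.toReal_ofReal p1, ENNReal.toReal_ofReal p2, ENNReal.toReal_ofReal p3,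
    ENNReal.toReal_ofReal p4]
  congr 1
  ring

/-- The energy of an atomless measure (neutral if `d = 2`) is nonnegative, and it dominates the
time integrals of the quadratic forms of the heat kernels. -/
theorem exists_energy_nonneg (hd : 2 ≤ d) : ∃ A : ℝ, 0 < A ∧
    ∀ K : Set (EuclideanSpace ℝ (Fin d)), IsCompact K →
    ∀ μ : SignedMeasure (EuclideanSpace ℝ (Fin d)), IsOn μ K → (d = 2 → μ univ = 0) →
      (∀ x, μ {x} = 0) → EnergyDefined μ → 0 ≤ energy μ ∧ (energy μ = ⊤ ∨
        ∃ E : ℝ, 0 ≤ E ∧ energy μ = E ∧ ∀ a b : ℝ, 0 < a → a ≤ b →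
          ∫ t in Ioc a b, sform μ.toJordanDecomposition.posPart μ.toJordanDecomposition.negPart
            (heat t) ≤ A * E) := by
  obtain ⟨A, hA0, hA⟩ := exists_kernel_eq hd
  refine ⟨A, hA0, fun K hK μ hμK hneutral hatom hdef ↦ ?_⟩
  -- If the positive part is infinite, the negative part is finite, and the energy is +∞.
  by_cases hpos : energyPos μ = ⊤
  · have hneg : energyNeg μ ≠ ⊤ := hdef.resolve_left (not_not.2 hpos)
    have : energy μ = ⊤ := by
      rw [energy, hpos, EReal.coe_ennreal_top]
      lift energyNeg μ to ℝ≥0 using hneg with r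
      exact EReal.top_sub_coe r
    exact ⟨this ▸ le_top, Or.inl this⟩
  set α := μ.toJordanDecomposition.posPart with hα
  set β := μ.toJordanDecomposition.negPart with hβ
  obtain ⟨r, hr⟩ := hK.isBounded.subset_closedBall (0 : EuclideanSpace ℝ (Fin d))
  obtain ⟨k1, k2⟩ := isOn_ae hμK
  have hN : ∀ N : Measure (EuclideanSpace ℝ (Fin d) × EuclideanSpace ℝ (Fin d)),
      (∀ᵐ p ∂N, p ∈ (diagonal (EuclideanSpace ℝ (Fin d)))ᶜ) → (∀ᵐ p ∂N, p.1 ∈ K ∧ p.2 ∈ K) →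
      ∀ᵐ p ∂N, p.1 - p.2 ≠ 0 ∧ ‖p.1 - p.2‖ ≤ r + r := by
    intro N h1 h2
    filter_upwards [h1, h2] with p hp hpK
    refine ⟨sub_ne_zero.2 hp, (norm_sub_le _ _).trans (add_le_add ?_ ?_)⟩
    · exact mem_closedBall_zero_iff.1 (hr hpK.1)
    · exact mem_closedBall_zero_iff.1 (hr hpK.2)
  have z1 : ∀ x, α {x} = 0 := fun x ↦ (singleton_eq_zero hatom x).1
  have z2 : ∀ x, β {x} = 0 := fun x ↦ (singleton_eq_zero hatom x).2
  have e1 := offDiagPos_eq hatom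
  have e2 := offDiagNeg_eq (μ := μ)
  rw [← hα, ← hβ] at e1 e2
  -- For d = 2, neutrality gives the Jordan parts a common mass m, and both product measures have
  -- mass 2m². Otherwise the shift is zero.
  have hmass : ∀ t, heatShift d t * (α.prod α + β.prod β).real univ =
      heatShift d t * (α.prod β + β.prod α).real univ := by
    intro t
    by_cases h2 : d = 2
    · have h0 := hneutral h2
      rw [μ.apply_eq_posPart_real_sub_negPart_real MeasurableSet.univ, sub_eq_zero] at h0
      congr 1
      rw [measureReal_add_apply, measureReal_add_apply, ← univ_prod_univ]
      simp only [measureReal_prod_prod]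
      rw [← hα, ← hβ] at h0
      rw [h0]
    · simp [heatShift, h2]
  have hfin : ∫⁻ p, ENNReal.ofReal (kernel d (p.1 - p.2)) ∂(α.prod α + β.prod β) ≠ ⊤ := by
    rw [← e1]
    rw [energyPos] at hpos
    exact (ENNReal.add_ne_top.1 hpos).1
  obtain ⟨i1, i2, i3, i4⟩ := energy_of_heat_le hd hA0 hA (α.prod α + β.prod β)
    (α.prod β + β.prod α)
    (ae_add_measure_iff.2 ⟨hN _ (ae_prod_ne (Filter.Eventually.of_forall z1)) (ae_prod_mem k1 k1),
      hN _ (ae_prod_ne (Filter.Eventually.of_forall z2)) (ae_prod_mem k2 k2)⟩)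
    (ae_add_measure_iff.2 ⟨hN _ (ae_prod_ne (Filter.Eventually.of_forall z2)) (ae_prod_mem k1 k2),
      hN _ (ae_prod_ne (Filter.Eventually.of_forall z1)) (ae_prod_mem k2 k1)⟩)
    (fun t ht ↦ sub_nonneg.1 (sform_heat_nonneg (α := α) (β := β) ht)) hmass hfin
  have hE := energy_eq_of_integrable e1 e2 i1 i2
  set E : ℝ := ∫ p, kernel d (p.1 - p.2) ∂(α.prod α + β.prod β) -
    ∫ p, kernel d (p.1 - p.2) ∂(α.prod β + β.prod α) with hEdef
  have hAE : 0 ≤ A * E := by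
    rw [← i4]
    exact setIntegral_nonneg measurableSet_Ioi fun t ht ↦ sform_heat_nonneg (α := α) (β := β) ht
  have hE0 : 0 ≤ E := nonneg_of_mul_nonneg_right hAE hA0
  refine ⟨by rw [hE]; exact_mod_cast hE0, Or.inr ⟨E, hE0, hE, fun a b ha hab ↦ ?_⟩⟩
  rw [← i4]
  refine setIntegral_mono_set i3 ?_ (LE.le.eventuallyLE fun t ht ↦ ha.trans ht.1)
  filter_upwards [ae_restrict_mem measurableSet_Ioi] with t ht
  exact sform_heat_nonneg (α := α) (β := β) ht

end Energy

/-- The integral against a signed measure in terms of its Jordan decomposition. -/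
lemma integral_signedMeasure (μ : SignedMeasure (EuclideanSpace ℝ (Fin d)))
    {f : EuclideanSpace ℝ (Fin d) → ℝ} (h1 : Integrable f μ.toJordanDecomposition.posPart)
    (h2 : Integrable f μ.toJordanDecomposition.negPart) :
    ∫ᵛ x, f x ∂<•μ = sint μ.toJordanDecomposition.posPart μ.toJordanDecomposition.negPart f := by
  have e : μ = μ.toJordanDecomposition.posPart.toSignedMeasure -
      μ.toJordanDecomposition.negPart.toSignedMeasure :=
    μ.toSignedMeasure_toJordanDecomposition.symm
  conv_lhs => rw [e]
  rw [VectorMeasure.integral_sub_vectorMeasure, VectorMeasure.integral_toSignedMeasure,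
    VectorMeasure.integral_toSignedMeasure, sint]
  · simpa [VectorMeasure.Integrable] using h1
  · simpa [VectorMeasure.Integrable] using h2

/-! ### Mollifiers and averages -/

/-- The reflected rescaled mollifier: averaging `q` against `z ↦ mollifier ψ ε (x - z)` is averaging
`y ↦ q (x + ε y)` against `ψ`. -/
def mollifier (ψ : EuclideanSpace ℝ (Fin d) → ℝ) (ε : ℝ) (w : EuclideanSpace ℝ (Fin d)) : ℝ :=
  (ε ^ d)⁻¹ * ψ (-(ε⁻¹ • w))

section Mollifier

variable {ψ : EuclideanSpace ℝ (Fin d) → ℝ} {ε : ℝ}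

lemma contDiff_mollifier (hψ : ContDiff ℝ ∞ ψ) : ContDiff ℝ ∞ (mollifier ψ ε) := by
  unfold mollifier
  exact contDiff_const.mul (hψ.comp (by fun_prop))

lemma mollifier_nonneg (hψ : ∀ x, 0 ≤ ψ x) (hε : 0 < ε) (w : EuclideanSpace ℝ (Fin d)) :
    0 ≤ mollifier ψ ε w := mul_nonneg (by positivity) (hψ _)

lemma tsupport_mollifier {w : EuclideanSpace ℝ (Fin d)} (hw : w ∈ tsupport (mollifier ψ ε)) :
    -(ε⁻¹ • w) ∈ tsupport ψ := by
  have h1 : tsupport (mollifier ψ ε) ⊆ tsupport fun w ↦ ψ (-(ε⁻¹ • w)) := by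
    refine closure_mono fun w hw ↦ ?_
    exact right_ne_zero_of_mul hw
  exact tsupport_comp_subset_preimage ψ (f := fun w : EuclideanSpace ℝ (Fin d) ↦ -(ε⁻¹ • w))
    (by fun_prop) (h1 hw)

lemma hasCompactSupport_mollifier (hψ : HasCompactSupport ψ) (hε : 0 < ε) :
    HasCompactSupport (mollifier ψ ε) := by
  refine HasCompactSupport.mul_left ?_
  exact hψ.comp_homeomorph ((Homeomorph.smulOfNeZero ε⁻¹ (inv_ne_zero hε.ne')).trans
    (Homeomorph.neg _))

lemma integral_mul_mollifier (hε : 0 < ε) (q : EuclideanSpace ℝ (Fin d) → ℝ)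
    (x : EuclideanSpace ℝ (Fin d)) :
    ∫ z, q z * mollifier ψ ε (x - z) = ∫ y, ψ y * q (x + ε • y) := by
  have h1 := Measure.integral_comp_smul (volume : Measure (EuclideanSpace ℝ (Fin d)))
    (fun w ↦ ψ (ε⁻¹ • w) * q (x + w)) ε
  simp only [inv_smul_smul₀ hε.ne', finrank_euclideanSpace_fin, smul_eq_mul] at h1
  rw [h1, ← integral_sub_right_eq_self (fun w ↦ ψ (ε⁻¹ • w) * q (x + w)) x, abs_of_pos (by positivity), ← integral_const_mul]
  refine integral_congr_ae (Filter.Eventually.of_forall fun z ↦ ?_)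
  simp only [mollifier, add_sub_cancel]
  rw [← smul_neg, neg_sub]
  ring

lemma integral_mollifier (hψ : ∫ x, ψ x = 1) (hε : 0 < ε) (x : EuclideanSpace ℝ (Fin d)) :
    ∫ z, mollifier ψ ε (x - z) = 1 := by
  have := integral_mul_mollifier (ψ := ψ) hε (fun _ ↦ 1) x
  simpa [hψ] using this

lemma integral_mollifier' (hψ : ∫ x, ψ x = 1) (hε : 0 < ε) (z : EuclideanSpace ℝ (Fin d)) :
    ∫ x, mollifier ψ ε (x - z) = 1 := by
  rw [integral_sub_right_eq_self (fun x ↦ mollifier ψ ε x), ← integral_mollifier hψ hε 0,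
    integral_sub_left_eq_self (fun x ↦ mollifier ψ ε x)]

end Mollifier

/-- Jensen's inequality for the square of an average. -/
lemma sq_integral_mul_le {X : Type*} [MeasurableSpace X] {ν : Measure X} {ρ h : X → ℝ}
    (hρ : ∀ x, 0 ≤ ρ x) (hi : Integrable ρ ν) (h1 : ∫ x, ρ x ∂ν = 1)
    (i1 : Integrable (fun x ↦ ρ x * h x) ν) (i2 : Integrable (fun x ↦ ρ x * h x ^ 2) ν) :
    (∫ x, ρ x * h x ∂ν) ^ 2 ≤ ∫ x, ρ x * h x ^ 2 ∂ν := by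
  set m := ∫ x, ρ x * h x ∂ν with hm
  have h0 : 0 ≤ ∫ x, (ρ x * h x ^ 2 - 2 * m * (ρ x * h x) + m ^ 2 * ρ x) ∂ν :=
    integral_nonneg fun x ↦ by
      have : ρ x * h x ^ 2 - 2 * m * (ρ x * h x) + m ^ 2 * ρ x = ρ x * (h x - m) ^ 2 := by ring
      rw [Pi.zero_apply, this]
      exact mul_nonneg (hρ x) (sq_nonneg _)
  have i3 : Integrable (fun x ↦ 2 * m * (ρ x * h x)) ν := i1.const_mul _
  have i4 : Integrable (fun x ↦ m ^ 2 * ρ x) ν := hi.const_mul _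
  have i5 : Integrable (fun x ↦ ρ x * h x ^ 2 - 2 * m * (ρ x * h x)) ν := i2.sub i3
  rw [integral_add i5 i4, integral_sub i2 i3, integral_const_mul, integral_const_mul, h1,
    ← hm] at h0
  nlinarith

/-- The derivative of a composition with a Lipschitz map. -/
lemma norm_fderiv_comp_lipschitz_le {h : EuclideanSpace ℝ (Fin d) → ℝ}
    {R : EuclideanSpace ℝ (Fin d) → EuclideanSpace ℝ (Fin d)} {Λ : ℝ≥0} (hR : LipschitzWith Λ R)
    {x : EuclideanSpace ℝ (Fin d)} (hh : DifferentiableAt ℝ h (R x)) :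
    ‖fderiv ℝ (h ∘ R) x‖ ≤ Λ * ‖fderiv ℝ h (R x)‖ := by
  refine le_of_forall_pos_le_add fun η hη ↦ ?_
  set η' : ℝ := η / (Λ + 1) with hη'
  have hη'0 : 0 < η' := by positivity
  have h1 : ∀ᶠ w in nhds (R x), ‖h w - h (R x)‖ ≤ (‖fderiv ℝ h (R x)‖ + η') * ‖w - R x‖ := by
    have := (hasFDerivAt_iff_isLittleO.1 hh.hasFDerivAt).def hη'0
    filter_upwards [this] with w hw
    calc ‖h w - h (R x)‖ = ‖(h w - h (R x) - fderiv ℝ h (R x) (w - R x)) +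
          fderiv ℝ h (R x) (w - R x)‖ := by rw [sub_add_cancel]
      _ ≤ η' * ‖w - R x‖ + ‖fderiv ℝ h (R x)‖ * ‖w - R x‖ :=
          (norm_add_le _ _).trans (add_le_add hw (ContinuousLinearMap.le_opNorm _ _))
      _ = _ := by ring
  have h2 := (hR.continuous.tendsto x).eventually h1
  -- `R` need not be differentiable: a Lipschitz estimate centred at x is enough, and `fderiv` is 0
  -- where the composition has no derivative.
  refine (norm_fderiv_le_of_lip' ℝ (C := (‖fderiv ℝ h (R x)‖ + η') * Λ) (by positivity) ?_).trans ?_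
  · filter_upwards [h2] with y hy
    refine hy.trans ?_
    rw [mul_assoc]
    gcongr
    exact hR.norm_sub_le y x
  · have : η' * Λ ≤ η := by
      rw [hη', div_mul_eq_mul_div, div_le_iff₀ (by positivity)]
      nlinarith [NNReal.coe_nonneg Λ]
    nlinarith

/-! ### Charts, cut off functions and their smoothings -/

/-- A piece of `K`, cut out by `χ`, which is straightened by the closed set `K'`: `R` is a Lipschitz
retraction onto `K'`, and `ψ` is a mollifier pointing into `K'`. -/
structure IsChart (K K' : Set (EuclideanSpace ℝ (Fin d)))
    (R : EuclideanSpace ℝ (Fin d) → EuclideanSpace ℝ (Fin d))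
    (ψ χ : EuclideanSpace ℝ (Fin d) → ℝ) (Λ C : ℝ≥0) : Prop where
  contDiff_mol : ContDiff ℝ ∞ ψ
  compact_mol : HasCompactSupport ψ
  mol_nonneg : ∀ x, 0 ≤ ψ x
  integral_mol : ∫ x, ψ x = 1
  contDiff_cutoff : ContDiff ℝ ∞ χ
  compact_cutoff : HasCompactSupport χ
  measurableSet : MeasurableSet K'
  mapsTo : ∀ x, R x ∈ K'
  eq_self : ∀ x ∈ K', R x = x
  lipschitz : LipschitzWith Λ R
  bounded : ∀ s, Bornology.IsBounded s → Bornology.IsBounded (R ⁻¹' s)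
  lintegral_le : ∀ g : EuclideanSpace ℝ (Fin d) → ℝ≥0∞, Measurable g →
    ∫⁻ x, g (R x) ≤ C * ∫⁻ x in K', g x
  -- Averages taken at points of `K'` meet the support of `χ` only inside of `K`, where the weak
  -- gradient is available.
  inward : ∀ x ∈ K', ∀ ε ∈ Ioc (0 : ℝ) 1, ∀ y ∈ tsupport ψ, x + ε • y ∈ tsupport χ →
    x + ε • y ∈ interior K
  -- The points of `K` that the chart does not describe are invisible to `χ`, both before and after
  -- applying `R`.
  off : ∀ x ∈ K, x ∉ K' → χ x = 0 ∧ R x ∉ tsupport χ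

/-- The cut off function `χ f`, extended by zero outside of the interior of `K`. -/
def cutFun (K : Set (EuclideanSpace ℝ (Fin d))) (χ f : EuclideanSpace ℝ (Fin d) → ℝ) :
    EuclideanSpace ℝ (Fin d) → ℝ :=
  (interior K).indicator fun z ↦ f z * χ z

/-- The gradient of `χ f`, extended by zero outside of the interior of `K`. -/
def cutGrad (K : Set (EuclideanSpace ℝ (Fin d))) (χ f : EuclideanSpace ℝ (Fin d) → ℝ)
    (G : EuclideanSpace ℝ (Fin d) → EuclideanSpace ℝ (Fin d)) :
    EuclideanSpace ℝ (Fin d) → EuclideanSpace ℝ (Fin d) :=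
  (interior K).indicator fun z ↦ χ z • G z + f z • gradient χ z

section Cut

variable {K : Set (EuclideanSpace ℝ (Fin d))} {χ f : EuclideanSpace ℝ (Fin d) → ℝ}
  {G : EuclideanSpace ℝ (Fin d) → EuclideanSpace ℝ (Fin d)}

lemma continuous_gradient (hχ : ContDiff ℝ ∞ χ) : Continuous (gradient χ) := by
  unfold gradient
  exact (LinearIsometryEquiv.continuous _).comp (hχ.continuous_fderiv (by simp))

lemma norm_gradient (g : EuclideanSpace ℝ (Fin d) → ℝ) (x : EuclideanSpace ℝ (Fin d)) :
    ‖gradient g x‖ = ‖fderiv ℝ g x‖ := by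
  unfold gradient
  rw [LinearIsometryEquiv.norm_map]

lemma inner_gradient (g : EuclideanSpace ℝ (Fin d) → ℝ) (x v : EuclideanSpace ℝ (Fin d)) :
    inner ℝ (gradient g x) v = fderiv ℝ g x v := by
  rw [gradient, InnerProductSpace.toDual_symm_apply]

lemma exists_cutoff_bound (hχ : ContDiff ℝ ∞ χ) (hχc : HasCompactSupport χ) :
    ∃ B : ℝ, 0 ≤ B ∧ ∀ x, |χ x| ≤ B ∧ ‖gradient χ x‖ ≤ B := by
  obtain ⟨B1, h1⟩ := hχ.continuous.bounded_above_of_compact_support hχc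
  obtain ⟨B2, h2⟩ := (hχ.continuous_fderiv (by simp)).bounded_above_of_compact_support
    (hχc.fderiv ℝ)
  refine ⟨max B1 B2, ((norm_nonneg _).trans (h1 0)).trans (le_max_left _ _), fun x ↦ ⟨?_, ?_⟩⟩
  · exact (h1 x).trans (le_max_left _ _)
  · rw [norm_gradient]
    exact (h2 x).trans (le_max_right _ _)

lemma memLp_cut (h : IsH1 (interior K) f G) (hχ : ContDiff ℝ ∞ χ) (hχc : HasCompactSupport χ) :
    MemLp (cutFun K χ f) 2 ∧ MemLp (cutGrad K χ f G) 2 := by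
  obtain ⟨B, hB, hb⟩ := exists_cutoff_bound hχ hχc
  have hm : MeasurableSet (interior K) := isOpen_interior.measurableSet
  have m1 : MemLp (fun z ↦ f z * χ z) 2 (volume.restrict (interior K)) := by
    refine h.memLp.of_le_mul (c := B) (h.memLp.1.mul hχ.continuous.aestronglyMeasurable)
      (Filter.Eventually.of_forall fun z ↦ ?_)
    rw [norm_mul, mul_comm]
    exact mul_le_mul_of_nonneg_right (hb z).1 (norm_nonneg _)
  have m2 : MemLp (fun z ↦ χ z • G z) 2 (volume.restrict (interior K)) := by
    refine h.memLp_grad.of_le_mul (c := B)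
      (hχ.continuous.aestronglyMeasurable.smul h.memLp_grad.1)
      (Filter.Eventually.of_forall fun z ↦ ?_)
    rw [norm_smul]
    exact mul_le_mul_of_nonneg_right (hb z).1 (norm_nonneg _)
  have m3 : MemLp (fun z ↦ f z • gradient χ z) 2 (volume.restrict (interior K)) := by
    refine h.memLp.of_le_mul (c := B)
      (h.memLp.1.smul (continuous_gradient hχ).aestronglyMeasurable)
      (Filter.Eventually.of_forall fun z ↦ ?_)
    rw [norm_smul, mul_comm]
    exact mul_le_mul_of_nonneg_right (hb z).2 (norm_nonneg _)
  exact ⟨(memLp_indicator_iff_restrict hm).2 m1, (memLp_indicator_iff_restrict hm).2 (m2.add m3)⟩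

lemma integrable_cut (hK : IsCompact K) (h : IsH1 (interior K) f G) (hχ : ContDiff ℝ ∞ χ)
    (hχc : HasCompactSupport χ) :
    Integrable (cutFun K χ f) ∧ Integrable (cutGrad K χ f G) := by
  obtain ⟨m1, m2⟩ := memLp_cut h hχ hχc
  have hm : MeasurableSet (interior K) := isOpen_interior.measurableSet
  have : IsFiniteMeasure (volume.restrict (interior K)) :=
    ⟨by rw [Measure.restrict_apply_univ]
        exact (measure_mono interior_subset).trans_lt hK.measure_lt_top⟩
  rw [cutFun, memLp_indicator_iff_restrict hm] at m1
  rw [cutGrad, memLp_indicator_iff_restrict hm] at m2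
  exact ⟨(integrable_indicator_iff hm).2 (m1.integrable (by norm_num)),
    (integrable_indicator_iff hm).2 (m2.integrable (by norm_num))⟩

lemma integral_norm_sq_cutGrad_le (h : IsH1 (interior K) f G) {B : ℝ}
    (hb : ∀ x, |χ x| ≤ B ∧ ‖gradient χ x‖ ≤ B) :
    ∫ z, ‖cutGrad K χ f G z‖ ^ 2 ≤ 2 * B ^ 2 * h1Norm (interior K) f G ^ 2 := by
  have hm : MeasurableSet (interior K) := isOpen_interior.measurableSet
  have i1 : Integrable (fun x ↦ f x ^ 2) (volume.restrict (interior K)) := by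
    simpa using (memLp_two_iff_integrable_sq_norm h.memLp.1).1 h.memLp
  have i2 := (memLp_two_iff_integrable_sq_norm h.memLp_grad.1).1 h.memLp_grad
  have e : ∀ z, ‖cutGrad K χ f G z‖ ^ 2 =
      (interior K).indicator (fun z ↦ ‖χ z • G z + f z • gradient χ z‖ ^ 2) z := by
    intro z
    by_cases hz : z ∈ interior K <;> simp [cutGrad, hz]
  simp_rw [e]
  rw [integral_indicator hm, h1Norm, Real.sq_sqrt (add_nonneg
    (integral_nonneg fun _ ↦ sq_nonneg _) (integral_nonneg fun _ ↦ sq_nonneg _)),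
    ← integral_add i1 i2, ← integral_const_mul]
  refine integral_mono_of_nonneg (Filter.Eventually.of_forall fun _ ↦ sq_nonneg _)
    ((i1.add i2).const_mul _) (Filter.Eventually.of_forall fun z ↦ ?_)
  have hB : 0 ≤ B := (abs_nonneg _).trans (hb z).1
  have h1 : ‖χ z • G z + f z • gradient χ z‖ ≤ B * (‖G z‖ + |f z|) := by
    refine (norm_add_le _ _).trans ?_
    rw [norm_smul, norm_smul, mul_add]
    refine add_le_add (mul_le_mul_of_nonneg_right (hb z).1 (norm_nonneg _)) ?_
    rw [mul_comm B]
    exact mul_le_mul_of_nonneg_left (hb z).2 (norm_nonneg _)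
  calc ‖χ z • G z + f z • gradient χ z‖ ^ 2 ≤ (B * (‖G z‖ + |f z|)) ^ 2 := by gcongr
    _ ≤ 2 * B ^ 2 * (f z ^ 2 + ‖G z‖ ^ 2) := by
      rw [← sq_abs (f z)]
      have := mul_nonneg (sq_nonneg B) (sq_nonneg (‖G z‖ - |f z|))
      nlinarith

end Cut

/-- The convolution of `q` and `ρ`. -/
def smoothing (q ρ : EuclideanSpace ℝ (Fin d) → ℝ) (x : EuclideanSpace ℝ (Fin d)) : ℝ :=
  ∫ z, q z * ρ (x - z)

section Smoothing

variable {q ρ : EuclideanSpace ℝ (Fin d) → ℝ}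

lemma smoothing_eq_convolution (q ρ : EuclideanSpace ℝ (Fin d) → ℝ) :
    smoothing q ρ = convolution q ρ (ContinuousLinearMap.mul ℝ ℝ) volume := rfl

lemma contDiff_smoothing (hq : Integrable q) (hρ : ContDiff ℝ ∞ ρ) (hρc : HasCompactSupport ρ) :
    ContDiff ℝ ∞ (smoothing q ρ) := by
  rw [smoothing_eq_convolution]
  exact hρc.contDiff_convolution_right _ hq.locallyIntegrable hρ

lemma hasCompactSupport_smoothing (hq : HasCompactSupport q) (hρc : HasCompactSupport ρ) :
    HasCompactSupport (smoothing q ρ) := by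
  rw [smoothing_eq_convolution]
  exact hq.convolution _ hρc

lemma fderiv_smoothing (hq : Integrable q) (hρ : ContDiff ℝ ∞ ρ) (hρc : HasCompactSupport ρ)
    (x v : EuclideanSpace ℝ (Fin d)) :
    fderiv ℝ (smoothing q ρ) x v = ∫ z, q z * fderiv ℝ ρ (x - z) v := by
  rw [smoothing_eq_convolution, (hρc.hasFDerivAt_convolution_right _ hq.locallyIntegrable
    (hρ.of_le (by simp)) x).fderiv, convolution_precompR_apply _ hq.locallyIntegrable
    (hρc.fderiv ℝ) (hρ.continuous_fderiv (by simp))]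
  rfl

end Smoothing

section Cut

variable {K : Set (EuclideanSpace ℝ (Fin d))} {χ ρ f : EuclideanSpace ℝ (Fin d) → ℝ}
  {G : EuclideanSpace ℝ (Fin d) → EuclideanSpace ℝ (Fin d)}

lemma integrable_mul_of_hasCompactSupport {ν : Measure (EuclideanSpace ℝ (Fin d))}
    {q ρ : EuclideanSpace ℝ (Fin d) → ℝ} (hq : Integrable q ν) (hρ : Continuous ρ)
    (hρc : HasCompactSupport ρ) : Integrable (fun z ↦ q z * ρ z) ν := by
  obtain ⟨M, hM⟩ := hρ.bounded_above_of_compact_support hρc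
  exact hq.mul_bdd hρ.aestronglyMeasurable (Filter.Eventually.of_forall hM)

lemma hasCompactSupport_sub_left {F : Type*} [Zero F] {ρ : EuclideanSpace ℝ (Fin d) → F}
    (hρ : HasCompactSupport ρ) (x : EuclideanSpace ℝ (Fin d)) :
    HasCompactSupport fun z ↦ ρ (x - z) :=
  hρ.comp_homeomorph (Homeomorph.subLeft x)

/-- Where `ρ (x - ·)` only sees the support of `χ` inside of `K`, the derivative of the
smoothing of `χ f` is the average of the cut off weak gradient. -/
lemma fderiv_smoothing_cutFun (hK : IsCompact K) (h : IsH1 (interior K) f G)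
    (hχ : ContDiff ℝ ∞ χ) (hχc : HasCompactSupport χ) (hρ : ContDiff ℝ ∞ ρ)
    (hρc : HasCompactSupport ρ) {x : EuclideanSpace ℝ (Fin d)}
    (hx : ∀ z ∈ tsupport χ, x - z ∈ tsupport ρ → z ∈ interior K)
    (v : EuclideanSpace ℝ (Fin d)) :
    fderiv ℝ (smoothing (cutFun K χ f) ρ) x v =
      ∫ z, inner ℝ (cutGrad K χ f G z) v * ρ (x - z) := by
  have hm : MeasurableSet (interior K) := isOpen_interior.measurableSet
  have : IsFiniteMeasure (volume.restrict (interior K)) :=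
    ⟨by rw [Measure.restrict_apply_univ]
        exact (measure_mono interior_subset).trans_lt hK.measure_lt_top⟩
  have if_ : Integrable f (volume.restrict (interior K)) := h.memLp.integrable (by norm_num)
  have iG : Integrable G (volume.restrict (interior K)) := h.memLp_grad.integrable (by norm_num)
  have cρ : Continuous fun z ↦ ρ (x - z) := hρ.continuous.comp (by fun_prop)
  have cρ' : Continuous fun z ↦ fderiv ℝ ρ (x - z) v :=
    ((hρ.continuous_fderiv (by simp)).comp (by fun_prop)).clm_apply continuous_const
  have cχ' : Continuous fun z ↦ fderiv ℝ χ z v :=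
    (hχ.continuous_fderiv (by simp)).clm_apply continuous_const
  rw [fderiv_smoothing (integrable_cut hK h hχ hχc).1 hρ hρc]
  -- This is an admissible test function for the weak gradient: by `hx` its support lies in the
  -- interior of `K`.
  set φ : EuclideanSpace ℝ (Fin d) → ℝ := fun z ↦ χ z * ρ (x - z) with hφ
  have e1 : ∀ z, fderiv ℝ φ z v = fderiv ℝ χ z v * ρ (x - z) - χ z * fderiv ℝ ρ (x - z) v := by
    intro z
    have a1 := (hχ.differentiable (by simp) z).hasFDerivAt
    have a2 := ((hρ.differentiable (by simp) (x - z)).hasFDerivAt).comp z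
      ((hasFDerivAt_id z).const_sub x)
    have a3 : HasFDerivAt φ _ z := a1.mul a2
    rw [a3.fderiv]
    simp
    ring
  have hsupp : tsupport φ ⊆ interior K := by
    intro z hz
    refine hx z (tsupport_mul_subset_left hz) ?_
    exact tsupport_comp_subset_preimage ρ (f := fun z ↦ x - z) (by fun_prop)
      (tsupport_mul_subset_right hz)
  have key := h.weakGradient φ (hχ.mul (hρ.comp (by fun_prop))) (hχc.mul_right) hsupp v
  have i1 : Integrable (fun z ↦ f z * (fderiv ℝ χ z v * ρ (x - z)))
      (volume.restrict (interior K)) :=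
    integrable_mul_of_hasCompactSupport if_ (cχ'.mul cρ) (hasCompactSupport_sub_left hρc x).mul_left
  have i2 : Integrable (fun z ↦ f z * (χ z * fderiv ℝ ρ (x - z) v))
      (volume.restrict (interior K)) :=
    integrable_mul_of_hasCompactSupport if_ (hχ.continuous.mul cρ') hχc.mul_right
  have i3 : Integrable (fun z ↦ inner ℝ (G z) v * φ z) (volume.restrict (interior K)) :=
    integrable_mul_of_hasCompactSupport (iG.inner_const v) (hχ.continuous.mul cρ) hχc.mul_right
  simp_rw [e1, mul_sub] at key
  rw [integral_sub i1 i2] at key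
  have e2 : ∫ z, cutFun K χ f z * fderiv ℝ ρ (x - z) v =
      ∫ z in interior K, f z * (χ z * fderiv ℝ ρ (x - z) v) := by
    rw [← integral_indicator hm]
    congr 1
    ext z
    by_cases hz : z ∈ interior K <;> simp [cutFun, hz, mul_assoc]
  have e3 : ∫ z, inner ℝ (cutGrad K χ f G z) v * ρ (x - z) =
      ∫ z in interior K, (inner ℝ (G z) v * φ z + f z * (fderiv ℝ χ z v * ρ (x - z))) := by
    rw [← integral_indicator hm]
    congr 1
    ext z
    by_cases hz : z ∈ interior K
    · simp only [cutGrad, indicator_of_mem hz, hφ, inner_add_left, real_inner_smul_left,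
        inner_gradient]
      ring
    · simp [cutGrad, hz]
  rw [e2, e3, integral_add i3 i1]
  linarith

/-- The derivative is an average of the cut off gradient with respect to the probability density ρ(x
- ·), so Jensen's inequality applies. -/
lemma sq_norm_fderiv_smoothing_cutFun_le (hK : IsCompact K) (h : IsH1 (interior K) f G)
    (hχ : ContDiff ℝ ∞ χ) (hχc : HasCompactSupport χ) (hρ : ContDiff ℝ ∞ ρ)
    (hρc : HasCompactSupport ρ) (hρ0 : ∀ z, 0 ≤ ρ z) {x : EuclideanSpace ℝ (Fin d)}
    (hρ1 : ∫ z, ρ (x - z) = 1)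
    (hx : ∀ z ∈ tsupport χ, x - z ∈ tsupport ρ → z ∈ interior K) :
    ‖fderiv ℝ (smoothing (cutFun K χ f) ρ) x‖ ^ 2 ≤
      ∫ z, ρ (x - z) * ‖cutGrad K χ f G z‖ ^ 2 := by
  have iW := (integrable_cut hK h hχ hχc).2
  have iW2 := (memLp_two_iff_integrable_sq_norm iW.1).1 (memLp_cut h hχ hχc).2
  have cρ : Continuous fun z ↦ ρ (x - z) := hρ.continuous.comp (by fun_prop)
  have sρ := hasCompactSupport_sub_left hρc x
  have i1 : Integrable (fun z ↦ ρ (x - z) * ‖cutGrad K χ f G z‖) := by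
    simpa only [mul_comm] using integrable_mul_of_hasCompactSupport iW.norm cρ sρ
  have i2 : Integrable (fun z ↦ ρ (x - z) * ‖cutGrad K χ f G z‖ ^ 2) := by
    simpa only [mul_comm] using integrable_mul_of_hasCompactSupport iW2 cρ sρ
  have hn : 0 ≤ ∫ z, ρ (x - z) * ‖cutGrad K χ f G z‖ :=
    integral_nonneg fun z ↦ mul_nonneg (hρ0 _) (norm_nonneg _)
  have h1 : ‖fderiv ℝ (smoothing (cutFun K χ f) ρ) x‖ ≤ ∫ z, ρ (x - z) * ‖cutGrad K χ f G z‖ := by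
    refine ContinuousLinearMap.opNorm_le_bound _ hn fun v ↦ ?_
    rw [fderiv_smoothing_cutFun hK h hχ hχc hρ hρc hx, ← integral_mul_const]
    refine norm_integral_le_of_norm_le (i1.mul_const _) (Filter.Eventually.of_forall fun z ↦ ?_)
    rw [norm_mul, Real.norm_of_nonneg (hρ0 _), mul_comm, mul_assoc]
    exact mul_le_mul_of_nonneg_left (norm_inner_le_norm _ _) (hρ0 _)
  exact (pow_le_pow_left₀ (norm_nonneg _) h1 2).trans (sq_integral_mul_le (fun z ↦ hρ0 _)
    (cρ.integrable_of_hasCompactSupport sρ) hρ1 i1 i2)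

/-- Averaging does not increase integrals. -/
lemma lintegral_average_le {W : EuclideanSpace ℝ (Fin d) → ℝ} (hW : Integrable W)
    (hW0 : ∀ z, 0 ≤ W z) (hρ : Continuous ρ) (hρc : HasCompactSupport ρ) (hρ0 : ∀ z, 0 ≤ ρ z)
    (hρ1 : ∀ z, ∫ x, ρ (x - z) = 1) :
    ∫⁻ x, ENNReal.ofReal (∫ z, ρ (x - z) * W z) ≤ ∫⁻ z, ENNReal.ofReal (W z) := by
  have h1 : ∀ x, ENNReal.ofReal (∫ z, ρ (x - z) * W z) =
      ∫⁻ z, ENNReal.ofReal (ρ (x - z)) * ENNReal.ofReal (W z) := by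
    intro x
    rw [ofReal_integral_eq_lintegral_ofReal]
    · simp_rw [ENNReal.ofReal_mul (hρ0 _)]
    · have := integrable_mul_of_hasCompactSupport hW (hρ.comp (by fun_prop : Continuous (x - ·)))
        (hasCompactSupport_sub_left hρc x)
      simp_rw [mul_comm (ρ _)]
      exact this
    · exact Filter.Eventually.of_forall fun z ↦ mul_nonneg (hρ0 _) (hW0 _)
  simp_rw [h1]
  rw [lintegral_lintegral_swap]
  · refine lintegral_mono fun z ↦ ?_
    rw [lintegral_mul_const _ (by fun_prop), ← ofReal_integral_eq_lintegral_ofReal, hρ1 z]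
    · simp
    · exact (hρ.integrable_of_hasCompactSupport hρc).comp_sub_right z
    · exact Filter.Eventually.of_forall fun z ↦ hρ0 _
  · refine AEMeasurable.mul ?_ hW.1.aemeasurable.ennreal_ofReal.comp_snd
    exact ((hρ.comp (by fun_prop)).measurable.ennreal_ofReal).aemeasurable

end Cut

/-! ### Extension of a localised function to the whole space -/

section Chart

variable {K K' : Set (EuclideanSpace ℝ (Fin d))} {χ ψ f : EuclideanSpace ℝ (Fin d) → ℝ}
  {R G : EuclideanSpace ℝ (Fin d) → EuclideanSpace ℝ (Fin d)} {Λ C : ℝ≥0}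

/-- The extension to the whole space of a smoothing of `χ f`. -/
def chartExt (K : Set (EuclideanSpace ℝ (Fin d)))
    (R : EuclideanSpace ℝ (Fin d) → EuclideanSpace ℝ (Fin d))
    (ψ χ f : EuclideanSpace ℝ (Fin d) → ℝ) (ε : ℝ) : EuclideanSpace ℝ (Fin d) → ℝ :=
  smoothing (cutFun K χ f) (mollifier ψ ε) ∘ R

lemma hasCompactSupport_cutFun (hχc : HasCompactSupport χ) : HasCompactSupport (cutFun K χ f) := by
  refine hχc.mono fun z hz ↦ ?_
  by_contra h0
  rw [Function.notMem_support] at h0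
  refine hz ?_
  by_cases hi : z ∈ interior K <;> simp [cutFun, hi, h0]

namespace IsChart

lemma contDiff_smoothing (hc : IsChart K K' R ψ χ Λ C) (hK : IsCompact K)
    (h : IsH1 (interior K) f G) {ε : ℝ} (hε : 0 < ε) :
    ContDiff ℝ ∞ (smoothing (cutFun K χ f) (mollifier ψ ε)) :=
  Coulomb.contDiff_smoothing (integrable_cut hK h hc.contDiff_cutoff hc.compact_cutoff).1
    (contDiff_mollifier hc.contDiff_mol) (hasCompactSupport_mollifier hc.compact_mol hε)

/-- Composition with `R` keeps supports bounded, since preimages of bounded sets under `R` are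
bounded. -/
lemma hasCompactSupport_chartExt (hc : IsChart K K' R ψ χ Λ C) {ε : ℝ} (hε : 0 < ε) :
    HasCompactSupport (chartExt K R ψ χ f ε) := by
  have h1 := hasCompactSupport_smoothing (hasCompactSupport_cutFun (K := K) (f := f)
    hc.compact_cutoff) (hasCompactSupport_mollifier hc.compact_mol hε)
  obtain ⟨S, hS⟩ := (hc.bounded _ h1.isBounded).subset_closedBall 0
  refine HasCompactSupport.intro (isCompact_closedBall 0 S) fun x hx ↦ ?_
  by_contra hne
  exact hx (hS (subset_tsupport _ hne))

lemma exists_lipschitzWith_chartExt (hc : IsChart K K' R ψ χ Λ C) (hK : IsCompact K)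
    (h : IsH1 (interior K) f G) {ε : ℝ} (hε : 0 < ε) :
    ∃ M, LipschitzWith M (chartExt K R ψ χ f ε) := by
  obtain ⟨M, hM⟩ := (hc.contDiff_smoothing hK h hε).lipschitzWith_of_hasCompactSupport
    (hasCompactSupport_smoothing (hasCompactSupport_cutFun (K := K) (f := f)
    hc.compact_cutoff) (hasCompactSupport_mollifier hc.compact_mol hε)) (by simp)
  exact ⟨_, hM.comp hc.lipschitz⟩

/-- The Dirichlet integral of the extension is controlled by that of `χ f`. -/
lemma integral_sq_norm_gradient_le (hc : IsChart K K' R ψ χ Λ C) (hK : IsCompact K)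
    (h : IsH1 (interior K) f G) {ε : ℝ} (hε : ε ∈ Ioc (0 : ℝ) 1) :
    ∫ x, ‖gradient (chartExt K R ψ χ f ε) x‖ ^ 2 ≤
      Λ ^ 2 * C * ∫ z, ‖cutGrad K χ f G z‖ ^ 2 := by
  set H := smoothing (cutFun K χ f) (mollifier ψ ε) with hH
  have sH := hc.contDiff_smoothing hK h hε.1
  have cm := contDiff_mollifier (ε := ε) hc.contDiff_mol
  have cc := hasCompactSupport_mollifier hc.compact_mol hε.1
  have c0 := mollifier_nonneg hc.mol_nonneg hε.1
  have iW := (integrable_cut hK h hc.contDiff_cutoff hc.compact_cutoff).2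
  have iW2 := (memLp_two_iff_integrable_sq_norm iW.1).1
    (memLp_cut h hc.contDiff_cutoff hc.compact_cutoff).2
  have mH : Measurable fun x ↦ ENNReal.ofReal (‖fderiv ℝ H x‖ ^ 2) :=
    ((sH.continuous_fderiv (by simp)).norm.pow 2).measurable.ennreal_ofReal
  -- Only points of `K'` are needed: `lintegral_le` bounds integrals of functions of `R x` over the
  -- whole space by integrals over `K'`.
  have h1 : ∀ x ∈ K', ‖fderiv ℝ H x‖ ^ 2 ≤
      ∫ z, mollifier ψ ε (x - z) * ‖cutGrad K χ f G z‖ ^ 2 := by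
    intro x hx
    refine sq_norm_fderiv_smoothing_cutFun_le hK h hc.contDiff_cutoff hc.compact_cutoff cm cc c0
      (integral_mollifier hc.integral_mol hε.1 x) fun z hz hxz ↦ ?_
    have := hc.inward x hx ε hε _ (tsupport_mollifier hxz)
    rw [smul_neg, smul_inv_smul₀ hε.1.ne', neg_sub, add_sub_cancel] at this
    exact this hz
  have h2 : ∫⁻ x in K', ENNReal.ofReal (‖fderiv ℝ H x‖ ^ 2) ≤
      ENNReal.ofReal (∫ z, ‖cutGrad K χ f G z‖ ^ 2) := by
    calc ∫⁻ x in K', ENNReal.ofReal (‖fderiv ℝ H x‖ ^ 2)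
        ≤ ∫⁻ x in K', ENNReal.ofReal (∫ z, mollifier ψ ε (x - z) * ‖cutGrad K χ f G z‖ ^ 2) :=
          setLIntegral_mono' hc.measurableSet fun x hx ↦ ENNReal.ofReal_le_ofReal (h1 x hx)
      _ ≤ ∫⁻ x, ENNReal.ofReal (∫ z, mollifier ψ ε (x - z) * ‖cutGrad K χ f G z‖ ^ 2) :=
          setLIntegral_le_lintegral _ _
      _ ≤ ∫⁻ z, ENNReal.ofReal (‖cutGrad K χ f G z‖ ^ 2) :=
          lintegral_average_le iW2 (fun _ ↦ sq_nonneg _) cm.continuous cc c0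
            (integral_mollifier' hc.integral_mol hε.1)
      _ = _ := (ofReal_integral_eq_lintegral_ofReal iW2
          (Filter.Eventually.of_forall fun _ ↦ sq_nonneg _)).symm
  have h3 : ∀ x, ‖gradient (chartExt K R ψ χ f ε) x‖ ^ 2 ≤ Λ ^ 2 * ‖fderiv ℝ H (R x)‖ ^ 2 := by
    intro x
    rw [norm_gradient, ← mul_pow]
    exact pow_le_pow_left₀ (norm_nonneg _)
      (norm_fderiv_comp_lipschitz_le hc.lipschitz (sH.differentiable (by simp) _)) 2
  have h4 : ∫⁻ x, ENNReal.ofReal (‖gradient (chartExt K R ψ χ f ε) x‖ ^ 2) ≤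
      ENNReal.ofReal (Λ ^ 2 * C * ∫ z, ‖cutGrad K χ f G z‖ ^ 2) := by
    calc ∫⁻ x, ENNReal.ofReal (‖gradient (chartExt K R ψ χ f ε) x‖ ^ 2)
        ≤ ∫⁻ x, ENNReal.ofReal (Λ ^ 2) * ENNReal.ofReal (‖fderiv ℝ H (R x)‖ ^ 2) := by
          refine lintegral_mono fun x ↦ ?_
          rw [← ENNReal.ofReal_mul (by positivity)]
          exact ENNReal.ofReal_le_ofReal (h3 x)
      _ = ENNReal.ofReal (Λ ^ 2) * ∫⁻ x, ENNReal.ofReal (‖fderiv ℝ H (R x)‖ ^ 2) :=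
          lintegral_const_mul _ (mH.comp hc.lipschitz.continuous.measurable)
      _ ≤ ENNReal.ofReal (Λ ^ 2) * (C * ENNReal.ofReal (∫ z, ‖cutGrad K χ f G z‖ ^ 2)) := by
          gcongr
          exact (hc.lintegral_le _ mH).trans (by gcongr)
      _ = _ := by
          rw [mul_assoc, ENNReal.ofReal_mul (by positivity), ENNReal.ofReal_mul (by positivity),
            ENNReal.ofReal_coe_nnreal]
  rw [integral_eq_lintegral_of_nonneg_ae (Filter.Eventually.of_forall fun _ ↦ sq_nonneg _)]
  · refine ENNReal.toReal_le_of_le_ofReal ?_ h4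
    have : 0 ≤ ∫ z, ‖cutGrad K χ f G z‖ ^ 2 := integral_nonneg fun _ ↦ sq_nonneg _
    positivity
  · obtain ⟨M, hM⟩ := hc.exists_lipschitzWith_chartExt hK h hε.1
    exact (memLp_gradient hM (hc.hasCompactSupport_chartExt hε.1) 2).1.norm.pow 2

/-- The smoothed extension is bounded by `√E`. -/
lemma abs_sint_chartExt_le (hc : IsChart K K' R ψ χ Λ C) (hK : IsCompact K) (hd : 0 < d)
    (h : IsH1 (interior K) f G) {ε : ℝ} (hε : ε ∈ Ioc (0 : ℝ) 1)
    {α β : Measure (EuclideanSpace ℝ (Fin d))} [IsFiniteMeasure α] [IsFiniteMeasure β] {E : ℝ}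
    (hE : ∀ a b : ℝ, 0 < a → a ≤ b → ∫ t in Ioc a b, sform α β (heat t) ≤ E) :
    |sint α β (chartExt K R ψ χ f ε)| ≤
      √(Λ ^ 2 * C * ∫ z, ‖cutGrad K χ f G z‖ ^ 2) * √E := by
  obtain ⟨M, hM⟩ := hc.exists_lipschitzWith_chartExt hK h hε.1
  have hs := hc.hasCompactSupport_chartExt (f := f) hε.1
  refine (abs_sint_le hd (heatIBP_gradient hM hs) hM.continuous hs
    (memLp_one_iff_integrable.1 (memLp_gradient hM hs 1)) (memLp_gradient hM hs 2) hE).trans ?_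
  gcongr
  exact hc.integral_sq_norm_gradient_le hK h hε

end IsChart

end Chart

section Chart

variable {K K' : Set (EuclideanSpace ℝ (Fin d))} {χ ψ f : EuclideanSpace ℝ (Fin d) → ℝ}
  {R G : EuclideanSpace ℝ (Fin d) → EuclideanSpace ℝ (Fin d)} {Λ C : ℝ≥0}

lemma chartExt_apply {ε : ℝ} (hε : 0 < ε) (x : EuclideanSpace ℝ (Fin d)) :
    chartExt K R ψ χ f ε x = ∫ y, ψ y * cutFun K χ f (R x + ε • y) :=
  integral_mul_mollifier hε _ _

lemma exists_cutFun_bound (hK : IsCompact K) (hf : ContinuousOn f K) (hχ : ContDiff ℝ ∞ χ)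
    (hχc : HasCompactSupport χ) :
    ∃ M : ℝ, 0 ≤ M ∧ (∀ z, |cutFun K χ f z| ≤ M) ∧ ∀ z ∈ K, |χ z * f z| ≤ M := by
  obtain ⟨B, hB, hb⟩ := exists_cutoff_bound hχ hχc
  obtain ⟨S, hS⟩ := hK.exists_bound_of_continuousOn hf
  have h1 : ∀ z ∈ K, |χ z * f z| ≤ B * max S 0 := by
    intro z hz
    rw [abs_mul]
    exact mul_le_mul (hb z).1 ((hS z hz).trans (le_max_left _ _)) (abs_nonneg _) hB
  refine ⟨B * max S 0, by positivity, fun z ↦ ?_, h1⟩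
  by_cases hz : z ∈ interior K
  · rw [cutFun, indicator_of_mem hz, mul_comm]
    exact h1 z (interior_subset hz)
  · rw [cutFun, indicator_of_notMem hz, abs_zero]
    positivity

/-- Approach to `x` through points where `χ f` is not cut off by the boundary of `K`. -/
lemma tendsto_cutFun {x : EuclideanSpace ℝ (Fin d)} (hx : x ∈ K) (hf : ContinuousOn f K)
    (hχ : Continuous χ) {z : ℕ → EuclideanSpace ℝ (Fin d)}
    (hz : Filter.Tendsto z Filter.atTop (nhds x))
    (hi : ∀ᶠ n in Filter.atTop, z n ∈ tsupport χ → z n ∈ interior K) :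
    Filter.Tendsto (fun n ↦ cutFun K χ f (z n)) Filter.atTop (nhds (χ x * f x)) := by
  classical
  -- Redefining f as the constant f x off the interior makes it continuous at x in the whole space,
  -- whereas f itself is controlled on `K` only.
  set g : EuclideanSpace ℝ (Fin d) → ℝ := fun w ↦ if w ∈ interior K then f w else f x with hg
  have h1 : Filter.Tendsto g (nhds x) (nhds (f x)) := by
    intro U hU
    have h2 : ∀ᶠ w in nhds x, w ∈ K → f w ∈ U := eventually_nhdsWithin_iff.1 (hf x hx hU)
    rw [Filter.mem_map]
    filter_upwards [h2] with w hw
    rw [mem_preimage]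
    by_cases hwi : w ∈ interior K
    · simpa [hg, hwi] using hw (interior_subset hwi)
    · simpa [hg, hwi] using mem_of_mem_nhds hU
  refine Filter.Tendsto.congr' ?_ (((hχ.tendsto x).comp hz).mul (h1.comp hz))
  filter_upwards [hi] with n hn
  by_cases hni : z n ∈ interior K
  · simp [cutFun, hg, hni, mul_comm]
  · have : χ (z n) = 0 := image_eq_zero_of_notMem_tsupport fun h ↦ hni (hn h)
    simp [cutFun, hni, this]

namespace IsChart

/-- Dominated convergence in the mollifying variable y. If x is in `K'`, then R x = x and x + εy
tends to x through points allowed by `inward`. Otherwise χ x = 0 and R x is off the closed support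
of χ, so the averages vanish eventually. No point of `K` is excepted, so the limit can be integrated
against any measure on `K`. -/
lemma tendsto_chartExt (hc : IsChart K K' R ψ χ Λ C) (hK : IsCompact K)
    (h : IsH1 (interior K) f G) (hf : ContinuousOn f K) {x : EuclideanSpace ℝ (Fin d)}
    (hx : x ∈ K) :
    Filter.Tendsto (fun n : ℕ ↦ chartExt K R ψ χ f (1 / ((n : ℝ) + 1)) x) Filter.atTop
      (nhds (χ x * f x)) := by
  obtain ⟨M, hM0, hM, -⟩ := exists_cutFun_bound hK hf hc.contDiff_cutoff hc.compact_cutoff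
  have hψi : Integrable ψ := hc.contDiff_mol.continuous.integrable_of_hasCompactSupport
    hc.compact_mol
  have e0 : ∀ n : ℕ, (0 : ℝ) < 1 / ((n : ℝ) + 1) := fun n ↦ by positivity
  have e1 : ∀ n : ℕ, 1 / ((n : ℝ) + 1) ≤ 1 := fun n ↦ by
    rw [div_le_one (by positivity)]
    linarith [(Nat.cast_nonneg n : (0 : ℝ) ≤ n)]
  have hlim : ∀ w y : EuclideanSpace ℝ (Fin d),
      Filter.Tendsto (fun n : ℕ ↦ w + (1 / ((n : ℝ) + 1)) • y) Filter.atTop (nhds w) := by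
    intro w y
    simpa using ((tendsto_one_div_add_atTop_nhds_zero_nat (𝕜 := ℝ)).smul_const y).const_add w
  have hgoal : ∫ y, ψ y * (χ x * f x) = χ x * f x := by
    rw [integral_mul_const, hc.integral_mol, one_mul]
  rw [← hgoal]
  simp_rw [chartExt_apply (e0 _)]
  refine tendsto_integral_of_dominated_convergence (fun y ↦ ψ y * M) (fun n ↦ ?_)
    (hψi.mul_const M) (fun n ↦ Filter.Eventually.of_forall fun y ↦ ?_)
    (Filter.Eventually.of_forall fun y ↦ ?_)
  · refine hψi.1.mul ?_
    exact (((integrable_cut hK h hc.contDiff_cutoff hc.compact_cutoff).1.comp_add_left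
      (R x)).comp_smul (e0 n).ne').1
  · rw [norm_mul, Real.norm_of_nonneg (hc.mol_nonneg y)]
    exact mul_le_mul_of_nonneg_left (hM _) (hc.mol_nonneg y)
  · by_cases hy : y ∈ tsupport ψ
    · refine Filter.Tendsto.const_mul _ ?_
      by_cases hxK : x ∈ K'
      · rw [hc.eq_self x hxK]
        exact tendsto_cutFun hx hf hc.contDiff_cutoff.continuous (hlim x y)
          (Filter.Eventually.of_forall fun n ↦ hc.inward x hxK _ ⟨e0 n, e1 n⟩ y hy)
      · obtain ⟨h1, h2⟩ := hc.off x hx hxK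
        rw [h1, zero_mul]
        refine tendsto_const_nhds.congr' ?_
        filter_upwards [(hlim (R x) y).eventually
          ((isClosed_tsupport χ).isOpen_compl.mem_nhds h2)] with n hn
        by_cases hi : R x + (1 / ((n : ℝ) + 1)) • y ∈ interior K
        · rw [cutFun, indicator_of_mem hi, image_eq_zero_of_notMem_tsupport hn, mul_zero]
        · rw [cutFun, indicator_of_notMem hi]
    · simp [image_eq_zero_of_notMem_tsupport hy]

lemma norm_chartExt_le (hc : IsChart K K' R ψ χ Λ C) {M : ℝ} (hM : ∀ z, |cutFun K χ f z| ≤ M)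
    {ε : ℝ} (hε : 0 < ε) (x : EuclideanSpace ℝ (Fin d)) : ‖chartExt K R ψ χ f ε x‖ ≤ M := by
  have hψi : Integrable ψ := hc.contDiff_mol.continuous.integrable_of_hasCompactSupport
    hc.compact_mol
  rw [chartExt_apply hε]
  have : ∫ y, ψ y * M = M := by rw [integral_mul_const, hc.integral_mol, one_mul]
  rw [← this]
  refine norm_integral_le_of_norm_le (hψi.mul_const M) (Filter.Eventually.of_forall fun y ↦ ?_)
  rw [norm_mul, Real.norm_of_nonneg (hc.mol_nonneg y)]
  exact mul_le_mul_of_nonneg_left (hM _) (hc.mol_nonneg y)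

lemma tendsto_integral_chartExt (hc : IsChart K K' R ψ χ Λ C) (hK : IsCompact K)
    (h : IsH1 (interior K) f G) (hf : ContinuousOn f K)
    {α : Measure (EuclideanSpace ℝ (Fin d))} [IsFiniteMeasure α] (hα : ∀ᵐ x ∂α, x ∈ K) :
    Filter.Tendsto (fun n : ℕ ↦ ∫ x, chartExt K R ψ χ f (1 / ((n : ℝ) + 1)) x ∂α) Filter.atTop
      (nhds (∫ x, χ x * f x ∂α)) := by
  obtain ⟨M, hM0, hM, -⟩ := exists_cutFun_bound hK hf hc.contDiff_cutoff hc.compact_cutoff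
  refine tendsto_integral_of_dominated_convergence (fun _ ↦ M) (fun n ↦ ?_)
    (integrable_const M) (fun n ↦ Filter.Eventually.of_forall fun x ↦
      hc.norm_chartExt_le hM (by positivity) x) ?_
  · obtain ⟨L, hL⟩ := hc.exists_lipschitzWith_chartExt hK h
      (by positivity : (0 : ℝ) < 1 / ((n : ℝ) + 1))
    exact hL.continuous.aestronglyMeasurable
  · filter_upwards [hα] with x hx using hc.tendsto_chartExt hK h hf hx

/-- The bound `|∫ χ f dμ| ≤ C ‖f‖_{H¹} √E` for the part of `f` in a chart. -/
lemma exists_abs_sint_le (hc : IsChart K K' R ψ χ Λ C) (hK : IsCompact K) (hd : 0 < d) :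
    ∃ D : ℝ, 0 ≤ D ∧ ∀ f G, ContinuousOn f K → IsH1 (interior K) f G →
      ∀ α β : Measure (EuclideanSpace ℝ (Fin d)), IsFiniteMeasure α → IsFiniteMeasure β →
      (∀ᵐ x ∂α, x ∈ K) → (∀ᵐ x ∂β, x ∈ K) → ∀ E : ℝ,
      (∀ a b : ℝ, 0 < a → a ≤ b → ∫ t in Ioc a b, sform α β (heat t) ≤ E) →
      |sint α β fun x ↦ χ x * f x| ≤ D * h1Norm (interior K) f G * √E := by
  obtain ⟨B, hB, hb⟩ := exists_cutoff_bound hc.contDiff_cutoff hc.compact_cutoff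
  -- Λ² C is the cost of the retraction, 2 B² that of the cutoff.
  refine ⟨√(Λ ^ 2 * C * (2 * B ^ 2)), Real.sqrt_nonneg _,
    fun f G hf h α β _ _ hα hβ E hE ↦ ?_⟩
  have h1 := ((hc.tendsto_integral_chartExt hK h hf hα).sub
    (hc.tendsto_integral_chartExt hK h hf hβ)).abs
  refine le_of_tendsto h1 (Filter.Eventually.of_forall fun n ↦ ?_)
  refine (hc.abs_sint_chartExt_le hK hd h ⟨by positivity, ?_⟩ hE).trans ?_
  · rw [div_le_one (by positivity)]
    linarith [(Nat.cast_nonneg n : (0 : ℝ) ≤ n)]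
  · gcongr
    have hn : 0 ≤ h1Norm (interior K) f G := Real.sqrt_nonneg _
    rw [← Real.sqrt_sq hn, ← Real.sqrt_mul (by positivity), mul_assoc (Λ ^ 2 * C : ℝ)]
    refine Real.sqrt_le_sqrt ?_
    gcongr
    exact integral_norm_sq_cutGrad_le h hb

end IsChart

end Chart

/-! ### Reflection in a Lipschitz graph and construction of charts -/

/-- Lipschitz maps increase the volume by at most a constant factor. -/
lemma volume_image_le {S : EuclideanSpace ℝ (Fin d) → EuclideanSpace ℝ (Fin d)} {Λ : ℝ≥0}
    (hS : LipschitzWith Λ S) (A : Set (EuclideanSpace ℝ (Fin d))) :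
    volume (S '' A) ≤ (Λ ^ d : ℝ≥0) * volume A := by
  -- Volume is a constant multiple of the Hausdorff measure of dimension d, for which the Lipschitz
  -- bound is available. The constant appears on both sides.
  have h1 := Measure.isAddLeftInvariant_eq_smul (volume : Measure (EuclideanSpace ℝ (Fin d)))
    (Measure.hausdorffMeasure (Module.finrank ℝ (EuclideanSpace ℝ (Fin d))))
  have h2 := hS.hausdorffMeasure_image_le
    (Nat.cast_nonneg (Module.finrank ℝ (EuclideanSpace ℝ (Fin d)))) A
  rw [h1, Measure.smul_apply, Measure.smul_apply, ENNReal.smul_def, ENNReal.smul_def, smul_eq_mul,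
    smul_eq_mul, mul_left_comm]
  gcongr
  refine h2.trans_eq ?_
  rw [finrank_euclideanSpace_fin, ENNReal.rpow_natCast, ENNReal.coe_pow]

section Reflection

variable {e : EuclideanSpace ℝ (Fin d)} {h : EuclideanSpace ℝ (Fin d) → ℝ} {M : ℝ≥0}

lemma lipschitzWith_add_smul (he : ‖e‖ = 1) {u : EuclideanSpace ℝ (Fin d) → ℝ}
    (hu : LipschitzWith M u) : LipschitzWith (1 + 2 * M) fun x ↦ x + (2 * u x) • e := by
  refine LipschitzWith.id.add (LipschitzWith.of_dist_le_mul fun x y ↦ ?_)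
  rw [dist_eq_norm, ← sub_smul, norm_smul, he, mul_one, ← mul_sub, norm_mul, ← dist_eq_norm]
  have := hu.dist_le_mul x y
  push_cast
  rw [Real.norm_of_nonneg zero_le_two, mul_assoc]
  gcongr

/-- The reflection in direction `e` at the graph `h = 0` does not increase volumes by more than
a constant factor. -/
lemma lintegral_reflection_le (he : ‖e‖ = 1) (hM : LipschitzWith M h)
    (hs : ∀ x (s : ℝ), h (x + s • e) = h x - s) {g : EuclideanSpace ℝ (Fin d) → ℝ≥0∞}
    (hg : Measurable g) :
    ∫⁻ x in {x | h x ≤ 0}ᶜ, g (x + (2 * h x) • e) ≤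
      ((1 + 2 * M) ^ d : ℝ≥0) * ∫⁻ x in {x | h x ≤ 0}, g x := by
  set S : EuclideanSpace ℝ (Fin d) → EuclideanSpace ℝ (Fin d) := fun x ↦ x + (2 * h x) • e with hS
  have hSL : LipschitzWith (1 + 2 * M) S := lipschitzWith_add_smul he hM
  have hSm : Measurable S := hSL.continuous.measurable
  have hm : MeasurableSet {x | h x ≤ 0} := measurableSet_le hM.continuous.measurable
    measurable_const
  have hhS : ∀ x, h (S x) = -h x := fun x ↦ by
    rw [hS]
    simp only [hs]
    ring
  have hSS : ∀ x, S (S x) = x := fun x ↦ by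
    have h1 : S (S x) = S x + (2 * h (S x)) • e := rfl
    rw [h1, hhS, hS]
    simp only [mul_neg, neg_smul, add_neg_cancel_right]
  -- `S` is an involution exchanging the two sides of the graph, so a preimage under `S` is an image
  -- under `S` and its volume is controlled by the Lipschitz constant.
  have key : (volume.restrict {x | h x ≤ 0}ᶜ).map S ≤
      (((1 + 2 * M) ^ d : ℝ≥0) : ℝ≥0∞) • volume.restrict {x | h x ≤ 0} := by
    refine Measure.le_iff.2 fun A hA ↦ ?_
    rw [Measure.map_apply hSm hA, Measure.restrict_apply (hSm hA), Measure.smul_apply,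
      Measure.restrict_apply hA, smul_eq_mul]
    refine le_trans (measure_mono ?_) (volume_image_le hSL _)
    rintro x ⟨hxA, hx⟩
    refine ⟨S x, ⟨hxA, ?_⟩, hSS x⟩
    simp only [mem_compl_iff, mem_ofPred_eq, not_le] at hx ⊢
    rw [hhS]
    linarith
  rw [← lintegral_map (f := g) hg hSm, ← smul_eq_mul, ← lintegral_smul_measure]
  exact lintegral_mono' key le_rfl

end Reflection

/-- A neighbourhood of `x₀` in which every cut off function has a chart. -/
def HasCharts (K : Set (EuclideanSpace ℝ (Fin d))) (x₀ : EuclideanSpace ℝ (Fin d)) : Prop :=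
  ∃ ρ : ℝ, 0 < ρ ∧ ∀ χ : EuclideanSpace ℝ (Fin d) → ℝ, ContDiff ℝ ∞ χ → HasCompactSupport χ →
    tsupport χ ⊆ Metric.ball x₀ ρ → ∃ K' R ψ Λ C, IsChart K K' R ψ χ Λ C

variable {K : Set (EuclideanSpace ℝ (Fin d))} {x₀ : EuclideanSpace ℝ (Fin d)}

/-- Inside of `K` nothing has to be straightened: the retraction is the identity of the whole space,
and any mollifier points inwards. -/
lemma hasCharts_of_mem_interior (hx : x₀ ∈ interior K) : HasCharts K x₀ := by
  obtain ⟨ρ, hρ, hsub⟩ := Metric.isOpen_iff.1 isOpen_interior x₀ hx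
  refine ⟨ρ, hρ, fun χ hχ hχc hs ↦ ?_⟩
  let b : ContDiffBump (0 : EuclideanSpace ℝ (Fin d)) := ⟨1, 2, one_pos, one_lt_two⟩
  exact ⟨univ, id, b.normed volume, 1, 1,
    { contDiff_mol := b.contDiff_normed
      compact_mol := b.hasCompactSupport_normed
      mol_nonneg := b.nonneg_normed
      integral_mol := b.integral_normed
      contDiff_cutoff := hχ
      compact_cutoff := hχc
      measurableSet := MeasurableSet.univ
      mapsTo := fun x ↦ mem_univ _
      eq_self := fun x _ ↦ rfl
      lipschitz := LipschitzWith.id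
      bounded := fun s hs ↦ hs
      lintegral_le := fun g _ ↦ by simp
      inward := fun x _ ε _ y _ h ↦ hsub (hs h)
      off := fun x _ h ↦ absurd (mem_univ x) h }⟩

/-- `h` is the signed height of the graph above a point, measured along e, so that h ≤ 0 describes
`K` near x₀. The chart takes for `K'` the whole region h ≤ 0, for `R` the reflection of the other
side along e, and for the mollifier a bump near e, which moves points of `K'` strictly above the
graph. -/
lemma hasCharts_of_height {e : EuclideanSpace ℝ (Fin d)} {h : EuclideanSpace ℝ (Fin d) → ℝ}
    {M : ℝ≥0} (he : ‖e‖ = 1) (hM : LipschitzWith M h)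
    (hs : ∀ x (s : ℝ), h (x + s • e) = h x - s) (h0 : h x₀ = 0) {r : ℝ} (hr : 0 < r)
    (hK : ∀ y ∈ Metric.ball x₀ r, y ∈ K ↔ h y ≤ 0) : HasCharts K x₀ := by
  set S : EuclideanSpace ℝ (Fin d) → EuclideanSpace ℝ (Fin d) := fun x ↦ x + (2 * h x) • e with hS
  have hSL : LipschitzWith (1 + 2 * M) S := lipschitzWith_add_smul he hM
  have hhS : ∀ x, h (S x) = -h x := fun x ↦ by
    rw [hS]
    simp only [hs]
    ring
  have hSS : ∀ x, S (S x) = x := fun x ↦ by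
    have h1 : S (S x) = S x + (2 * h (S x)) • e := rfl
    rw [h1, hhS, hS]
    simp only [mul_neg, neg_smul, add_neg_cancel_right]
  have hS0 : S x₀ = x₀ := by simp [hS, h0]
  set R : EuclideanSpace ℝ (Fin d) → EuclideanSpace ℝ (Fin d) :=
    fun x ↦ x + (2 * max (h x) 0) • e with hR
  have hR1 : ∀ x, h x ≤ 0 → R x = x := fun x hx ↦ by simp [hR, max_eq_right hx]
  have hR2 : ∀ x, 0 ≤ h x → R x = S x := fun x hx ↦ by simp [hR, hS, max_eq_left hx]
  have hm : MeasurableSet {x | h x ≤ 0} := measurableSet_le hM.continuous.measurable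
    measurable_const
  have hi : ∀ z ∈ Metric.ball x₀ r, h z < 0 → z ∈ interior K := by
    intro z hz hz0
    refine mem_interior.2 ⟨Metric.ball x₀ r ∩ {z | h z < 0}, fun w hw ↦ (hK w hw.1).2 hw.2.le,
      Metric.isOpen_ball.inter (isOpen_lt hM.continuous continuous_const), hz, hz0⟩
  -- If ‖y - e‖ ≤ 1/(2(M+1)), then h changes by at most ε/2 along ε(y - e) and drops by ε along εe,
  -- so h(x + εy) < 0 whenever h x ≤ 0.
  have hκ : (0 : ℝ) < 1 / (2 * (M + 1)) := by positivity
  let b : ContDiffBump e := ⟨1 / (2 * (M + 1)) / 2, 1 / (2 * (M + 1)), half_pos hκ, half_lt_self hκ⟩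
  have hL1 : (1 : ℝ) ≤ ((1 + 2 * M : ℝ≥0) : ℝ) := by
    push_cast
    linarith [M.coe_nonneg]
  have hL0 : (0 : ℝ) < ((1 + 2 * M : ℝ≥0) : ℝ) := by linarith
  -- The radius is divided by the Lipschitz constant of `S`, which fixes x₀: the reflection of a
  -- point outside of the ball of radius r then misses the support of χ. This is used in `off`.
  refine ⟨r / ((1 + 2 * M : ℝ≥0) : ℝ), div_pos hr hL0, fun χ hχ hχc hsupp ↦
    ⟨{x | h x ≤ 0}, R, b.normed volume, 1 + 2 * M, 1 + (1 + 2 * M) ^ d, ?_⟩⟩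
  have hsupp' : tsupport χ ⊆ Metric.ball x₀ r :=
    hsupp.trans (Metric.ball_subset_ball (div_le_self hr.le hL1))
  exact
    { contDiff_mol := b.contDiff_normed
      compact_mol := b.hasCompactSupport_normed
      mol_nonneg := b.nonneg_normed
      integral_mol := b.integral_normed
      contDiff_cutoff := hχ
      compact_cutoff := hχc
      measurableSet := hm
      mapsTo := fun x ↦ by
        rcases le_total (h x) 0 with hx | hx
        · rwa [hR1 x hx]
        · rw [hR2 x hx, mem_ofPred_eq, hhS]
          linarith
      eq_self := hR1
      lipschitz := lipschitzWith_add_smul he (hM.max_const 0)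
      bounded := fun s hs ↦ by
        refine (hs.union (hSL.isBounded_image hs)).subset fun x hx ↦ ?_
        rcases le_total (h x) 0 with h1 | h1
        · rw [mem_preimage, hR1 x h1] at hx
          exact Or.inl hx
        · rw [mem_preimage, hR2 x h1] at hx
          exact Or.inr ⟨S x, hx, hSS x⟩
      lintegral_le := fun g hg ↦ by
        rw [← lintegral_add_compl (fun x ↦ g (R x)) hm, ENNReal.coe_add, add_mul, ENNReal.coe_one,
          one_mul]
        refine add_le_add (setLIntegral_mono' hm fun x hx ↦ by rw [hR1 x hx]) ?_
        refine le_trans (setLIntegral_mono' hm.compl fun x hx ↦ ?_)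
          (lintegral_reflection_le he hM hs hg)
        rw [mem_compl_iff, mem_ofPred_eq, not_le] at hx
        rw [hR2 x hx.le]
      inward := fun x hx ε hε y hy hxy ↦ by
        refine hi _ (hsupp' hxy) ?_
        rw [b.tsupport_normed_eq, mem_closedBall_iff_norm] at hy
        have h1 : x + ε • y = (x + ε • (y - e)) + ε • e := by
          rw [smul_sub]
          abel
        have h2 := hM.dist_le_mul (x + ε • (y - e)) x
        rw [dist_eq_norm (x + _), add_sub_cancel_left, norm_smul, Real.norm_of_nonneg hε.1.le,
          Real.dist_eq] at h2
        have h3 := (le_abs_self _).trans h2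
        have h4 : (M : ℝ) * ‖y - e‖ ≤ 1 / 2 := by
          refine (mul_le_mul_of_nonneg_left hy M.coe_nonneg).trans ?_
          rw [mul_one_div, div_le_div_iff₀ (by positivity) two_pos]
          linarith
        rw [h1, hs]
        have hx' : h x ≤ 0 := hx
        nlinarith [hε.1]
      off := fun x hxK hx ↦ by
        rw [mem_ofPred_eq, not_le] at hx
        have hxr : x ∉ Metric.ball x₀ r := fun hxr ↦ absurd ((hK x hxr).1 hxK) (not_le.2 hx)
        refine ⟨image_eq_zero_of_notMem_tsupport fun h' ↦ hxr (hsupp' h'), fun h' ↦ hxr ?_⟩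
        rw [hR2 x hx.le] at h'
        have h1 := hSL.dist_le_mul (S x) x₀
        rw [hSS, hS0] at h1
        have h2 := Metric.mem_ball.1 (hsupp h')
        rw [lt_div_iff₀ hL0] at h2
        rw [Metric.mem_ball]
        linarith }

/-- The height is γ(Py) - ⟨e, y⟩, with P the projection onto the hyperplane. It is Lipschitz and
decreases at unit speed along e. -/
lemma HasLipschitzBoundary.hasCharts (hL : HasLipschitzBoundary K) (hK : IsClosed K)
    (hx : x₀ ∈ K) : HasCharts K x₀ := by
  by_cases hi : x₀ ∈ interior K
  · exact hasCharts_of_mem_interior hi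
  obtain ⟨e, L, γ, r, he, hγ, hr, hKr⟩ := hL x₀ (hK.frontier_eq ▸ ⟨hx, hi⟩)
  have hPe : (ℝ ∙ e)ᗮ.orthogonalProjectionOnto e = 0 :=
    Submodule.orthogonalProjectionOnto_eq_zero_iff.2
      (Submodule.le_orthogonal_orthogonal _ (Submodule.mem_span_singleton_self e))
  have hM : LipschitzWith (L * 1 + 1)
      fun y ↦ γ ((ℝ ∙ e)ᗮ.orthogonalProjectionOnto y) - inner ℝ e y := by
    refine (hγ.comp (Submodule.lipschitzWith_orthogonalProjectionOnto _)).sub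
      (LipschitzWith.of_dist_le_mul fun x y ↦ ?_)
    rw [Real.dist_eq, ← inner_sub_right, dist_eq_norm, NNReal.coe_one, ← he]
    exact abs_real_inner_le_norm _ _
  have hKr' : ∀ y ∈ Metric.ball x₀ r, y ∈ K ↔
      γ ((ℝ ∙ e)ᗮ.orthogonalProjectionOnto y) - inner ℝ e y ≤ 0 := by
    intro y hy
    rw [hKr y hy, sub_nonpos]
  refine hasCharts_of_height he hM (fun x s ↦ ?_) ?_ hr hKr'
  · rw [map_add, map_smul, hPe, smul_zero, add_zero, inner_add_right, real_inner_smul_right,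
      real_inner_self_eq_norm_sq, he]
    ring
  -- A strictly negative height would persist nearby and make x₀ an interior point.
  · refine le_antisymm ((hKr' x₀ (Metric.mem_ball_self hr)).1 hx) (not_lt.1 fun hlt ↦ hi ?_)
    refine mem_interior.2 ⟨Metric.ball x₀ r ∩
      {z | γ ((ℝ ∙ e)ᗮ.orthogonalProjectionOnto z) - inner ℝ e z < 0},
      fun w hw ↦ (hKr' w hw.1).2 hw.2.le,
      Metric.isOpen_ball.inter (isOpen_lt hM.continuous continuous_const),
      Metric.mem_ball_self hr, hlt⟩

/-! ### The energy controls the dual norm -/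

open scoped Manifold in
/-- The dual bound on a compact set which has charts everywhere. -/
lemma exists_abs_sint_le_of_hasCharts {K : Set (EuclideanSpace ℝ (Fin d))} (hK : IsCompact K)
    (hd : 0 < d) (hc : ∀ x ∈ K, HasCharts K x) :
    ∃ D : ℝ, 0 ≤ D ∧ ∀ f G, ContinuousOn f K → IsH1 (interior K) f G →
      ∀ α β : Measure (EuclideanSpace ℝ (Fin d)), IsFiniteMeasure α → IsFiniteMeasure β →
      (∀ᵐ x ∂α, x ∈ K) → (∀ᵐ x ∂β, x ∈ K) → ∀ E : ℝ,
      (∀ a b : ℝ, 0 < a → a ≤ b → ∫ t in Ioc a b, sform α β (heat t) ≤ E) →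
      |sint α β f| ≤ D * h1Norm (interior K) f G * √E := by
  choose! ρ hρ hch using hc
  obtain ⟨t, htK, hcov⟩ := hK.elim_nhds_subcover (fun x ↦ Metric.ball x (ρ x))
    fun x hx ↦ Metric.ball_mem_nhds x (hρ x hx)
  -- Compactness leaves finitely many balls. The subordinate partition cuts f into pieces, each
  -- within reach of one chart, and their constants add up.
  obtain ⟨p, hp⟩ := SmoothPartitionOfUnity.exists_isSubordinate
    𝓘(ℝ, EuclideanSpace ℝ (Fin d)) hK.isClosed (fun i : t ↦ Metric.ball (i : _) (ρ i))
    (fun i ↦ Metric.isOpen_ball) (hcov.trans (by simp [iUnion_subtype]))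
  have hsm : ∀ i, ContDiff ℝ ∞ (p i) := fun i ↦ (p i).contMDiff.contDiff
  have hcs : ∀ i, HasCompactSupport (p i) := fun i ↦
    Metric.isCompact_of_isClosed_isBounded (isClosed_tsupport _)
      (Metric.isBounded_ball.subset (hp i))
  have hD : ∀ i : t, ∃ D : ℝ, 0 ≤ D ∧ ∀ f G, ContinuousOn f K → IsH1 (interior K) f G →
      ∀ α β : Measure (EuclideanSpace ℝ (Fin d)), IsFiniteMeasure α → IsFiniteMeasure β →
      (∀ᵐ x ∂α, x ∈ K) → (∀ᵐ x ∂β, x ∈ K) → ∀ E : ℝ,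
      (∀ a b : ℝ, 0 < a → a ≤ b → ∫ t in Ioc a b, sform α β (heat t) ≤ E) →
      |sint α β fun x ↦ p i x * f x| ≤ D * h1Norm (interior K) f G * √E := by
    intro i
    obtain ⟨K', R, ψ, Λ, C, h⟩ := hch i (htK i i.2) (p i) (hsm i) (hcs i) (hp i)
    exact h.exists_abs_sint_le hK hd
  choose D hD0 hD using hD
  refine ⟨∑ i, D i, Finset.sum_nonneg fun i _ ↦ hD0 i, fun f G hf hH α β _ _ hα hβ E hE ↦ ?_⟩
  have hsum : ∀ x ∈ K, f x = ∑ i, p i x * f x := by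
    intro x hx
    have := p.sum_eq_one hx
    rw [finsum_eq_sum_of_fintype] at this
    rw [← Finset.sum_mul, this, one_mul]
  have hint : ∀ γ : Measure (EuclideanSpace ℝ (Fin d)), IsFiniteMeasure γ → (∀ᵐ x ∂γ, x ∈ K) →
      ∀ i, Integrable (fun x ↦ p i x * f x) γ := by
    intro γ _ hγ i
    rw [← Measure.restrict_eq_self_of_ae_mem hγ]
    exact ((hsm i).continuous.continuousOn.mul hf).integrableOn_compact hK
  have hdec : sint α β f = ∑ i, sint α β fun x ↦ p i x * f x := by
    simp only [sint]
    rw [integral_congr_ae (hα.mono hsum), integral_congr_ae (hβ.mono hsum),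
      integral_finsetSum _ fun i _ ↦ hint α inferInstance hα i,
      integral_finsetSum _ fun i _ ↦ hint β inferInstance hβ i, Finset.sum_sub_distrib]
  rw [hdec, Finset.sum_mul, Finset.sum_mul]
  exact (Finset.abs_sum_le_sum_abs _ _).trans
    (Finset.sum_le_sum fun i _ ↦ hD i f G hf hH α β ‹_› ‹_› hα hβ E hE)

lemma toENNReal_rpow_half {E : ℝ} (hE : 0 ≤ E) :
    (E : EReal).toENNReal ^ (1 / 2 : ℝ) = ENNReal.ofReal √E := by
  rw [EReal.toENNReal_of_ne_top (EReal.coe_ne_top E), EReal.toReal_coe,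
    ENNReal.ofReal_rpow_of_nonneg hE (by norm_num), Real.sqrt_eq_rpow]

/-- The energy controls the `H⁻¹` norm. -/
theorem exists_hMinusOneNorm_le (hd : 2 ≤ d) {K : Set (EuclideanSpace ℝ (Fin d))}
    (hK : IsCompact K) (hL : HasLipschitzBoundary K) :
    ∃ C : ℝ≥0, 0 < C ∧ ∀ μ : SignedMeasure (EuclideanSpace ℝ (Fin d)),
      IsOn μ K → (d = 2 → μ univ = 0) → (∀ x, μ {x} = 0) → EnergyDefined μ →
        0 ≤ energy μ ∧ hMinusOneNorm K μ ≤ C * sqrtEnergy μ := by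
  obtain ⟨A, hA, henergy⟩ := exists_energy_nonneg hd
  obtain ⟨D, hD, hdual⟩ := exists_abs_sint_le_of_hasCharts hK (by lia : 0 < d)
    fun x hx ↦ hL.hasCharts hK.isClosed hx
  -- `D` may be 0, but the constant must be positive, also in order that its product with an
  -- infinite energy be infinite.
  have hC : 0 < (D + 1) * √A := mul_pos (by linarith) (Real.sqrt_pos.2 hA)
  refine ⟨NNReal.mk ((D + 1) * √A) hC.le, hC, fun μ hμ h2 hat hdef ↦ ?_⟩
  obtain ⟨h0, htop | ⟨E, hE, hEμ, hheat⟩⟩ := henergy K hK μ hμ h2 hat hdef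
  · refine ⟨h0, ?_⟩
    rw [sqrtEnergy, htop, EReal.toENNReal_top, ENNReal.top_rpow_of_pos (by norm_num),
      ENNReal.mul_top]
    · exact le_top
    · exact ENNReal.coe_ne_zero.2 (ne_of_gt hC)
  refine ⟨h0, ?_⟩
  rw [sqrtEnergy, hEμ, toENNReal_rpow_half hE]
  refine iSup_le fun f ↦ iSup_le fun G ↦ iSup_le fun hf ↦ iSup_le fun hH ↦ ?_
  obtain ⟨a1, a2⟩ := isOn_ae hμ
  have hi : ∀ γ : Measure (EuclideanSpace ℝ (Fin d)), IsFiniteMeasure γ → (∀ᵐ x ∂γ, x ∈ K) →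
      Integrable f γ := by
    intro γ _ hγ
    rw [← Measure.restrict_eq_self_of_ae_mem hγ]
    exact hf.integrableOn_compact hK
  rw [integral_signedMeasure μ (hi _ inferInstance a1) (hi _ inferInstance a2)]
  -- This covers a vanishing H¹ norm: the product bound then forces the numerator to vanish, and 0/0
  -- = 0.
  refine ENNReal.div_le_of_le_mul ?_
  have hn : 0 ≤ h1Norm (interior K) f G := Real.sqrt_nonneg _
  have h1 := (le_abs_self _).trans
    (hdual f G hf hH _ _ inferInstance inferInstance a1 a2 (A * E) hheat)
  have e : (NNReal.mk ((D + 1) * √A) hC.le : ℝ≥0∞) = ENNReal.ofReal ((D + 1) * √A) :=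
    (ENNReal.ofReal_eq_coe_nnreal hC.le).symm
  rw [e, ← ENNReal.ofReal_mul hC.le, ← ENNReal.ofReal_mul (by positivity)]
  refine ENNReal.ofReal_le_ofReal (h1.trans ?_)
  rw [Real.sqrt_mul hA.le]
  calc D * h1Norm (interior K) f G * (√A * √E) ≤ (D + 1) * h1Norm (interior K) f G * (√A * √E) := by
        gcongr
        linarith
    _ = _ := by ring

/-! ### Heat potentials of a measure and their size -/

section Potential

variable {α β : Measure (EuclideanSpace ℝ (Fin d))} [IsFiniteMeasure α] [IsFiniteMeasure β]

/-- This is what makes the potential of a measure a good test function: its pairing with the measure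
returns the quadratic form. -/
lemma sint_sint_shift {k : EuclideanSpace ℝ (Fin d) → ℝ} (hk : Continuous k) {M : ℝ}
    (hM : ∀ x, ‖k x‖ ≤ M) :
    (sint α β fun z ↦ sint α β fun x ↦ k (z - x)) = sform α β k := by
  have hi : ∀ ν : Measure (EuclideanSpace ℝ (Fin d) × EuclideanSpace ℝ (Fin d)),
      IsFiniteMeasure ν → Integrable (fun p ↦ k (p.1 - p.2)) ν := fun ν _ ↦
    Integrable.of_bound (hk.comp continuous_sub).aestronglyMeasurable M
      (Filter.Eventually.of_forall fun _ ↦ hM _)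
  have hp : ∀ μ ν : Measure (EuclideanSpace ℝ (Fin d)), IsFiniteMeasure μ → IsFiniteMeasure ν →
      Integrable (fun z ↦ ∫ x, k (z - x) ∂ν) μ ∧
      ∫ p, k (p.1 - p.2) ∂(μ.prod ν) = ∫ z, ∫ x, k (z - x) ∂ν ∂μ := fun μ ν _ _ ↦
    ⟨(hi (μ.prod ν) inferInstance).integral_prod_left, integral_prod _ (hi _ inferInstance)⟩
  obtain ⟨i1, e1⟩ := hp α α inferInstance inferInstance
  obtain ⟨i2, e2⟩ := hp α β inferInstance inferInstance
  obtain ⟨i3, e3⟩ := hp β α inferInstance inferInstance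
  obtain ⟨i4, e4⟩ := hp β β inferInstance inferInstance
  rw [sform, integral_add_measure (hi _ inferInstance) (hi _ inferInstance),
    integral_add_measure (hi _ inferInstance) (hi _ inferInstance), e1, e2, e3, e4]
  simp only [sint]
  rw [integral_sub i1 i2, integral_sub i3 i4]
  ring

lemma continuous_sint_shift {F : Type*} [NormedAddCommGroup F] [InnerProductSpace ℝ F]
    [CompleteSpace F] {a : EuclideanSpace ℝ (Fin d) → F} (ha : Continuous a) {M : ℝ}
    (hM : ∀ x, ‖a x‖ ≤ M) : Continuous fun z ↦ sint α β fun x ↦ a (z - x) :=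
  (continuous_integral_shift ha hM).sub (continuous_integral_shift ha hM)

lemma norm_sint_le {F : Type*} [NormedAddCommGroup F] [NormedSpace ℝ F]
    {a : EuclideanSpace ℝ (Fin d) → F} {M : ℝ} (hM : ∀ x, ‖a x‖ ≤ M) :
    ‖sint α β a‖ ≤ M * (α.real univ + β.real univ) := by
  refine (norm_sub_le _ _).trans ?_
  rw [mul_add]
  exact add_le_add (norm_integral_le_of_norm_le_const (Filter.Eventually.of_forall hM))
    (norm_integral_le_of_norm_le_const (Filter.Eventually.of_forall hM))

lemma integral_inner_sint_shift {F : Type*} [NormedAddCommGroup F] [InnerProductSpace ℝ F]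
    [CompleteSpace F] {W a : EuclideanSpace ℝ (Fin d) → F} (hW : Integrable W) (ha : Continuous a)
    {M : ℝ} (hM : ∀ x, ‖a x‖ ≤ M) :
    ∫ z, inner ℝ (W z) (sint α β fun x ↦ a (z - x)) =
      sint α β fun x ↦ ∫ z, inner ℝ (W z) (a (z - x)) := by
  obtain ⟨-, i1, e1⟩ := integral_integral_inner_shift (α := α) hW ha hM
  obtain ⟨-, i2, e2⟩ := integral_integral_inner_shift (α := β) hW ha hM
  rw [sint, e1, e2, ← integral_sub i1 i2]
  simp only [sint, inner_sub_right]

/-- The pointwise bound of the heat flow of a measure by its quadratic form. -/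
lemma sq_sint_heat_le {t : ℝ} (ht : 0 < t) (z : EuclideanSpace ℝ (Fin d)) :
    (sint α β fun x ↦ heat t (z - x)) ^ 2 ≤
      (4 * Real.pi * t) ^ (-(d : ℝ) / 2) * sform α β (heat t) := by
  have hc := (contDiff_heat (d := d) (t / 2)).continuous
  have hb := abs_heat_le (d := d) (half_pos ht)
  have hw : Integrable fun y : EuclideanSpace ℝ (Fin d) ↦ heat (t / 2) (y - z) :=
    (integrable_heat (half_pos ht)).comp_sub_right z
  -- The flow at time t is split into two half steps. Cauchy-Schwarz between them produces p_t(0),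
  -- the squared norm of p_{t/2}, and the quadratic form.
  have e1 := integral_inner_sint_shift (α := α) (β := β) hw hc hb
  simp_rw [heat_inner_shift ht] at e1
  obtain ⟨i2, e2⟩ := integral_sint_heat_sq (α := α) (β := β) ht
  have hw2 : MemLp (fun y : EuclideanSpace ℝ (Fin d) ↦ heat (t / 2) (y - z)) 2 := by
    refine memLp_two_of_integrable_sq_norm hw.1 ?_
    refine (hw.mul_bdd (c := _) hw.1 (Filter.Eventually.of_forall fun y ↦ hb (y - z))).congr
      (Filter.Eventually.of_forall fun y ↦ ?_)
    simp [sq]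
  have hu2 : MemLp (fun y ↦ sint α β fun x ↦ heat (t / 2) (y - x)) 2 := by
    refine memLp_two_of_integrable_sq_norm (continuous_sint_shift hc hb).aestronglyMeasurable ?_
    simpa using i2
  have hCS := abs_integral_inner_le hw2 hu2
  have e3 := heat_inner_shift ht z z
  rw [sub_self, heat_zero] at e3
  simp only [real_inner_self_eq_norm_sq] at e3
  simp only [Real.norm_eq_abs, sq_abs] at hCS e3
  rw [e1, e3, e2] at hCS
  rw [← sq_abs]
  refine (pow_le_pow_left₀ (abs_nonneg _) hCS 2).trans_eq ?_
  rw [mul_pow, Real.sq_sqrt (by positivity), Real.sq_sqrt (sform_heat_nonneg ht)]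

lemma measurable_sint_heat :
    Measurable fun p : ℝ × EuclideanSpace ℝ (Fin d) ↦ sint α β fun x ↦ heat p.1 (p.2 - x) := by
  have h : StronglyMeasurable fun q : (ℝ × EuclideanSpace ℝ (Fin d)) × EuclideanSpace ℝ (Fin d) ↦
      heat q.1.1 (q.1.2 - q.2) :=
    (measurable_heat.comp (by fun_prop : Measurable
      fun q : (ℝ × EuclideanSpace ℝ (Fin d)) × EuclideanSpace ℝ (Fin d) ↦
        (q.1.1, q.1.2 - q.2))).stronglyMeasurable
  exact (h.integral_prod_right.sub h.integral_prod_right).measurable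

lemma sint_heatInt {δ T : ℝ} (hδ : 0 < δ) (z : EuclideanSpace ℝ (Fin d)) :
    (sint α β fun x ↦ heatInt δ T (z - x)) =
      ∫ t in Ioc δ T, sint α β fun x ↦ heat t (z - x) := by
  obtain ⟨C, h⟩ := exists_heat_time_bound (d := d) (T := T) hδ
  have hi : ∀ ν : Measure (EuclideanSpace ℝ (Fin d)), IsFiniteMeasure ν →
      Integrable (fun q : ℝ × EuclideanSpace ℝ (Fin d) ↦ heat q.1 (z - q.2))
        ((volume.restrict (Ioc δ T)).prod ν) := by
    intro ν _
    refine integrable_time_prod (C := C) (g := fun _ ↦ 1) ?_ (integrable_const _) ?_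
    · exact (measurable_heat.comp (by fun_prop : Measurable
        fun q : ℝ × EuclideanSpace ℝ (Fin d) ↦ (q.1, z - q.2))).aestronglyMeasurable
    · intro t ht x
      simpa using h t (Ioc_subset_Icc_self ht) _
  have h1 := hi α inferInstance
  have h2 := hi β inferInstance
  simp only [sint, heatInt]
  rw [integral_sub h1.integral_prod_left h2.integral_prod_left,
    integral_integral_swap (f := fun t x ↦ heat t (z - x)) h1,
    integral_integral_swap (f := fun t x ↦ heat t (z - x)) h2]

lemma exists_sint_heat_bound {δ T : ℝ} (hδ : 0 < δ) : ∃ M : ℝ, 0 ≤ M ∧ ∀ t ∈ Icc δ T,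
    ∀ z : EuclideanSpace ℝ (Fin d), |sint α β fun x ↦ heat t (z - x)| ≤ M := by
  obtain ⟨C, h⟩ := exists_heat_time_bound (d := d) (T := T) hδ
  refine ⟨|C| * (α.real univ + β.real univ), by positivity, fun t ht z ↦ ?_⟩
  exact norm_sint_le (a := fun x ↦ heat t (z - x)) fun x ↦ (h t ht _).trans (le_abs_self C)

end Potential

/-- The weighted Cauchy-Schwarz inequality. -/
lemma sq_integral_le_weight {X : Type*} [MeasurableSpace X] {ν : Measure X} {f v w : X → ℝ}
    (hw : ∀ᵐ x ∂ν, 0 ≤ w x) (hvw : ∀ᵐ x ∂ν, w x * v x = 1) {W : ℝ} (hW : 0 < W)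
    (hv : ∫ x, v x ∂ν ≤ W) (iv : Integrable v ν) (i1 : Integrable f ν)
    (i2 : Integrable (fun x ↦ w x * f x ^ 2) ν) :
    (∫ x, f x ∂ν) ^ 2 ≤ W * ∫ x, w x * f x ^ 2 ∂ν := by
  set m := ∫ x, f x ∂ν with hm
  -- The square of f - (m/W) v, integrated against the weight w, where v is the inverse of w.
  have h0 : 0 ≤ ∫ x, (w x * f x ^ 2 - 2 * (m / W) * f x + (m / W) ^ 2 * v x) ∂ν := by
    refine integral_nonneg_of_ae ?_
    filter_upwards [hw, hvw] with x h1 h2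
    have : w x * f x ^ 2 - 2 * (m / W) * f x + (m / W) ^ 2 * v x =
        w x * (f x - m / W * v x) ^ 2 := by
      have e : w x * (f x - m / W * v x) ^ 2 = w x * f x ^ 2 - 2 * (m / W) * f x * (w x * v x) +
        (m / W) ^ 2 * v x * (w x * v x) := by ring
      rw [e, h2]
      ring
    rw [Pi.zero_apply, this]
    exact mul_nonneg h1 (sq_nonneg _)
  have i3 : Integrable (fun x ↦ 2 * (m / W) * f x) ν := i1.const_mul _
  have i4 : Integrable (fun x ↦ (m / W) ^ 2 * v x) ν := iv.const_mul _
  have i5 : Integrable (fun x ↦ w x * f x ^ 2 - 2 * (m / W) * f x) ν := i2.sub i3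
  rw [integral_add i5 i4, integral_sub i2 i3, integral_const_mul, integral_const_mul, ← hm] at h0
  have h1 : (m / W) ^ 2 * ∫ x, v x ∂ν ≤ m ^ 2 / W := by
    calc (m / W) ^ 2 * ∫ x, v x ∂ν ≤ (m / W) ^ 2 * W := by gcongr
      _ = m ^ 2 / W := by field_simp
  have h2 : 2 * (m / W) * m = 2 * (m ^ 2 / W) := by ring
  rw [← div_le_iff₀' hW]
  linarith

section Potential

variable {α β : Measure (EuclideanSpace ℝ (Fin d))} [IsFiniteMeasure α] [IsFiniteMeasure β]

lemma integrableOn_sint_heat {δ T : ℝ} (hδ : 0 < δ) (z : EuclideanSpace ℝ (Fin d)) :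
    IntegrableOn (fun t ↦ sint α β fun x ↦ heat t (z - x)) (Ioc δ T) := by
  obtain ⟨M, -, hM⟩ := exists_sint_heat_bound (α := α) (β := β) (T := T) hδ
  refine Measure.integrableOn_of_bounded (M := M) measure_Ioc_lt_top.ne
    (measurable_sint_heat.comp measurable_prodMk_right).aestronglyMeasurable ?_
  filter_upwards [ae_restrict_mem measurableSet_Ioc] with t ht
  exact hM t (Ioc_subset_Icc_self ht) z

lemma sint_heatInt_add {a b c : ℝ} (ha : 0 < a) (hab : a ≤ b) (hbc : b ≤ c)
    (z : EuclideanSpace ℝ (Fin d)) :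
    (sint α β fun x ↦ heatInt a c (z - x)) =
      (sint α β fun x ↦ heatInt a b (z - x)) + sint α β fun x ↦ heatInt b c (z - x) := by
  rw [sint_heatInt ha, sint_heatInt ha, sint_heatInt (ha.trans_le hab),
    ← Ioc_union_Ioc_eq_Ioc hab hbc]
  exact setIntegral_union (Ioc_disjoint_Ioc_of_le le_rfl) measurableSet_Ioc
    (integrableOn_sint_heat ha z) (integrableOn_sint_heat (ha.trans_le hab) z)

lemma setIntegral_sform_heat_mono {a b a' b' : ℝ} (ha : 0 < a') (h1 : a' ≤ a) (h2 : b ≤ b') :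
    ∫ t in Ioc a b, sform α β (heat t) ≤ ∫ t in Ioc a' b', sform α β (heat t) := by
  refine setIntegral_mono_set (integrableOn_sform_heat ha) ?_
    (Ioc_subset_Ioc h1 h2).eventuallyLE
  filter_upwards [ae_restrict_mem measurableSet_Ioc] with t ht
  exact sform_heat_nonneg (ha.trans ht.1)

/-- The contribution of small times to the `L²` norm of the potential. -/
lemma setIntegral_sq_sint_heatInt_le {δ : ℝ} (hδ : 0 < δ) (hδ1 : δ ≤ 1)
    {Ω : Set (EuclideanSpace ℝ (Fin d))} (hΩ : volume Ω < ⊤) :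
    ∫ z in Ω, (sint α β fun x ↦ heatInt δ 1 (z - x)) ^ 2 ≤
      ∫ t in Ioc (2 * δ) 2, sform α β (heat t) := by
  have : IsFiniteMeasure (volume.restrict Ω) := ⟨by rwa [Measure.restrict_apply_univ]⟩
  obtain ⟨M, hM0, hM⟩ := exists_sint_heat_bound (α := α) (β := β) (T := 1) hδ
  have hi : Integrable (fun p : ℝ × EuclideanSpace ℝ (Fin d) ↦
      (sint α β fun x ↦ heat p.1 (p.2 - x)) ^ 2)
      ((volume.restrict (Ioc δ 1)).prod (volume.restrict Ω)) := by
    refine integrable_time_prod (C := M ^ 2) (g := fun _ ↦ 1)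
      (measurable_sint_heat.pow_const 2).aestronglyMeasurable (integrable_const _) fun t ht z ↦ ?_
    rw [norm_pow, mul_one]
    exact pow_le_pow_left₀ (norm_nonneg _) (hM t (Ioc_subset_Icc_self ht) z) 2
  have h1 : ∀ z, Integrable (fun t ↦ (sint α β fun x ↦ heat t (z - x)) ^ 2)
      (volume.restrict (Ioc δ 1)) := by
    intro z
    refine Measure.integrableOn_of_bounded (M := M ^ 2) measure_Ioc_lt_top.ne
      ((measurable_sint_heat.comp measurable_prodMk_right).pow_const 2).aestronglyMeasurable ?_
    filter_upwards [ae_restrict_mem measurableSet_Ioc] with t ht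
    rw [norm_pow]
    exact pow_le_pow_left₀ (norm_nonneg _) (hM t (Ioc_subset_Icc_self ht) z) 2
  have h2 : ∀ z, (sint α β fun x ↦ heatInt δ 1 (z - x)) ^ 2 ≤
      ∫ t in Ioc δ 1, (sint α β fun x ↦ heat t (z - x)) ^ 2 := by
    intro z
    rw [sint_heatInt hδ]
    -- Unit weights suffice, as the interval (δ, 1] has length at most 1.
    have := sq_integral_le_weight (ν := volume.restrict (Ioc δ 1)) (w := fun _ ↦ 1)
      (v := fun _ ↦ 1) (W := 1) (f := fun t ↦ sint α β fun x ↦ heat t (z - x))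
      (by simp) (by simp) one_pos (by simp [hδ1]; linarith) (integrable_const _)
      (integrableOn_sint_heat hδ z) (by simpa using h1 z)
    simpa using this
  -- Enlarging Ω to the whole space gives the squared L² norm of the flow at time t, which is the
  -- form at time 2t.
  have h3 : ∀ t ∈ Ioc δ 1, ∫ z in Ω, (sint α β fun x ↦ heat t (z - x)) ^ 2 ≤
      sform α β (heat (2 * t)) := by
    intro t ht
    obtain ⟨i2, e2⟩ := integral_sint_heat_sq (α := α) (β := β)
      (by linarith [ht.1] : (0 : ℝ) < 2 * t)
    rw [mul_div_cancel_left₀ t two_ne_zero] at i2 e2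
    rw [← e2]
    exact setIntegral_le_integral i2 (Filter.Eventually.of_forall fun _ ↦ sq_nonneg _)
  have h4 : ∫ t in Ioc δ 1, sform α β (heat (2 * t)) =
      2⁻¹ * ∫ t in Ioc (2 * δ) 2, sform α β (heat t) := by
    have := intervalIntegral.integral_comp_mul_left (fun t ↦ sform α β (heat t)) (a := δ) (b := 1)
      (c := 2) two_ne_zero
    rwa [intervalIntegral.integral_of_le hδ1, mul_one,
      intervalIntegral.integral_of_le (by linarith), smul_eq_mul] at this
  have i4 : IntegrableOn (fun t ↦ sform α β (heat (2 * t))) (Ioc δ 1) := by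
    have := (integrableOn_sform_heat (α := α) (β := β) (T := 2) (by linarith : 0 < 2 * δ))
    rw [← intervalIntegrable_iff_integrableOn_Ioc_of_le (by linarith)] at this
    have h := this.comp_mul_left (c := 2)
    rw [mul_div_cancel_left₀ δ two_ne_zero, div_self two_ne_zero,
      intervalIntegrable_iff_integrableOn_Ioc_of_le hδ1] at h
    exact h
  calc ∫ z in Ω, (sint α β fun x ↦ heatInt δ 1 (z - x)) ^ 2
      ≤ ∫ z in Ω, ∫ t in Ioc δ 1, (sint α β fun x ↦ heat t (z - x)) ^ 2 :=
        integral_mono_of_nonneg (Filter.Eventually.of_forall fun _ ↦ sq_nonneg _)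
          hi.integral_prod_right (Filter.Eventually.of_forall h2)
    _ = ∫ t in Ioc δ 1, ∫ z in Ω, (sint α β fun x ↦ heat t (z - x)) ^ 2 :=
        (integral_integral_swap
          (f := fun t z ↦ (sint α β fun x ↦ heat t (z - x)) ^ 2) hi).symm
    _ ≤ ∫ t in Ioc δ 1, sform α β (heat (2 * t)) :=
        setIntegral_mono_on hi.integral_prod_left i4 measurableSet_Ioc h3
    _ ≤ ∫ t in Ioc (2 * δ) 2, sform α β (heat t) := by
        rw [h4]
        have : 0 ≤ ∫ t in Ioc (2 * δ) 2, sform α β (heat t) :=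
          setIntegral_nonneg measurableSet_Ioc fun t ht ↦ sform_heat_nonneg (by linarith [ht.1])
        linarith

/-- The contribution of large times to the potential. -/
lemma sq_sint_heatInt_le (hd : 3 ≤ d) {T : ℝ} (z : EuclideanSpace ℝ (Fin d)) :
    (sint α β fun x ↦ heatInt 1 T (z - x)) ^ 2 ≤ 2 * ∫ t in Ioc 1 T, sform α β (heat t) := by
  have hI := integrableOn_Ioi_rpow_of_lt (a := -(3 / 2)) (by norm_num) one_pos
  have hpos : ∀ᵐ t ∂(volume.restrict (Ioc (1 : ℝ) T)), (1 : ℝ) < t := by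
    filter_upwards [ae_restrict_mem measurableSet_Ioc] with t ht using ht.1
  -- For d ≥ 3 the decay t^(-d/2) of p_t(0) pays for the weight t^(3/2), whose inverse has integral
  -- 2 over (1, ∞).
  have hle : ∀ t : ℝ, 1 < t →
      t ^ (3 / 2 : ℝ) * (sint α β fun x ↦ heat t (z - x)) ^ 2 ≤ sform α β (heat t) := by
    intro t ht
    have ht0 : 0 < t := by linarith
    have hq := sform_heat_nonneg (α := α) (β := β) ht0
    have h4 : (1 : ℝ) ≤ 4 * Real.pi := by linarith [Real.pi_gt_three]
    have h3 : (3 : ℝ) ≤ d := by exact_mod_cast hd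
    have h1 : t ^ (3 / 2 : ℝ) * (4 * Real.pi * t) ^ (-(d : ℝ) / 2) ≤ 1 := by
      calc t ^ (3 / 2 : ℝ) * (4 * Real.pi * t) ^ (-(d : ℝ) / 2)
          ≤ t ^ (3 / 2 : ℝ) * t ^ (-(d : ℝ) / 2) := by
            refine mul_le_mul_of_nonneg_left ?_ (by positivity)
            refine Real.rpow_le_rpow_of_nonpos ht0 (le_mul_of_one_le_left ht0.le h4) ?_
            linarith
        _ = t ^ (3 / 2 + -(d : ℝ) / 2) := (Real.rpow_add ht0 _ _).symm
        _ ≤ 1 := Real.rpow_le_one_of_one_le_of_nonpos ht.le (by linarith)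
    calc t ^ (3 / 2 : ℝ) * (sint α β fun x ↦ heat t (z - x)) ^ 2
        ≤ t ^ (3 / 2 : ℝ) * ((4 * Real.pi * t) ^ (-(d : ℝ) / 2) * sform α β (heat t)) := by
          gcongr
          exact sq_sint_heat_le ht0 z
      _ = t ^ (3 / 2 : ℝ) * (4 * Real.pi * t) ^ (-(d : ℝ) / 2) * sform α β (heat t) := by ring
      _ ≤ sform α β (heat t) := mul_le_of_le_one_left hq h1
  have i2 : Integrable (fun t ↦ t ^ (3 / 2 : ℝ) * (sint α β fun x ↦ heat t (z - x)) ^ 2)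
      (volume.restrict (Ioc 1 T)) := by
    refine (integrableOn_sform_heat (α := α) (β := β) one_pos).mono' ?_ ?_
    · exact ((measurable_id.pow_const _).mul
        ((measurable_sint_heat.comp measurable_prodMk_right).pow_const 2)).aestronglyMeasurable
    · filter_upwards [hpos] with t ht
      have ht0 : 0 < t := by linarith
      rw [Real.norm_of_nonneg (by positivity)]
      exact hle t ht
  rw [sint_heatInt one_pos]
  refine (sq_integral_le_weight (v := fun t ↦ t ^ (-(3 / 2) : ℝ)) (w := fun t ↦ t ^ (3 / 2 : ℝ))
    ?_ ?_ two_pos ?_ (hI.mono_set Ioc_subset_Ioi_self) (integrableOn_sint_heat one_pos z)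
    i2).trans ?_
  · filter_upwards [hpos] with t ht
    positivity
  · filter_upwards [hpos] with t ht
    rw [← Real.rpow_add (by linarith)]
    simp
  · refine (setIntegral_mono_set hI ?_ Ioc_subset_Ioi_self.eventuallyLE).trans ?_
    · filter_upwards [ae_restrict_mem measurableSet_Ioi] with t ht
      have : (0 : ℝ) < t := lt_trans one_pos ht
      positivity
    · rw [integral_Ioi_rpow_of_lt (by norm_num) one_pos]
      norm_num
  · refine mul_le_mul_of_nonneg_left ?_ zero_le_two
    refine integral_mono_ae i2 (integrableOn_sform_heat one_pos) ?_
    filter_upwards [hpos] with t ht using hle t ht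

/-- The `L²` norm of the potential of a measure in a set of finite volume. -/
lemma setIntegral_sq_potential_le (hd : 3 ≤ d) {δ T : ℝ} (hδ : 0 < δ) (hδ1 : δ ≤ 1) (hT : 2 ≤ T)
    {Ω : Set (EuclideanSpace ℝ (Fin d))} (hΩ : volume Ω < ⊤) :
    ∫ z in Ω, (sint α β fun x ↦ heatInt δ T (z - x)) ^ 2 ≤
      (2 + 4 * volume.real Ω) * ∫ t in Ioc δ T, sform α β (heat t) := by
  have : IsFiniteMeasure (volume.restrict Ω) := ⟨by rwa [Measure.restrict_apply_univ]⟩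
  set Q := ∫ t in Ioc δ T, sform α β (heat t) with hQ
  obtain ⟨M, hM0, hM⟩ := exists_heatInt_bound (d := d) hδ hδ1
  have hc := continuous_sint_shift (α := α) (β := β) (continuous_heatInt (T := 1) hδ) fun x ↦
    ((hM x).1).trans (mul_le_of_le_one_right hM0 (envelope_le_one one_pos x))
  have i1 : Integrable (fun z ↦ (sint α β fun x ↦ heatInt δ 1 (z - x)) ^ 2)
      (volume.restrict Ω) := by
    refine Integrable.of_bound (hc.pow 2).aestronglyMeasurable
      ((M * (α.real univ + β.real univ)) ^ 2) (Filter.Eventually.of_forall fun z ↦ ?_)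
    rw [norm_pow]
    refine pow_le_pow_left₀ (norm_nonneg _) (norm_sint_le fun x ↦ ?_) 2
    exact ((hM (z - x)).1).trans (mul_le_of_le_one_right hM0 (envelope_le_one one_pos _))
  -- (a + b)² ≤ 2a² + 2b², where the large time part satisfies b² ≤ 2Q.
  have h1 : ∀ z, (sint α β fun x ↦ heatInt δ T (z - x)) ^ 2 ≤
      2 * (sint α β fun x ↦ heatInt δ 1 (z - x)) ^ 2 + 4 * Q := by
    intro z
    have hQ1 : ∫ t in Ioc 1 T, sform α β (heat t) ≤ Q :=
      setIntegral_sform_heat_mono hδ hδ1 le_rfl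
    have := sq_sint_heatInt_le (α := α) (β := β) (T := T) hd z
    rw [sint_heatInt_add hδ hδ1 (by linarith)]
    nlinarith [sq_nonneg ((sint α β fun x ↦ heatInt δ 1 (z - x)) -
      sint α β fun x ↦ heatInt 1 T (z - x))]
  have h2 : ∫ t in Ioc (2 * δ) 2, sform α β (heat t) ≤ Q :=
    setIntegral_sform_heat_mono hδ (by linarith) hT
  have h3 := setIntegral_sq_sint_heatInt_le (α := α) (β := β) hδ hδ1 hΩ
  calc ∫ z in Ω, (sint α β fun x ↦ heatInt δ T (z - x)) ^ 2
      ≤ ∫ z in Ω, (2 * (sint α β fun x ↦ heatInt δ 1 (z - x)) ^ 2 + 4 * Q) :=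
        integral_mono_of_nonneg (Filter.Eventually.of_forall fun _ ↦ sq_nonneg _)
          ((i1.const_mul 2).add (integrable_const _)) (Filter.Eventually.of_forall h1)
    _ = 2 * (∫ z in Ω, (sint α β fun x ↦ heatInt δ 1 (z - x)) ^ 2) + volume.real Ω * (4 * Q) := by
        rw [integral_add (i1.const_mul 2) (integrable_const _), integral_const_mul, integral_const,
          smul_eq_mul, measureReal_restrict_apply_univ]
    _ ≤ _ := by linarith

end Potential

/-! ### The truncated potential as an H¹ function -/

section Potential

variable {α β : Measure (EuclideanSpace ℝ (Fin d))} [IsFiniteMeasure α] [IsFiniteMeasure β]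

lemma integral_potential_mul_fderiv {δ T : ℝ} (hδ : 0 < δ) (hδT : δ ≤ T)
    {φ : EuclideanSpace ℝ (Fin d) → ℝ} (hφ : ContDiff ℝ ∞ φ) (hφc : HasCompactSupport φ)
    (v : EuclideanSpace ℝ (Fin d)) :
    ∫ z, (sint α β fun x ↦ heatInt δ T (z - x)) * fderiv ℝ φ z v =
      -∫ z, inner ℝ (sint α β fun x ↦ gradInt δ T (z - x)) v * φ z := by
  obtain ⟨M, hM0, hM⟩ := exists_heatInt_bound (d := d) hδ hδT
  have hT : 0 < T := hδ.trans_le hδT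
  have b1 : ∀ x : EuclideanSpace ℝ (Fin d), ‖heatInt δ T x‖ ≤ M := fun x ↦
    ((hM x).1).trans (mul_le_of_le_one_right hM0 (envelope_le_one hT x))
  have b2 : ∀ x : EuclideanSpace ℝ (Fin d), ‖gradInt δ T x‖ ≤ M := fun x ↦
    ((hM x).2).trans (mul_le_of_le_one_right hM0 (envelope_le_one hT x))
  have w1 : Integrable fun z ↦ fderiv ℝ φ z v :=
    ((hφ.continuous_fderiv (by simp)).clm_apply continuous_const).integrable_of_hasCompactSupport
      ((hφc.fderiv ℝ).comp_left (g := fun L : EuclideanSpace ℝ (Fin d) →L[ℝ] ℝ ↦ L v) (by simp))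
  have w2 : Integrable fun z ↦ φ z • v :=
    (hφ.continuous.integrable_of_hasCompactSupport hφc).smul_const v
  have e1 := integral_inner_sint_shift (α := α) (β := β) w1 (continuous_heatInt hδ) b1
  have e2 := integral_inner_sint_shift (α := α) (β := β) w2 (continuous_gradInt hδ) b2
  simp only [real_inner_smul_left] at e2
  simp only [RCLike.inner_apply, conj_trivial] at e1
  rw [e1]
  simp_rw [integral_heatInt_mul_fderiv hδ _ v hφ hφc, mul_comm _ (φ _), real_inner_comm v]
  rw [e2]
  simp only [sint, integral_neg]
  ring

/-- The time truncated potential is of class `H¹` in sets of finite volume. -/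
lemma isH1_potential {δ T : ℝ} (hδ : 0 < δ) (hδT : δ ≤ T)
    {Ω : Set (EuclideanSpace ℝ (Fin d))} (hΩ : volume Ω < ⊤) :
    IsH1 Ω (fun z ↦ sint α β fun x ↦ heatInt δ T (z - x))
      fun z ↦ sint α β fun x ↦ gradInt δ T (z - x) := by
  have : IsFiniteMeasure (volume.restrict Ω) := ⟨by rwa [Measure.restrict_apply_univ]⟩
  obtain ⟨M, hM0, hM⟩ := exists_heatInt_bound (d := d) hδ hδT
  have hT : 0 < T := hδ.trans_le hδT
  have b1 : ∀ x : EuclideanSpace ℝ (Fin d), ‖heatInt δ T x‖ ≤ M := fun x ↦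
    ((hM x).1).trans (mul_le_of_le_one_right hM0 (envelope_le_one hT x))
  have b2 : ∀ x : EuclideanSpace ℝ (Fin d), ‖gradInt δ T x‖ ≤ M := fun x ↦
    ((hM x).2).trans (mul_le_of_le_one_right hM0 (envelope_le_one hT x))
  refine ⟨?_, ?_, fun φ hφ hφc hs v ↦ ?_⟩
  · exact MemLp.of_bound (continuous_sint_shift (continuous_heatInt hδ) b1).aestronglyMeasurable _
      (Filter.Eventually.of_forall fun z ↦ norm_sint_le fun x ↦ b1 _)
  · exact MemLp.of_bound (continuous_sint_shift (continuous_gradInt hδ) b2).aestronglyMeasurable _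
      (Filter.Eventually.of_forall fun z ↦ norm_sint_le fun x ↦ b2 _)
  · rw [setIntegral_eq_integral_of_forall_compl_eq_zero, setIntegral_eq_integral_of_forall_compl_eq_zero,
      integral_potential_mul_fderiv hδ hδT hφ hφc v]
    · intro x hx
      rw [image_eq_zero_of_notMem_tsupport fun h ↦ hx (hs h), mul_zero]
    · intro x hx
      have : fderiv ℝ φ x = 0 :=
        image_eq_zero_of_notMem_tsupport fun h ↦ hx (hs (tsupport_fderiv_subset ℝ h))
      rw [this, zero_apply, mul_zero]

/-- The bound for the gradient of the potential involves times up to T + δ instead of T. On the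
excess interval the heat kernel is at most 1, so the excess is O(δ). -/
lemma setIntegral_sform_heat_le {T δ : ℝ} (hT : 1 ≤ T) (hδ : 0 ≤ δ) :
    ∫ t in Ioc T (T + δ), sform α β (heat t) ≤ δ * (α.prod α + β.prod β).real univ := by
  have h1 : ∀ t ∈ Ioc T (T + δ), sform α β (heat t) ≤ (α.prod α + β.prod β).real univ := by
    intro t ht
    have ht1 : 1 < t := hT.trans_lt ht.1
    have ht0 : 0 < t := by linarith
    have hle : ∀ x : EuclideanSpace ℝ (Fin d), heat t x ≤ 1 := fun x ↦ by
      refine (heat_le ht0 x).trans (Real.rpow_le_one_of_one_le_of_nonpos ?_ ?_)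
      · nlinarith [Real.pi_gt_three]
      · rw [neg_div]
        exact neg_nonpos.2 (by positivity)
    have h2 : ∫ p, heat t (p.1 - p.2) ∂(α.prod α + β.prod β) ≤ (α.prod α + β.prod β).real univ := by
      refine (integral_mono (integrable_heat_sub ht0 _) (integrable_const 1) fun p ↦ hle _).trans ?_
      simp
    have h3 : 0 ≤ ∫ p, heat t (p.1 - p.2) ∂(α.prod β + β.prod α) :=
      integral_nonneg fun p ↦ (heat_pos ht0 _).le
    rw [sform]
    linarith
  refine (setIntegral_mono_on (integrableOn_sform_heat (by linarith))
    (integrableOn_const measure_Ioc_lt_top.ne) measurableSet_Ioc h1).trans ?_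
  rw [setIntegral_const, Real.volume_real_Ioc_of_le (by linarith), add_sub_cancel_left, smul_eq_mul]

/-- The `H¹` norm of the time truncated potential. -/
lemma sq_h1Norm_potential_le (hd : 3 ≤ d) {δ T : ℝ} (hδ : 0 < δ) (hδ1 : δ ≤ 1) (hT : 2 ≤ T)
    {Ω : Set (EuclideanSpace ℝ (Fin d))} (hΩ : volume Ω < ⊤) :
    h1Norm Ω (fun z ↦ sint α β fun x ↦ heatInt δ T (z - x))
      (fun z ↦ sint α β fun x ↦ gradInt δ T (z - x)) ^ 2 ≤
      (3 + 4 * volume.real Ω) * (∫ t in Ioc δ T, sform α β (heat t)) +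
        δ * (α.prod α + β.prod β).real univ := by
  obtain ⟨i1, h1⟩ := integral_sint_gradInt_sq (α := α) (β := β) hδ (by linarith : δ ≤ T)
  have h2 : ∫ z in Ω, ‖sint α β fun x ↦ gradInt δ T (z - x)‖ ^ 2 ≤
      ∫ z, ‖sint α β fun x ↦ gradInt δ T (z - x)‖ ^ 2 :=
    setIntegral_le_integral i1 (Filter.Eventually.of_forall fun _ ↦ sq_nonneg _)
  have h3 : ∫ t in Ioc (δ + δ) (T + δ), sform α β (heat t) ≤
      ∫ t in Ioc δ (T + δ), sform α β (heat t) :=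
    setIntegral_sform_heat_mono hδ (by linarith) le_rfl
  have h4 : ∫ t in Ioc δ (T + δ), sform α β (heat t) =
      (∫ t in Ioc δ T, sform α β (heat t)) + ∫ t in Ioc T (T + δ), sform α β (heat t) := by
    rw [← Ioc_union_Ioc_eq_Ioc (by linarith : δ ≤ T) (by linarith : T ≤ T + δ)]
    exact setIntegral_union (Ioc_disjoint_Ioc_of_le le_rfl) measurableSet_Ioc
      (integrableOn_sform_heat hδ) (integrableOn_sform_heat (by linarith))
  have h5 := setIntegral_sform_heat_le (α := α) (β := β) (by linarith : 1 ≤ T) hδ.le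
  have h6 := setIntegral_sq_potential_le (α := α) (β := β) hd hδ hδ1 hT hΩ
  rw [h1Norm, Real.sq_sqrt (add_nonneg (integral_nonneg fun _ ↦ sq_nonneg _)
    (integral_nonneg fun _ ↦ sq_nonneg _))]
  linarith

end Potential

/-! ### The dual norm controls the energy -/

section Upper

variable {K : Set (EuclideanSpace ℝ (Fin d))} {μ : SignedMeasure (EuclideanSpace ℝ (Fin d))}

/-- The supremum defining the dual norm is tested with the truncated potential of μ, whose pairing
with μ is the left side. -/
lemma setIntegral_sform_heat_le_mul_h1Norm (hK : IsCompact K) (hN : hMinusOneNorm K μ ≠ ⊤) {δ T : ℝ}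
    (hδ : 0 < δ) (hδT : δ ≤ T) :
    ∫ t in Ioc δ T, sform μ.toJordanDecomposition.posPart μ.toJordanDecomposition.negPart
      (heat t) ≤ (hMinusOneNorm K μ).toReal * h1Norm (interior K)
        (fun z ↦ sint μ.toJordanDecomposition.posPart μ.toJordanDecomposition.negPart
          fun x ↦ heatInt δ T (z - x))
        (fun z ↦ sint μ.toJordanDecomposition.posPart μ.toJordanDecomposition.negPart
          fun x ↦ gradInt δ T (z - x)) := by
  set α := μ.toJordanDecomposition.posPart with hα
  set β := μ.toJordanDecomposition.negPart with hβ
  obtain ⟨M, hM0, hM⟩ := exists_heatInt_bound (d := d) hδ hδT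
  have b1 : ∀ x : EuclideanSpace ℝ (Fin d), ‖heatInt δ T x‖ ≤ M := fun x ↦
    ((hM x).1).trans (mul_le_of_le_one_right hM0 (envelope_le_one (hδ.trans_le hδT) x))
  set U : EuclideanSpace ℝ (Fin d) → ℝ := fun z ↦ sint α β fun x ↦ heatInt δ T (z - x) with hU
  set V : EuclideanSpace ℝ (Fin d) → EuclideanSpace ℝ (Fin d) :=
    fun z ↦ sint α β fun x ↦ gradInt δ T (z - x) with hV
  have hUc : Continuous U := continuous_sint_shift (continuous_heatInt hδ) b1
  have hUb : ∀ z, ‖U z‖ ≤ M * (α.real univ + β.real univ) := fun z ↦ norm_sint_le fun x ↦ b1 _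
  have hΩ : volume (interior K) < ⊤ := (measure_mono interior_subset).trans_lt hK.measure_lt_top
  have h1 : ENNReal.ofReal (∫ᵛ x, U x ∂<•μ) / ENNReal.ofReal (h1Norm (interior K) U V) ≤
      hMinusOneNorm K μ :=
    le_iSup_of_le U (le_iSup_of_le V (le_iSup_of_le hUc.continuousOn
      (le_iSup_of_le (isH1_potential hδ hδT hΩ) le_rfl)))
  have hi : ∀ γ : Measure (EuclideanSpace ℝ (Fin d)), IsFiniteMeasure γ → Integrable U γ :=
    fun γ _ ↦ Integrable.of_bound hUc.aestronglyMeasurable _ (Filter.Eventually.of_forall hUb)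
  rw [integral_signedMeasure μ (hi _ inferInstance) (hi _ inferInstance), ← hα, ← hβ, hU,
    sint_sint_shift (continuous_heatInt hδ) b1, sform_heatInt hδ, ← hU] at h1
  have h2 := (ENNReal.div_le_iff_le_mul (Or.inr hN) (Or.inl ENNReal.ofReal_ne_top)).1 h1
  rw [← ENNReal.ofReal_toReal hN, ← ENNReal.ofReal_mul ENNReal.toReal_nonneg] at h2
  exact (ENNReal.ofReal_le_ofReal_iff (mul_nonneg ENNReal.toReal_nonneg (Real.sqrt_nonneg _))).1 h2

/-- The quadratic forms of the heat kernels are controlled by the `H⁻¹` norm. -/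
lemma setIntegral_sform_heat_le_sq (hd : 3 ≤ d) (hK : IsCompact K) (hN : hMinusOneNorm K μ ≠ ⊤)
    {a b : ℝ} (ha : 0 < a) :
    ∫ t in Ioc a b, sform μ.toJordanDecomposition.posPart μ.toJordanDecomposition.negPart
      (heat t) ≤ (3 + 4 * volume.real (interior K)) * (hMinusOneNorm K μ).toReal ^ 2 := by
  set α := μ.toJordanDecomposition.posPart with hα
  set β := μ.toJordanDecomposition.negPart with hβ
  set n := (hMinusOneNorm K μ).toReal with hn
  have hn0 : 0 ≤ n := ENNReal.toReal_nonneg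
  set B := 3 + 4 * volume.real (interior K) with hB
  set m := (α.prod α + β.prod β).real univ with hm
  have hm0 : 0 ≤ m := measureReal_nonneg
  have hΩ : volume (interior K) < ⊤ := (measure_mono interior_subset).trans_lt hK.measure_lt_top
  refine le_of_forall_pos_le_add fun η hη ↦ ?_
  -- δ is so small that the O(δ) error of the H¹ norm, multiplied by n², is below η².
  obtain ⟨δ, hδ, hδa, hδ1, hδη⟩ : ∃ δ : ℝ, 0 < δ ∧ δ ≤ a ∧ δ ≤ 1 ∧ n ^ 2 * (δ * m) ≤ η ^ 2 := by
    refine ⟨min (min a 1) (η ^ 2 / (n ^ 2 * m + 1)), by positivity,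
      (min_le_left _ _).trans (min_le_left _ _), (min_le_left _ _).trans (min_le_right _ _), ?_⟩
    have h1 := min_le_right (min a 1) (η ^ 2 / (n ^ 2 * m + 1))
    rw [le_div_iff₀ (by positivity)] at h1
    have h2 : 0 < min (min a 1) (η ^ 2 / (n ^ 2 * m + 1)) := by positivity
    nlinarith
  set Q := ∫ t in Ioc δ (max b 2), sform α β (heat t) with hQ
  have hQ0 : 0 ≤ Q := setIntegral_nonneg measurableSet_Ioc fun t ht ↦
    sform_heat_nonneg (hδ.trans ht.1)
  have h1 : ∫ t in Ioc a b, sform α β (heat t) ≤ Q :=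
    setIntegral_sform_heat_mono hδ hδa (le_max_left _ _)
  have h2 := setIntegral_sform_heat_le_mul_h1Norm (μ := μ) hK hN hδ
    (by linarith [le_max_right b 2] : δ ≤ max b 2)
  have h3 := sq_h1Norm_potential_le (α := α) (β := β) hd hδ hδ1 (le_max_right b 2) hΩ
  rw [← hQ, ← hB, ← hm] at h3
  rw [← hα, ← hβ, ← hQ, ← hn] at h2
  refine h1.trans (not_lt.1 fun hlt ↦ ?_)
  -- If Q > B n² + η, then Q² > B n² Q + η Q ≥ B n² Q + η², against this inequality and the choice
  -- of δ.
  have h4 : Q ^ 2 ≤ n ^ 2 * (B * Q + δ * m) := by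
    refine (pow_le_pow_left₀ hQ0 h2 2).trans ?_
    rw [mul_pow]
    gcongr
  have hB0 : 0 ≤ B * n ^ 2 := by positivity
  nlinarith

end Upper

section Upper

variable {K : Set (EuclideanSpace ℝ (Fin d))} {μ : SignedMeasure (EuclideanSpace ℝ (Fin d))}

lemma kernel_nonneg (hd : 3 ≤ d) (x : EuclideanSpace ℝ (Fin d)) : 0 ≤ kernel d x := by
  rw [kernel, if_neg (by lia)]
  exact div_nonneg (kernelConst_pos (by lia)).le (by positivity)

/-- A monotone limit from bounded time intervals. -/
lemma lintegral_Ioi_le_of_forall_Ioc {q : ℝ → ℝ} {D : ℝ}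
    (hq : ∀ t, 0 < t → 0 ≤ q t) (hi : ∀ a b, 0 < a → IntegrableOn q (Ioc a b))
    (h : ∀ a b, 0 < a → ∫ t in Ioc a b, q t ≤ D) :
    ∫⁻ t in Ioi (0 : ℝ), ENNReal.ofReal (q t) ≤ ENNReal.ofReal D := by
  have hmono : Monotone fun n : ℕ ↦ Ioc (1 / ((n : ℝ) + 1)) n := by
    intro n m hnm
    have : (n : ℝ) ≤ m := by exact_mod_cast hnm
    refine Ioc_subset_Ioc ?_ this
    gcongr
  have hU : Ioi (0 : ℝ) = ⋃ n : ℕ, Ioc (1 / ((n : ℝ) + 1)) n := by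
    ext t
    simp only [mem_Ioi, mem_iUnion, mem_Ioc]
    constructor
    · intro ht
      obtain ⟨n, hn⟩ := exists_nat_one_div_lt ht
      obtain ⟨m, hm⟩ := exists_nat_ge t
      refine ⟨max n m, lt_of_le_of_lt ?_ hn, hm.trans (by exact_mod_cast le_max_right n m)⟩
      gcongr
      exact le_max_left n m
    · rintro ⟨n, h1, -⟩
      exact lt_trans (by positivity) h1
  rw [hU, setLIntegral_iUnion_of_directed _ hmono.directed_le]
  refine iSup_le fun n ↦ ?_
  have h0 : (0 : ℝ) < 1 / ((n : ℝ) + 1) := by positivity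
  rw [← ofReal_integral_eq_lintegral_ofReal (hi _ _ h0)]
  · exact ENNReal.ofReal_le_ofReal (h _ _ h0)
  · filter_upwards [ae_restrict_mem measurableSet_Ioc] with t ht using hq t (h0.trans ht.1)

/-- The comparison of the energy with the quadratic forms of the heat kernels. -/
lemma mul_energyPos_le (hd : 3 ≤ d) {A : ℝ} (hA : ∀ x : EuclideanSpace ℝ (Fin d), x ≠ 0 →
      ∫⁻ t in Ioi (0 : ℝ), ENNReal.ofReal (heat t x) = ENNReal.ofReal (A * kernel d x))
    (hA0 : 0 < A) {D : ℝ}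
    (hD : ∀ a b, 0 < a → ∫ t in Ioc a b, sform μ.toJordanDecomposition.posPart
      μ.toJordanDecomposition.negPart (heat t) ≤ D) :
    ENNReal.ofReal A * energyPos μ ≤ ENNReal.ofReal D + ENNReal.ofReal A * energyNeg μ := by
  set α := μ.toJordanDecomposition.posPart with hα
  set β := μ.toJordanDecomposition.negPart with hβ
  have e2 := offDiagNeg_eq (μ := μ)
  rw [← hα, ← hβ] at e2
  -- The only place where atoms intervene: removing the diagonal lowers the positive part, while the
  -- negative part does not charge it (`e2`).
  have hP : offDiagPos μ ≤ α.prod α + β.prod β := Measure.restrict_le_self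
  have hfin : IsFiniteMeasure (offDiagPos μ) := by unfold offDiagPos; infer_instance
  have hmeas : Measurable fun q : ℝ × (EuclideanSpace ℝ (Fin d) × EuclideanSpace ℝ (Fin d)) ↦
      ENNReal.ofReal (heat q.1 (q.2.1 - q.2.2)) := measurable_heat_sub.ennreal_ofReal
  have hk : ∀ N : Measure (EuclideanSpace ℝ (Fin d) × EuclideanSpace ℝ (Fin d)),
      IsFiniteMeasure N → (∀ᵐ p ∂N, p ∈ (diagonal (EuclideanSpace ℝ (Fin d)))ᶜ) →
      ENNReal.ofReal A * ∫⁻ p, ENNReal.ofReal (kernel d (p.1 - p.2)) ∂N =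
        ∫⁻ t in Ioi (0 : ℝ), ∫⁻ p, ENNReal.ofReal (heat t (p.1 - p.2)) ∂N := by
    intro N _ hN
    rw [lintegral_lintegral_swap hmeas.aemeasurable,
      ← lintegral_const_mul _ measurable_kernel_sub.ennreal_ofReal]
    refine lintegral_congr_ae ?_
    filter_upwards [hN] with p hp
    rw [hA _ (sub_ne_zero.2 hp), ENNReal.ofReal_mul hA0.le]
  have hm : MeasurableSet (diagonal (EuclideanSpace ℝ (Fin d)))ᶜ :=
    isClosed_diagonal.measurableSet.compl
  have h1 : energyPos μ = ∫⁻ p, ENNReal.ofReal (kernel d (p.1 - p.2)) ∂offDiagPos μ := by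
    rw [energyPos]
    simp [ENNReal.ofReal_of_nonpos (neg_nonpos.2 (kernel_nonneg hd _))]
  have h2 : ∫⁻ p, ENNReal.ofReal (kernel d (p.1 - p.2)) ∂offDiagNeg μ ≤ energyNeg μ :=
    le_add_self
  have h3 : ∀ t ∈ Ioi (0 : ℝ), ∫⁻ p, ENNReal.ofReal (heat t (p.1 - p.2)) ∂offDiagPos μ ≤
      ENNReal.ofReal (sform α β (heat t)) +
        ∫⁻ p, ENNReal.ofReal (heat t (p.1 - p.2)) ∂offDiagNeg μ := by
    intro t ht
    have hb : ∀ N : Measure (EuclideanSpace ℝ (Fin d) × EuclideanSpace ℝ (Fin d)),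
        IsFiniteMeasure N → ∫⁻ p, ENNReal.ofReal (heat t (p.1 - p.2)) ∂N =
          ENNReal.ofReal (∫ p, heat t (p.1 - p.2) ∂N) := fun N _ ↦
      (ofReal_integral_eq_lintegral_ofReal (integrable_heat_sub ht N)
        (Filter.Eventually.of_forall fun p ↦ (heat_pos ht _).le)).symm
    refine (lintegral_mono' hP le_rfl).trans ?_
    rw [e2, hb _ inferInstance, hb _ inferInstance, ← ENNReal.ofReal_add (sform_heat_nonneg ht)
      (integral_nonneg fun p ↦ (heat_pos ht _).le), sform, sub_add_cancel]
  have h4 : ∫⁻ t in Ioi (0 : ℝ), ENNReal.ofReal (sform α β (heat t)) ≤ ENNReal.ofReal D :=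
    lintegral_Ioi_le_of_forall_Ioc (fun t ht ↦ sform_heat_nonneg ht)
      (fun a b ha ↦ integrableOn_sform_heat ha) hD
  have hn : ∀ᵐ p ∂offDiagNeg μ, p ∈ (diagonal (EuclideanSpace ℝ (Fin d)))ᶜ := by
    unfold offDiagNeg
    exact ae_restrict_mem hm
  have hfin2 : IsFiniteMeasure (offDiagNeg μ) := by unfold offDiagNeg; infer_instance
  calc ENNReal.ofReal A * energyPos μ
      = ∫⁻ t in Ioi (0 : ℝ), ∫⁻ p, ENNReal.ofReal (heat t (p.1 - p.2)) ∂offDiagPos μ := by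
        rw [h1, hk _ hfin (by unfold offDiagPos; exact ae_restrict_mem hm)]
    _ ≤ ∫⁻ t in Ioi (0 : ℝ), (ENNReal.ofReal (sform α β (heat t)) +
          ∫⁻ p, ENNReal.ofReal (heat t (p.1 - p.2)) ∂offDiagNeg μ) :=
        setLIntegral_mono' measurableSet_Ioi h3
    _ = (∫⁻ t in Ioi (0 : ℝ), ENNReal.ofReal (sform α β (heat t))) +
          ENNReal.ofReal A * ∫⁻ p, ENNReal.ofReal (kernel d (p.1 - p.2)) ∂offDiagNeg μ := by
        rw [lintegral_add_right _ hmeas.lintegral_prod_right', hk _ hfin2 hn]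
    _ ≤ _ := by gcongr

/-- If Q is infinite, the difference is -∞ in `EReal`, even for P = ∞, and its `toENNReal` is 0.
Otherwise Q can be moved to the other side. -/
lemma toENNReal_sub_le {P Q R : ℝ≥0∞} (h : P ≤ R + Q) :
    ((P : EReal) - (Q : EReal)).toENNReal ≤ R := by
  by_cases hQ : Q = ⊤
  · simp [hQ]
  by_cases hR : R = ⊤
  · simp [hR]
  have hP : P ≠ ⊤ := ne_top_of_le_ne_top (ENNReal.add_ne_top.2 ⟨hR, hQ⟩) h
  lift P to ℝ≥0 using hP
  lift Q to ℝ≥0 using hQ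
  lift R to ℝ≥0 using hR
  have h' : (P : ℝ) ≤ R + Q := by exact_mod_cast h
  have e : ((P : ℝ≥0∞) : EReal) - ((Q : ℝ≥0∞) : EReal) = (((P : ℝ) - Q : ℝ) : EReal) := by
    rw [EReal.coe_sub]
    rfl
  rw [e, EReal.toENNReal_of_ne_top (EReal.coe_ne_top _), EReal.toReal_coe,
    ← ENNReal.ofReal_coe_nnreal (p := R)]
  exact ENNReal.ofReal_le_ofReal (by linarith)

/-- The `H⁻¹` norm controls the energy. -/
theorem exists_sqrtEnergy_le (hd : 3 ≤ d) (hK : IsCompact K) :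
    ∃ c : ℝ≥0, 0 < c ∧ ∀ μ : SignedMeasure (EuclideanSpace ℝ (Fin d)),
      sqrtEnergy μ ≤ (c : ℝ≥0∞)⁻¹ * hMinusOneNorm K μ := by
  obtain ⟨A, hA0, hA⟩ := exists_kernel_eq (by lia : 2 ≤ d)
  have hA' : ∀ x : EuclideanSpace ℝ (Fin d), x ≠ 0 →
      ∫⁻ t in Ioi (0 : ℝ), ENNReal.ofReal (heat t x) = ENNReal.ofReal (A * kernel d x) := by
    intro x hx
    simpa [heatShift, (by lia : d ≠ 2)] using (hA x hx).1
  set B := 3 + 4 * volume.real (interior K) with hB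
  have hB0 : 0 < B := by positivity
  have hC : 0 < √(B / A) := Real.sqrt_pos.2 (div_pos hB0 hA0)
  -- The bound 𝓔 ≤ (B/A) n², with n the dual norm, makes √(B/A) the constant c⁻¹.
  refine ⟨(Real.toNNReal √(B / A))⁻¹, inv_pos.2 (Real.toNNReal_pos.2 hC), fun μ ↦ ?_⟩
  rw [ENNReal.coe_inv (Real.toNNReal_pos.2 hC).ne', inv_inv]
  by_cases hN : hMinusOneNorm K μ = ⊤
  · rw [hN, ENNReal.mul_top (ENNReal.coe_ne_zero.2 (Real.toNNReal_pos.2 hC).ne')]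
    exact le_top
  set n := (hMinusOneNorm K μ).toReal with hn
  have hn0 : 0 ≤ n := ENNReal.toReal_nonneg
  have h1 := mul_energyPos_le (μ := μ) hd hA' hA0 (D := B * n ^ 2) fun a b ha ↦
    setIntegral_sform_heat_le_sq hd hK hN ha
  have h2 : energyPos μ ≤ ENNReal.ofReal (B / A * n ^ 2) + energyNeg μ := by
    rw [← ENNReal.mul_le_mul_iff_right (ENNReal.ofReal_pos.2 hA0).ne' ENNReal.ofReal_ne_top,
      mul_add, ← ENNReal.ofReal_mul hA0.le]
    refine h1.trans_eq ?_
    congr 2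
    field_simp
  have h3 : sqrtEnergy μ ≤ ENNReal.ofReal (B / A * n ^ 2) ^ (1 / 2 : ℝ) :=
    ENNReal.rpow_le_rpow (toENNReal_sub_le h2) (by norm_num)
  refine h3.trans_eq ?_
  rw [ENNReal.ofReal_rpow_of_nonneg (by positivity) (by norm_num), ← Real.sqrt_eq_rpow,
    Real.sqrt_mul (by positivity), Real.sqrt_sq hn0, ENNReal.ofReal_mul (Real.sqrt_nonneg _),
    ENNReal.ofReal_toReal hN]
  rfl

end Upper


end

end Coulomb

theorem mainTheorem9 (d : ℕ) (K : Set (EuclideanSpace ℝ (Fin d))) (hK : IsCompact K) :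
    (d = 2 → Coulomb.HasLipschitzBoundary K →
      ∃ C : ℝ≥0, 0 < C ∧ ∀ μ : SignedMeasure (EuclideanSpace ℝ (Fin d)),
        Coulomb.IsOn μ K → μ univ = 0 → (∀ x, μ {x} = 0) → Coulomb.EnergyDefined μ →
          0 ≤ Coulomb.energy μ ∧ Coulomb.hMinusOneNorm K μ ≤ C * Coulomb.sqrtEnergy μ) ∧
    (3 ≤ d →
      (Coulomb.HasLipschitzBoundary K →
        ∃ C : ℝ≥0, 0 < C ∧ ∀ μ : SignedMeasure (EuclideanSpace ℝ (Fin d)),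
          Coulomb.IsOn μ K → (∀ x, μ {x} = 0) → Coulomb.EnergyDefined μ →
            0 ≤ Coulomb.energy μ ∧ Coulomb.hMinusOneNorm K μ ≤ C * Coulomb.sqrtEnergy μ) ∧
      ∃ c : ℝ≥0, 0 < c ∧ ∀ μ : SignedMeasure (EuclideanSpace ℝ (Fin d)),
        Coulomb.IsOn μ K → μ univ ≠ 0 → Coulomb.EnergyDefined μ →
          Coulomb.sqrtEnergy μ ≤ (c : ℝ≥0∞)⁻¹ * Coulomb.hMinusOneNorm K μ) := by
  refine ⟨fun h2 hL ↦ ?_, fun h3 ↦ ⟨fun hL ↦ ?_, ?_⟩⟩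
  · obtain ⟨C, hC, h⟩ := Coulomb.exists_hMinusOneNorm_le h2.ge hK hL
    exact ⟨C, hC, fun μ hμ h0 hat hdef ↦ h μ hμ (fun _ ↦ h0) hat hdef⟩
  · obtain ⟨C, hC, h⟩ := Coulomb.exists_hMinusOneNorm_le (by lia) hK hL
    exact ⟨C, hC, fun μ hμ hat hdef ↦ h μ hμ (fun h2 ↦ by lia) hat hdef⟩
  · obtain ⟨c, hc, h⟩ := Coulomb.exists_sqrtEnergy_le h3 hK
    exact ⟨c, hc, fun μ _ _ _ ↦ h μ⟩
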